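/- **Setting.** Let $a,b\in\mathbb R$, $q,r>0$, $\gamma\in(0,1)$, $b\ne0$, $|a|\le 1-\delta_0$ and $0<\delta<\delta_0$. Let $\rho$ be a probability measure on $\mathbb R$ with $\mathbb E_\rho[x_0^2\mathbf 1_{x_0\ge0}]=\mathbb E_\rho[x_0^2\mathbf 1_{x_0<0}]=\sigma^2/2$, $\sigma>0$. For a feedback law $\mu:\mathbb R\to\mathbb R$ let $x_{t+1}=ax_t+b\mu(x_t)$, $J_\mu(x_0)=\sum_{t\ge0}\gamma^t(qx_t^2+r\mu(x_t)^2)$ and $\mathcal J(\mu)=\mathbb E_{x_0\sim\rho}[J_\mu(x_0)]$. Let $P^\star>0$ solve $P=q+\gamma a^2P-\frac{(\gamma abP)^2}{r+\gamma b^2P}$, let $K^\star=-\frac{\gamma abP^\star}{r+\gamma b^2P^\star}$ and $\mu^\star(x)=K^\star x$. For $K=(K_1,K_2)$ let $\mathcal J(K)$ be the cost of the law $x\mapsto K_1x$ for $x\ge0$, $x\mapsto K_2x$ for $x<0$, let $\mathcal K_d=\{K:|a+bK_1|\le1-d,\ |a+bK_2|\le1-d\}$, and identify $\mu^\star$ with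 $(K^\star,K^\star)$. The safe set is $\mathcal K_{\delta/2}$. The controller is the ReLU network $\mu_\theta(x)=\sum_{i=1}^m v_i\max(0,w_ix)$, $\theta=(w,v)\in\mathbb R^{2m}$, with effective gains $K_{1,\theta}=\sum_{w_j\ge0}v_jw_j$ and $K_{2,\theta}=\sum_{w_j<0}v_jw_j$. Policy gradient is $\theta_{k+1}=\theta_k-\eta_m\nabla_\theta\mathcal J(\mu_{\theta_k})$, $\eta_m=\iota/m$, where the ReLU has derivative $0$ at $0$. The initial weights are independent, $w_{j,0}\sim N(0,\beta/m)$ and $v_{j,0}\sim N(0,\beta^{-2}/m)$ (second argument: variance). **Constants.** Let $L>0$ be a Lipschitz constant of $\nabla_K\mathcal J$ on $\mathcal K_{\delta/2}$ and $\alpha>0$ be such that $\frac12\|\nabla_K\mathcal J(K)\|^2\ge\alpha(\mathcal J(K)-\mathcal J(\mu^\star))$ on $\mathcal K_{\delta/2}$. Put $d_0=1-\gamma(1-\frac\delta2)^2$, $K_{\max}=\frac{|a|+1-\delta/2}{|b|}$, $P_{\max}=\frac{q+rK_{\max}^2}{d_0}$, $G_{\max}=\frac{2\sqrt2\sigma^2}{d_0}\bigl(rK_{\max}+\gamma|b|(1-\frac\delta2)P_{\max}\bigr)$,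 $\kappa=(r+\gamma b^2P^\star)\frac{\sigma^2}2$ and $C_{\rm grad}=L^2/\kappa$. Let $0<s<S$, $V,\beta>0$, $\varepsilon\in(0,1)$ and $0<\iota<1/L$. Let $\Delta$ be any number with $\Delta>\mathcal J(0)-\mathcal J(\mu^\star)$, where $\mathcal J(0)$ is the cost of the zero law; the choice $\Delta=\sigma^2P_{\max}-\mathcal J(\mu^\star)$ is always allowed. With $\Phi$ the standard Gaussian distribution function put $\tau=s\sqrt\beta$, $W=S\sqrt\beta$, $c=(1-\varepsilon)(\Phi(S)-\Phi(s))(2\Phi(V\beta)-1)$, $\lambda_\ast=\frac{c\tau^2}4$, $B=\frac{2\sqrt{C_{\rm grad}\Delta}}{\lambda_\ast\alpha}$, $R_c=\sqrt{W^2+V^2}$, $R_\ast^2=(1+\varepsilon)(\beta^{-2}+\beta)$, $G_\ast=e^{2B}R_\ast^2$, $\tau_w=\frac{e^BB}{\sqrt{1-e^{2B}B^2}}V$. Let $M_w,M_v$ be numbers such that $$M_w>\mathbb E\sum_j(w_{j,0}^2+v_{j,0}^2)\mathbf 1_{|w_{j,0}|\le\tau_w/\sqrt m},\qquad M_v>\mathbb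 E\sum_j(w_{j,0}^2+v_{j,0}^2)\mathbf 1_{|v_{j,0}|>V/\sqrt m}$$ (the expectations are the same for all $m\ge1$), and put $\Xi_\ast=e^{2B}(M_w+M_v)$, $L_\ast=\frac32G_\ast+2\sqrt2\,\Xi_\ast$, $C_\ast=\frac12G_\ast G_{\max}+\frac L2L_\ast^2$. The pair $(\beta,m)$ is in the **benign width regime** if $\eta_mG_{\max}\le1$, $\eta_m\lambda_\ast\alpha\le1$, $e^BB<1$, $e^BBR_c\le\frac\tau2$, $2\sqrt2\,\Xi_\ast\le\frac{\lambda_\ast}4$, $\eta_mC_\ast\le\frac{\lambda_\ast}4$ and $|b|L_\ast B\le\frac\delta2$. **Theorem.** The gain $K^\star$ is the unique gain $K$ for which $x\mapsto Kx$ is stabilizing (all closed-loop trajectories tend to $0$) and has minimal expected cost among all stabilizing feedback laws, and constants $L,\alpha>0$ as above exist. For every choice of the constants above there are $C_0>0$ and $m_0\in\mathbb N$, not depending on $m$, such that for every $m\ge m_0$ with $(\beta,m)$ in the benign width regime, the number $$\rho_m=1-\eta_m\,\alpha\,(1-\varepsilon)\bigl(\Phi(S)-\Phi(s)\bigr)\bigl(2\Phi(V\beta)-1\bigr)\frac{s^2\beta}4$$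 lies in $[0,1)$, and with probability at least $1-e^{-C_0m}$ the following holds for all $k\ge0$: the cost of $\mu_{\theta_k}$ is finite, the partial derivatives of $\theta\mapsto\mathcal J(\mu_\theta)$ exist at $\theta_k$ (those in $w_j$ if $w_{j,k}\ne0$), $(K_{1,\theta_k},K_{2,\theta_k})\in\mathcal K_{\delta/2}$, $$\mathcal J(\mu_{\theta_k})-\mathcal J(\mu^\star)\le\rho_m^k\bigl(\mathcal J(\mu_{\theta_0})-\mathcal J(\mu^\star)\bigr),$$ $$(K_{1,\theta_k}-K^\star)^2+(K_{2,\theta_k}-K^\star)^2\le\frac{\mathcal J(\mu_{\theta_0})-\mathcal J(\mu^\star)}{(r+\gamma b^2P^\star)(\sigma^2/2)}\,\rho_m^k .$$ -/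

import Mathlib

open MeasureTheory ProbabilityTheory Filter Topology

noncomputable section

namespace ReLULQR

/-- The data of the scalar discounted LQR problem: dynamics `x⁺ = a x + b u`, stage cost
`q x² + r u²`, discount `γ`, second moment `σ²` of the initial state, stability margin `δ`, and
the Riccati coefficient `P`. The conditions on these numbers are stated in the theorem. -/
structure Problem where
  a : ℝ
  b : ℝ
  q : ℝ
  r : ℝ
  γ : ℝ
  σ : ℝ
  δ : ℝ
  P : ℝ

/-! ### Closed loop and cost -/

/-- The closed-loop trajectory of the feedback law `μ` from the state `x`. -/
def traj (p : Problem) (μ : ℝ → ℝ) (x : ℝ) : ℕ → ℝ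
  | 0 => x
  | t + 1 => p.a * traj p μ x t + p.b * μ (traj p μ x t)

/-- The discounted stage cost at time `t`. -/
def stage (p : Problem) (μ : ℝ → ℝ) (x : ℝ) (t : ℕ) : ℝ :=
  p.γ ^ t * (p.q * traj p μ x t ^ 2 + p.r * μ (traj p μ x t) ^ 2)

/-- The cost-to-go `J_μ(x)`. -/
def costToGo (p : Problem) (μ : ℝ → ℝ) (x : ℝ) : ℝ := ∑' t, stage p μ x t

/-- The expected cost `𝒥_ρ(μ) = 𝔼_{x₀ ∼ ρ} J_μ(x₀)`. -/
def cost (p : Problem) (ρ : Measure ℝ) (μ : ℝ → ℝ) : ℝ := ∫ x, costToGo p μ x ∂ρ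

/-- The expected cost with values in `[0, ∞]`, which makes sense for every feedback law. -/
def extCost (p : Problem) (ρ : Measure ℝ) (μ : ℝ → ℝ) : ENNReal :=
  ∫⁻ x, ∑' t, ENNReal.ofReal (stage p μ x t) ∂ρ

/-- Every closed-loop trajectory tends to `0`. -/
def Stabilizing (p : Problem) (μ : ℝ → ℝ) : Prop :=
  ∀ x, Tendsto (traj p μ x) atTop (𝓝 0)

/-- `x ↦ K x` is stabilizing and has the least expected cost among all stabilizing laws. -/
def IsOptimalGain (p : Problem) (ρ : Measure ℝ) (K : ℝ) : Prop :=
  Stabilizing p (fun x => K * x) ∧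
    ∀ μ : ℝ → ℝ, Stabilizing p μ → extCost p ρ (fun x => K * x) ≤ extCost p ρ μ

/-- `P` is the positive solution of the discounted algebraic Riccati equation. -/
def IsRiccati (p : Problem) : Prop :=
  0 < p.P ∧
    p.P = p.q + p.γ * p.a ^ 2 * p.P
      - (p.γ * p.a * p.b * p.P) ^ 2 / (p.r + p.γ * p.b ^ 2 * p.P)

/-- The LQR gain `K⋆ = - γ a b P / (r + γ b² P)`. -/
def Problem.Kstar (p : Problem) : ℝ :=
  -(p.γ * p.a * p.b * p.P) / (p.r + p.γ * p.b ^ 2 * p.P)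

/-- The cost `𝒥_ρ(μ⋆)` of the linear law `μ⋆(x) = K⋆ x`. -/
def optCost (p : Problem) (ρ : Measure ℝ) : ℝ := cost p ρ (fun x => p.Kstar * x)

/-! ### Two-gain controllers -/

/-- The piecewise linear law with gain `K 0` on `x ≥ 0` and gain `K 1` on `x < 0`. -/
def gainLaw (K : EuclideanSpace ℝ (Fin 2)) (x : ℝ) : ℝ :=
  if 0 ≤ x then K 0 * x else K 1 * x

/-- The expected cost as a function of the two gains. -/
def gainCost (p : Problem) (ρ : Measure ℝ) (K : EuclideanSpace ℝ (Fin 2)) : ℝ :=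
  cost p ρ (gainLaw K)

/-- The set `𝒦_d` of gain pairs with stability margin `d`. -/
def margin (p : Problem) (d : ℝ) : Set (EuclideanSpace ℝ (Fin 2)) :=
  {K | |p.a + p.b * K 0| ≤ 1 - d ∧ |p.a + p.b * K 1| ≤ 1 - d}

/-- The gain pair `μ⋆ = (K⋆, K⋆)`. -/
def optGains (p : Problem) : EuclideanSpace ℝ (Fin 2) := !₂[p.Kstar, p.Kstar]

/-- `L` is a Lipschitz constant of `∇_μ 𝒥_ρ` on the safe set `𝒦_{δ/2}`. -/
def IsSmoothConst (p : Problem) (ρ : Measure ℝ) (L : ℝ) : Prop :=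
  ∀ K ∈ margin p (p.δ / 2), ∀ K' ∈ margin p (p.δ / 2),
    ‖gradient (gainCost p ρ) K - gradient (gainCost p ρ) K'‖ ≤ L * ‖K - K'‖

/-- `α` is a Polyak–Łojasiewicz constant of `𝒥_ρ` on the safe set `𝒦_{δ/2}`. -/
def IsPLConst (p : Problem) (ρ : Measure ℝ) (α : ℝ) : Prop :=
  ∀ K ∈ margin p (p.δ / 2),
    α * (gainCost p ρ K - optCost p ρ) ≤ 1 / 2 * ‖gradient (gainCost p ρ) K‖ ^ 2

/-! ### The ReLU network and policy gradient -/

/-- The weights `θ = (w, v)` of a network of width `m`. -/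
abbrev Weights (m : ℕ) : Type := (Fin m → ℝ) × (Fin m → ℝ)

/-- The bias-free one-hidden-layer ReLU controller `μ_θ(x) = ∑ᵢ vᵢ max(0, wᵢ x)`. -/
def net {m : ℕ} (θ : Weights m) (x : ℝ) : ℝ := ∑ i, θ.2 i * max 0 (θ.1 i * x)

/-- The effective gains `(K₁, K₂)`. -/
def gains {m : ℕ} (θ : Weights m) : EuclideanSpace ℝ (Fin 2) :=
  !₂[∑ j with 0 ≤ θ.1 j, θ.2 j * θ.1 j, ∑ j with θ.1 j < 0, θ.2 j * θ.1 j]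

/-- The objective as a function of the weight `w_j` alone. -/
def costW (p : Problem) (ρ : Measure ℝ) {m : ℕ} (θ : Weights m) (j : Fin m) (t : ℝ) : ℝ :=
  cost p ρ (net (Function.update θ.1 j t, θ.2))

/-- The objective as a function of the weight `v_j` alone. -/
def costV (p : Problem) (ρ : Measure ℝ) {m : ℕ} (θ : Weights m) (j : Fin m) (t : ℝ) : ℝ :=
  cost p ρ (net (θ.1, Function.update θ.2 j t))

/-- The partial derivative in `w_j`. At `w_j = 0`, where it need not exist, the convention
`max(0, ·)'(0) = 0` for the derivative of the ReLU gives the value `0`. -/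
def gradW (p : Problem) (ρ : Measure ℝ) {m : ℕ} (θ : Weights m) (j : Fin m) : ℝ :=
  if θ.1 j = 0 then 0 else deriv (costW p ρ θ j) (θ.1 j)

/-- The partial derivative in `v_j`. -/
def gradV (p : Problem) (ρ : Measure ℝ) {m : ℕ} (θ : Weights m) (j : Fin m) : ℝ :=
  deriv (costV p ρ θ j) (θ.2 j)

/-- One step `θ - η ∇_θ 𝒥_ρ(θ)`. -/
def pgStep (p : Problem) (ρ : Measure ℝ) (η : ℝ) {m : ℕ} (θ : Weights m) : Weights m :=
  (fun j => θ.1 j - η * gradW p ρ θ j, fun j => θ.2 j - η * gradV p ρ θ j)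

/-- The policy gradient iterates `θ_k`. -/
def iter (p : Problem) (ρ : Measure ℝ) (η : ℝ) {m : ℕ} (θ₀ : Weights m) (k : ℕ) : Weights m :=
  (pgStep p ρ η)^[k] θ₀

/-- At `θ` the cost is a convergent sum and a convergent integral, and the partial derivatives
that make up the policy gradient exist. -/
def WellPosed (p : Problem) (ρ : Measure ℝ) {m : ℕ} (θ : Weights m) : Prop :=
  (∀ x, Summable (stage p (net θ) x)) ∧ Integrable (costToGo p (net θ)) ρ ∧
    (∀ j, θ.1 j ≠ 0 → DifferentiableAt ℝ (costW p ρ θ j) (θ.1 j)) ∧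
    ∀ j, DifferentiableAt ℝ (costV p ρ θ j) (θ.2 j)

/-- The law of the initialization: all weights independent, `w_j ∼ N(0, β/m)` and
`v_j ∼ N(0, β⁻²/m)`. -/
def initLaw (β : ℝ) (m : ℕ) : Measure (Weights m) :=
  (Measure.pi fun _ : Fin m => gaussianReal 0 (β / m).toNNReal).prod
    (Measure.pi fun _ : Fin m => gaussianReal 0 ((β ^ 2)⁻¹ / m).toNNReal)

/-- The standard Gaussian distribution function. -/
def Phi (x : ℝ) : ℝ := cdf (gaussianReal 0 1) x

/-! ### The constants of the benign width regime -/

/-- The free constants of the regime: smoothness and PL constants `L`, `α`, the numbers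
`s, S, V, β, ε`, a bound `Δ` for the initial cost gap, and the thresholds `Mw`, `Mv`. -/
structure Hyper where
  L : ℝ
  α : ℝ
  s : ℝ
  S : ℝ
  V : ℝ
  β : ℝ
  ε : ℝ
  Δ : ℝ
  Mw : ℝ
  Mv : ℝ

/-- `K_max`, a bound for the gains in the safe set. -/
def Problem.Kmax (p : Problem) : ℝ := (|p.a| + (1 - p.δ / 2)) / |p.b|

/-- `d₀ = 1 - γ (1 - δ/2)²`. -/
def Problem.d0 (p : Problem) : ℝ := 1 - p.γ * (1 - p.δ / 2) ^ 2

/-- `P_max = (q + r K_max²) / d₀`. -/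
def Problem.Pmax (p : Problem) : ℝ := (p.q + p.r * p.Kmax ^ 2) / p.d0

/-- `G_max`, a bound for `‖∇_μ 𝒥_ρ‖` on the safe set. -/
def Problem.Gmax (p : Problem) : ℝ :=
  2 * √2 * p.σ ^ 2 * (p.r * p.Kmax + p.γ * |p.b| * (1 - p.δ / 2) * p.Pmax) / p.d0

/-- The coefficient `(r + γ b² P⋆) σ²/2` of the quadratic growth bound. -/
def Problem.growth (p : Problem) : ℝ := (p.r + p.γ * p.b ^ 2 * p.P) * (p.σ ^ 2 / 2)

/-- `σ² P_max - 𝒥_ρ(μ⋆)`, a bound for the cost gap on the whole safe set. -/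
def gapMax (p : Problem) (ρ : Measure ℝ) : ℝ := p.σ ^ 2 * p.Pmax - optCost p ρ

namespace Hyper

variable (p : Problem) (h : Hyper)

/-- `C_grad = L² / ((r + γ b² P⋆) σ²/2)`. -/
def Cgrad : ℝ := h.L ^ 2 / p.growth

/-- `τ = s √β`. -/
def tau : ℝ := h.s * √h.β

/-- `W = S √β`. -/
def W : ℝ := h.S * √h.β

/-- `c = (1 - ε) (Φ(S) - Φ(s)) (2 Φ(Vβ) - 1)`. -/
def c : ℝ := (1 - h.ε) * (Phi h.S - Phi h.s) * (2 * Phi (h.V * h.β) - 1)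

/-- `λ⋆ = c τ² / 4`. -/
def lamStar : ℝ := h.c * h.tau ^ 2 / 4

/-- `B = 2 √(C_grad Δ) / (λ⋆ α)`. -/
def B : ℝ := 2 * √(h.Cgrad p * h.Δ) / (h.lamStar * h.α)

/-- `R_c = √(W² + V²)`. -/
def Rc : ℝ := √(h.W ^ 2 + h.V ^ 2)

/-- `R⋆² = (1 + ε) (β⁻² + β)`. -/
def RstarSq : ℝ := (1 + h.ε) * ((h.β ^ 2)⁻¹ + h.β)

/-- `G⋆ = e^{2B} R⋆²`. -/
def Gstar : ℝ := Real.exp (2 * h.B p) * h.RstarSq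

/-- `Ξ⋆ = e^{2B} (M_w + M_v)`. -/
def XiStar : ℝ := Real.exp (2 * h.B p) * (h.Mw + h.Mv)

/-- `L⋆ = (3/2) G⋆ + 2 √2 Ξ⋆`. -/
def Lstar : ℝ := 3 / 2 * h.Gstar p + 2 * √2 * h.XiStar p

/-- `C⋆ = (1/2) G⋆ G_max + (L/2) L⋆²`. -/
def Cstar : ℝ := 1 / 2 * h.Gstar p * p.Gmax + h.L / 2 * h.Lstar p ^ 2

/-- `τ_w = e^B B V / √(1 - e^{2B} B²)`. -/
def tauW : ℝ :=
  Real.exp (h.B p) * h.B p / √(1 - Real.exp (2 * h.B p) * h.B p ^ 2) * h.V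

/-- The mass of the neurons with `|w_j| ≤ τ_w / √m`. -/
def massW {m : ℕ} (θ : Weights m) : ℝ :=
  ∑ j with |θ.1 j| ≤ h.tauW p / √m, (θ.1 j ^ 2 + θ.2 j ^ 2)

/-- The mass of the neurons with `|v_j| > V / √m`. -/
def massV {m : ℕ} (θ : Weights m) : ℝ :=
  ∑ j with h.V / √m < |θ.2 j|, (θ.1 j ^ 2 + θ.2 j ^ 2)

/-- The thresholds `M_w`, `M_v` exceed the expected masses at initialization. -/
def ThresholdsOK (m : ℕ) : Prop :=
  ∫ θ, h.massW p θ ∂(initLaw h.β m) < h.Mw ∧ ∫ θ, h.massV θ ∂(initLaw h.β m) < h.Mv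

/-- The benign width regime, for width `m` and step size `ι / m`. -/
def Benign (ι : ℝ) (m : ℕ) : Prop :=
  ι / m * p.Gmax ≤ 1 ∧
  ι / m * h.lamStar * h.α ≤ 1 ∧
  Real.exp (h.B p) * h.B p < 1 ∧
  Real.exp (h.B p) * h.B p * h.Rc ≤ h.tau / 2 ∧
  2 * √2 * h.XiStar p ≤ h.lamStar / 4 ∧
  ι / m * h.Cstar p ≤ h.lamStar / 4 ∧
  |p.b| * h.Lstar p * h.B p ≤ p.δ / 2

/-- The rate `ρ_m = 1 - (ι/m) α (1 - ε) (Φ(S) - Φ(s)) (2 Φ(Vβ) - 1) s² β / 4`. -/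
def rate (ι : ℝ) (m : ℕ) : ℝ :=
  1 - ι / m * h.α * (1 - h.ε) * (Phi h.S - Phi h.s) * (2 * Phi (h.V * h.β) - 1)
    * (h.s ^ 2 * h.β) / 4

end Hyper

/-- The zero law costs less than `σ² P_max`. So `gapMax` is an admissible choice of `Δ`. -/
theorem zero_gap_lt_gapMax (p : Problem) (ρ : Measure ℝ) (hq : 0 < p.q)
    (hr : 0 < p.r) (hγ0 : 0 < p.γ) (hγ1 : p.γ < 1) (hσ : 0 < p.σ) (hδ : 0 < p.δ)
    (ha : |p.a| < 1 - p.δ)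
    (hpos : ∫ x in Set.Ici 0, x ^ 2 ∂ρ = p.σ ^ 2 / 2)
    (hneg : ∫ x in Set.Iio 0, x ^ 2 ∂ρ = p.σ ^ 2 / 2) :
    cost p ρ (fun _ => 0) - optCost p ρ < gapMax p ρ := by
  have htraj : ∀ x t, traj p (fun _ => 0) x t = p.a ^ t * x := by
    intro x t
    induction t with
    | zero => simp [traj]
    | succ t ih => simp only [traj, ih]; ring
  have h0 := abs_nonneg p.a
  have ha1 : p.a ^ 2 < (1 - p.δ / 2) ^ 2 := by
    rw [← sq_abs p.a]; exact pow_lt_pow_left₀ (by linarith) h0 (by norm_num)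
  have hy1 : (1 - p.δ / 2) ^ 2 < 1 := by nlinarith
  have hd : 0 < p.d0 := by unfold Problem.d0; nlinarith [sq_nonneg (1 - p.δ / 2)]
  have hlt : p.d0 < 1 - p.γ * p.a ^ 2 := by unfold Problem.d0; nlinarith
  have hctg : ∀ x, costToGo p (fun _ => 0) x = p.q / (1 - p.γ * p.a ^ 2) * x ^ 2 := by
    intro x
    have : ∀ t, stage p (fun _ => 0) x t = (p.γ * p.a ^ 2) ^ t * (p.q * x ^ 2) := by
      intro t; simp only [stage, htraj]; ring
    simp only [costToGo, this]
    rw [tsum_mul_right, tsum_geometric_of_lt_one (by positivity) (by linarith)]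
    ring
  have hint : ∀ s : Set ℝ, ∫ x in s, x ^ 2 ∂ρ = p.σ ^ 2 / 2 →
      IntegrableOn (fun x : ℝ => x ^ 2) s ρ := by
    intro s hs
    by_contra hn
    have := integral_undef hn
    rw [hs] at this
    have := pow_pos hσ 2
    linarith
  have hsq : ∫ x, x ^ 2 ∂ρ = p.σ ^ 2 := by
    have hu : (Set.Ici 0 ∪ Set.Iio 0 : Set ℝ) = Set.univ := by
      rw [Set.union_comm]; exact Set.Iio_union_Ici
    rw [← setIntegral_univ, ← hu, setIntegral_union _ measurableSet_Iio (hint _ hpos)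
      (hint _ hneg), hpos, hneg]
    · ring
    · rw [Set.disjoint_left]; exact fun x hx hx' => absurd (Set.mem_Iio.mp hx') (not_lt.mpr (Set.mem_Ici.mp hx))
  have hc : cost p ρ (fun _ => 0) = p.q / (1 - p.γ * p.a ^ 2) * p.σ ^ 2 := by
    simp only [cost, hctg]
    rw [integral_const_mul, hsq]
  have hk : p.q / (1 - p.γ * p.a ^ 2) < p.Pmax := by
    calc p.q / (1 - p.γ * p.a ^ 2) < p.q / p.d0 := div_lt_div_of_pos_left hq hd hlt
      _ ≤ p.Pmax := by
        unfold Problem.Pmax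
        gcongr
        nlinarith [sq_nonneg p.Kmax]
  unfold gapMax
  rw [hc]
  nlinarith [mul_lt_mul_of_pos_right hk (pow_pos hσ 2)]

end ReLULQR

end

noncomputable section

namespace ReLULQR

/-! A bias-free ReLU network on the line is a piecewise linear law with one gain per half line, so
it acts only through its two effective gains (`net_eq_gainLaw`). The cost in these gains is
explicit. Squares of states are carried between the half lines by a 2×2 matrix, because a
closed-loop coefficient either keeps the sign of the state or reverses it. The values solve a 2×2
Bellman system, and Cramer's rule gives a quotient that is continuously differentiable, since the
square of a positive part is. Differentiating the system yields the policy gradient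
(`Admissible.hasGradientAt`). Completing the square with the Riccati equation yields the performance
difference, hence quadratic growth and optimality of `Kstar`. Convexity of the squared positive part
yields the PL inequality (`gap_le_slope`).

A gradient step on the weights moves each gain by minus the gain gradient times the mass `∑ (w² +
v²)` of its class, up to a second-order term and an error from neurons that change sign
(`norm_gains_sub_drift_le`). If both masses stay above `lamStar` and the exceptional neurons carry
little mass, the descent lemma and PL give contraction by `rate`.

Convergence itself keeps the masses under control. Each neuron moves, relative to its norm, by at
most the step size times the gain gradient. That gradient is bounded by the square root of the cost
gap, so geometric decay makes the total relative movement at most `B`. `Admissible.converges` closes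
this loop by induction: decay bounds the movement, small movement preserves masses, classes and
safety, and these give the next step of decay.

The initial requirements concern empirical means of i.i.d. functions of quadratic growth. After
rescaling by `√m` the law of a neuron does not depend on `m`, so Chernoff bounds make every failure
exponentially unlikely (`Admissible.exists_goodInit`). The initial gains concentrate at `0`, which
is why `Δ` is compared with the cost of the zero law. -/

/-- The standing assumptions on the control problem and on the initial state. -/
structure Admissible (p : Problem) (δ₀ : ℝ) (ρ : Measure ℝ) : Prop where
  hq : 0 < p.q
  hr : 0 < p.r
  hγ0 : 0 < p.γ
  hγ1 : p.γ < 1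
  hb : p.b ≠ 0
  ha : |p.a| ≤ 1 - δ₀
  hδ : 0 < p.δ
  hδ₀ : p.δ < δ₀
  hσ : 0 < p.σ
  hpos : ∫ x in Set.Ici 0, x ^ 2 ∂ρ = p.σ ^ 2 / 2
  hneg : ∫ x in Set.Iio 0, x ^ 2 ∂ρ = p.σ ^ 2 / 2
  hP : IsRiccati p

/-! ### Squares of positive and negative parts -/

/-- The closed-loop coefficient of the gain `k`. -/
def Problem.cl (p : Problem) (k : ℝ) : ℝ := p.a + p.b * k

/-- The square of the positive part. -/
def sqPos (x : ℝ) : ℝ := max x 0 ^ 2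

lemma sqPos_nonneg (x : ℝ) : 0 ≤ sqPos x := sq_nonneg _

lemma sqPos_add_sqPos_neg (x : ℝ) : sqPos x + sqPos (-x) = x ^ 2 := by
  unfold sqPos
  rcases le_total 0 x with h | h
  · rw [max_eq_left h, max_eq_right (by linarith)]; ring
  · rw [max_eq_right h, max_eq_left (by linarith)]; ring

lemma sqPos_of_nonneg {x : ℝ} (h : 0 ≤ x) : sqPos x = x ^ 2 := by
  rw [sqPos, max_eq_left h]

lemma sqPos_of_nonpos {x : ℝ} (h : x ≤ 0) : sqPos x = 0 := by
  rw [sqPos, max_eq_right h]; norm_num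

/-- Convexity. It lets the future cost of another gain be bounded below by its linearization,
although the value function has different curvatures on the two half lines. -/
lemma sqPos_tangent (x y : ℝ) : sqPos x + 2 * max x 0 * (y - x) ≤ sqPos y := by
  unfold sqPos
  rcases le_total 0 x with h | h
  · rw [max_eq_left h]
    rcases le_total 0 y with h' | h'
    · rw [max_eq_left h']; nlinarith [sq_nonneg (x - y)]
    · rw [max_eq_right h']; nlinarith [mul_nonneg h (neg_nonneg.2 h')]
  · rw [max_eq_right h]; nlinarith [sq_nonneg (max y 0)]

/-- The square smooths the kink at `0`, so the cost stays differentiable when a closed-loop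
coefficient changes sign. -/
lemma hasDerivAt_sqPos (x : ℝ) : HasDerivAt sqPos (2 * max x 0) x := by
  rcases lt_trichotomy x 0 with h | h | h
  · have : sqPos =ᶠ[𝓝 x] fun _ => 0 := by
      filter_upwards [Iio_mem_nhds h] with y hy using sqPos_of_nonpos (le_of_lt hy)
    rw [max_eq_right h.le, mul_zero]
    exact (hasDerivAt_const x (0 : ℝ)).congr_of_eventuallyEq this
  · subst h
    rw [hasDerivAt_iff_isLittleO]
    simp only [max_self, mul_zero, smul_zero, sub_zero]
    have h0 : sqPos 0 = 0 := by simp [sqPos]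
    rw [h0]
    simp only [sub_zero]
    have : (fun x : ℝ => x ^ 2) =o[𝓝 0] fun x => x := by
      simpa using Asymptotics.isLittleO_pow_id (𝕜 := ℝ) (n := 2) (by norm_num)
    refine Asymptotics.IsBigO.trans_isLittleO (Asymptotics.IsBigO.of_bound 1 ?_) this
    refine Eventually.of_forall fun y => ?_
    rw [Real.norm_of_nonneg (sqPos_nonneg y), Real.norm_of_nonneg (sq_nonneg y)]
    linarith [sqPos_add_sqPos_neg y, sqPos_nonneg (-y)]
  · have : sqPos =ᶠ[𝓝 x] fun y => y ^ 2 := by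
      filter_upwards [Ioi_mem_nhds h] with y hy using sqPos_of_nonneg (le_of_lt hy)
    rw [max_eq_left h.le]
    simpa using (hasDerivAt_pow 2 x).congr_of_eventuallyEq this

/-! ### The value coefficients -/

/-- The determinant of `1 - γ M`, where `M` is the one-step transfer matrix of second moments. -/
def det (p : Problem) (k l : ℝ) : ℝ :=
  (1 - p.γ * sqPos (p.cl k)) * (1 - p.γ * sqPos (p.cl l))
    - p.γ * sqPos (-p.cl k) * (p.γ * sqPos (-p.cl l))

/-- The coefficient of the cost-to-go on the half line with gain `k`, when the other half line has
gain `l`. -/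
def val (p : Problem) (k l : ℝ) : ℝ :=
  ((p.q + p.r * k ^ 2) * (1 - p.γ * sqPos (p.cl l))
    + p.γ * sqPos (-p.cl k) * (p.q + p.r * l ^ 2)) / det p k l

/-- The discounted second moment of the states visited in the half line with gain `k`, divided by
`σ² / 2`. -/
def occ (p : Problem) (k l : ℝ) : ℝ :=
  ((1 - p.γ * sqPos (p.cl l)) + p.γ * sqPos (-p.cl l)) / det p k l

/-- The derivative in the action of the state-action value, at the state `1` with gain `k`. -/
def slope (p : Problem) (k l : ℝ) : ℝ :=
  2 * (p.r * k + p.γ * p.b * (max (p.cl k) 0 * val p k l - max (-p.cl k) 0 * val p l k))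

/-- The discounted closed loop of the gain `k` is a contraction. -/
def Contr (p : Problem) (k : ℝ) : Prop := p.γ * p.cl k ^ 2 < 1

section Values

variable {p : Problem} {k l : ℝ}

lemma det_comm : det p k l = det p l k := by unfold det; ring

lemma Contr.lt (hk : Contr p k) : p.γ * sqPos (-p.cl k) < 1 - p.γ * sqPos (p.cl k) := by
  have := sqPos_add_sqPos_neg (p.cl k)
  unfold Contr at hk
  rw [← this] at hk
  linarith

lemma Contr.pos (hγ : 0 < p.γ) (hk : Contr p k) : 0 < 1 - p.γ * sqPos (p.cl k) :=
  lt_of_le_of_lt (mul_nonneg hγ.le (sqPos_nonneg _)) hk.lt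

/-- Strict diagonal dominance of `1 - γ M`: in each row the diagonal entry exceeds the off-diagonal
one. -/
lemma det_pos (hγ : 0 < p.γ) (hk : Contr p k) (hl : Contr p l) : 0 < det p k l := by
  have h1 := hk.lt
  have h2 := hl.lt
  have h3 := mul_nonneg hγ.le (sqPos_nonneg (-p.cl k))
  have h4 := mul_nonneg hγ.le (sqPos_nonneg (-p.cl l))
  unfold det
  nlinarith [hk.pos hγ, hl.pos hγ]

lemma val_nonneg (hγ : 0 < p.γ) (hq : 0 < p.q) (hr : 0 < p.r) (hk : Contr p k) (hl : Contr p l) :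
    0 ≤ val p k l := by
  have h3 := mul_nonneg hγ.le (sqPos_nonneg (-p.cl k))
  have h2 := hl.pos hγ
  have h4 := det_pos hγ hk hl
  unfold val
  positivity

/-- `val` is Cramer's solution of the Bellman system of the two half lines: `sqPos (cl k)` is the
part that keeps its sign, `sqPos (-cl k)` the part that crosses. -/
lemma val_eq (hγ : 0 < p.γ) (hk : Contr p k) (hl : Contr p l) :
    val p k l = p.q + p.r * k ^ 2
      + p.γ * (sqPos (p.cl k) * val p k l + sqPos (-p.cl k) * val p l k) := by
  have h := (det_pos hγ hk hl).ne'
  have e : val p l k = ((p.q + p.r * l ^ 2) * (1 - p.γ * sqPos (p.cl k))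
    + p.γ * sqPos (-p.cl l) * (p.q + p.r * k ^ 2)) / det p k l := by rw [val, det_comm]
  rw [e, val]
  field_simp
  unfold det
  ring

/-- The initial state alone already contributes `1`. -/
lemma one_le_occ (hγ : 0 < p.γ) (hk : Contr p k) (hl : Contr p l) : 1 ≤ occ p k l := by
  have h := det_pos hγ hk hl
  have h1 := mul_nonneg hγ.le (sqPos_nonneg (-p.cl k))
  have h2 := mul_nonneg hγ.le (sqPos_nonneg (-p.cl l))
  have h3 := mul_nonneg hγ.le (sqPos_nonneg (p.cl k))
  rw [occ, le_div_iff₀ h]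
  unfold det
  nlinarith [hl.pos hγ, mul_nonneg h1 h2, mul_nonneg h3 (hl.pos hγ).le]

/-- Solution of the Bellman system with arbitrary stage costs `s`, `t`. -/
lemma sum_eq_of_bellman {x y s t : ℝ} (hγ : 0 < p.γ) (hk : Contr p k) (hl : Contr p l)
    (hx : x = s + p.γ * (sqPos (p.cl k) * x + sqPos (-p.cl k) * y))
    (hy : y = t + p.γ * (sqPos (p.cl l) * y + sqPos (-p.cl l) * x)) :
    x + y = occ p k l * s + occ p l k * t := by
  have h := (det_pos hγ hk hl).ne'
  have e : occ p l k = ((1 - p.γ * sqPos (p.cl k)) + p.γ * sqPos (-p.cl k)) / det p k l := by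
    rw [occ, det_comm]
  rw [e, occ]
  field_simp
  unfold det
  -- With the numerators of the two `occ` as weights, the coefficients of `x` and of `y` both become
  -- `det`.
  linear_combination ((1 - p.γ * sqPos (p.cl l)) + p.γ * sqPos (-p.cl l)) * hx +
    ((1 - p.γ * sqPos (p.cl k)) + p.γ * sqPos (-p.cl k)) * hy

/-- The constant values `1 / D` solve a Bellman system whose stage costs are at least `1`, so their
sum dominates the sum of the occupations. -/
lemma occ_add_occ_le {D : ℝ} (hγ : 0 < p.γ) (hk : p.γ * p.cl k ^ 2 ≤ 1 - D)
    (hl : p.γ * p.cl l ^ 2 ≤ 1 - D) (hD : 0 < D) : occ p k l + occ p l k ≤ 2 / D := by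
  have hk' : Contr p k := by unfold Contr; linarith
  have hl' : Contr p l := by unfold Contr; linarith
  have h := sum_eq_of_bellman (p := p) (k := k) (l := l) (x := 1 / D) (y := 1 / D)
    (s := 1 / D - p.γ * (sqPos (p.cl k) * (1 / D) + sqPos (-p.cl k) * (1 / D)))
    (t := 1 / D - p.γ * (sqPos (p.cl l) * (1 / D) + sqPos (-p.cl l) * (1 / D)))
    hγ hk' hl' (by ring) (by ring)
  have e1 : 1 ≤ 1 / D - p.γ * (sqPos (p.cl k) * (1 / D) + sqPos (-p.cl k) * (1 / D)) := by
    rw [← add_mul, sqPos_add_sqPos_neg]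
    have : 1 / D - p.γ * (p.cl k ^ 2 * (1 / D)) = (1 - p.γ * p.cl k ^ 2) / D := by ring
    rw [this, le_div_iff₀ hD]; linarith
  have e2 : 1 ≤ 1 / D - p.γ * (sqPos (p.cl l) * (1 / D) + sqPos (-p.cl l) * (1 / D)) := by
    rw [← add_mul, sqPos_add_sqPos_neg]
    have : 1 / D - p.γ * (p.cl l ^ 2 * (1 / D)) = (1 - p.γ * p.cl l ^ 2) / D := by ring
    rw [this, le_div_iff₀ hD]; linarith
  have h1 := one_le_occ hγ hk' hl'
  have h2 := one_le_occ hγ hl' hk'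
  have : 2 / D = 1 / D + 1 / D := by ring
  rw [this, h]
  nlinarith

/-- The value coefficients are at most the largest stage cost divided by `D`. -/
lemma val_le {D C : ℝ} (hγ : 0 < p.γ) (hk : p.γ * p.cl k ^ 2 ≤ 1 - D)
    (hl : p.γ * p.cl l ^ 2 ≤ 1 - D) (hD : 0 < D) (hkC : p.q + p.r * k ^ 2 ≤ C)
    (hlC : p.q + p.r * l ^ 2 ≤ C) (hC : 0 ≤ C) :
    val p k l ≤ C / D := by
  have hk' : Contr p k := by unfold Contr; linarith
  have hl' : Contr p l := by unfold Contr; linarith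
  -- Maximum principle: in the equation of the larger value, the smaller one may be replaced by the
  -- larger.
  have key : ∀ {k l : ℝ}, p.γ * p.cl k ^ 2 ≤ 1 - D → Contr p k → Contr p l →
      p.q + p.r * k ^ 2 ≤ C → val p l k ≤ val p k l → val p k l ≤ C / D := by
    intro k l hk hk' hl' hkC hle
    have e := val_eq hγ hk' hl'
    have h0 := mul_nonneg hγ.le (sqPos_nonneg (-p.cl k))
    rw [← sqPos_add_sqPos_neg] at hk
    have : val p k l * D ≤ C := by
      by_cases hv : 0 ≤ val p k l
      · nlinarith [mul_le_mul_of_nonneg_left hle h0, mul_le_mul_of_nonneg_right hk hv]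
      · nlinarith
    rwa [le_div_iff₀ hD]
  rcases le_total (val p l k) (val p k l) with h | h
  · exact key hk hk' hl' hkC h
  · exact h.trans (key hl hl' hk' hlC h)

/-- The one-step advantage of the optimal gain is bounded below by the slope. -/
lemma advantage_ge (hr : 0 < p.r) (hγ : 0 < p.γ) (hq : 0 < p.q) (hk : Contr p k) (hl : Contr p l) :
    -(slope p k l ^ 2) / (4 * p.r) ≤ p.q + p.r * p.Kstar ^ 2
      + p.γ * (sqPos (p.cl p.Kstar) * val p k l + sqPos (-p.cl p.Kstar) * val p l k)
      - val p k l := by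
  have e := val_eq hγ hk hl
  have v1 := mul_nonneg hγ.le (val_nonneg hγ hq hr hk hl)
  have v2 := mul_nonneg hγ.le (val_nonneg hγ hq hr hl hk)
  have t1 := mul_le_mul_of_nonneg_left (sqPos_tangent (p.cl k) (p.cl p.Kstar)) v1
  have t2 := mul_le_mul_of_nonneg_left (sqPos_tangent (-p.cl k) (-p.cl p.Kstar)) v2
  have hd : p.cl p.Kstar = p.cl k + p.b * (p.Kstar - k) := by unfold Problem.cl; ring
  -- The left side is the minimum of the quadratic in `Kstar - k` that remains after the future cost
  -- is linearized at `k`.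
  have h1 : -(slope p k l ^ 2) / (4 * p.r)
      ≤ slope p k l * (p.Kstar - k) + p.r * (p.Kstar - k) ^ 2 := by
    rw [div_le_iff₀ (by positivity)]
    nlinarith [sq_nonneg (slope p k l + 2 * p.r * (p.Kstar - k))]
  refine h1.trans ?_
  have hs : slope p k l = 2 * (p.r * k + p.γ * p.b *
    (max (p.cl k) 0 * val p k l - max (-p.cl k) 0 * val p l k)) := rfl
  rw [hs]
  generalize hx : max (p.cl k) 0 = mp at *
  generalize hy : max (-p.cl k) 0 = mn at *
  have d1 : p.cl p.Kstar - p.cl k = p.b * (p.Kstar - k) := by rw [hd]; ring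
  have d2 : -p.cl p.Kstar - -p.cl k = -(p.b * (p.Kstar - k)) := by rw [hd]; ring
  rw [d1] at t1
  rw [d2] at t2
  nlinarith [t1, t2, e]

/-! ### The Riccati solution -/

section Riccati

variable (hr : 0 < p.r) (hγ : 0 < p.γ) (hP : IsRiccati p)
include hr hγ hP

lemma riccati_denom_pos : 0 < p.r + p.γ * p.b ^ 2 * p.P := by
  have := hP.1
  positivity

lemma riccati_mul : (p.r + p.γ * p.b ^ 2 * p.P) * p.P
    = (p.r + p.γ * p.b ^ 2 * p.P) * (p.q + p.γ * p.a ^ 2 * p.P) - (p.γ * p.a * p.b * p.P) ^ 2 := by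
  have h := riccati_denom_pos hr hγ hP
  have e := hP.2
  generalize p.r + p.γ * p.b ^ 2 * p.P = R at *
  have : (p.γ * p.a * p.b * p.P) ^ 2 = R * ((p.γ * p.a * p.b * p.P) ^ 2 / R) := by
    field_simp
  rw [this]
  linear_combination R * e

lemma Kstar_mul : (p.r + p.γ * p.b ^ 2 * p.P) * p.Kstar = -(p.γ * p.a * p.b * p.P) := by
  have h := riccati_denom_pos hr hγ hP
  rw [Problem.Kstar]
  field_simp

/-- Completion of the square in the Bellman equation. -/
lemma bellman_square (x u : ℝ) :
    p.q * x ^ 2 + p.r * u ^ 2 + p.γ * p.P * (p.a * x + p.b * u) ^ 2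
      = p.P * x ^ 2 + (p.r + p.γ * p.b ^ 2 * p.P) * (u - p.Kstar * x) ^ 2 := by
  have h := riccati_denom_pos hr hγ hP
  have h1 := riccati_mul hr hγ hP
  have h2 := Kstar_mul hr hγ hP
  have h3 : ((p.r + p.γ * p.b ^ 2 * p.P) * p.Kstar) ^ 2 = (p.γ * p.a * p.b * p.P) ^ 2 := by
    rw [h2]; ring
  have : (p.r + p.γ * p.b ^ 2 * p.P) *
      (p.q * x ^ 2 + p.r * u ^ 2 + p.γ * p.P * (p.a * x + p.b * u) ^ 2)
      = (p.r + p.γ * p.b ^ 2 * p.P) *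
        (p.P * x ^ 2 + (p.r + p.γ * p.b ^ 2 * p.P) * (u - p.Kstar * x) ^ 2) := by
    linear_combination (-x^2) * h1 + 2 * u * x * (p.r + p.γ * p.b ^ 2 * p.P) * h2
      - x ^ 2 * h3
  exact mul_left_cancel₀ h.ne' this

lemma cl_Kstar_mul : (p.r + p.γ * p.b ^ 2 * p.P) * p.cl p.Kstar = p.a * p.r := by
  rw [Problem.cl]
  linear_combination p.b * Kstar_mul hr hγ hP

/-- The optimal closed loop is `a r / (r + γ b² P)`. Hence `Kstar` inherits the stability margin of
the open loop. -/
lemma abs_cl_Kstar_le : |p.cl p.Kstar| ≤ |p.a| := by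
  have h := riccati_denom_pos hr hγ hP
  have h1 := cl_Kstar_mul hr hγ hP
  have h2 := congrArg abs h1
  rw [abs_mul, abs_mul, abs_of_pos h, abs_of_pos hr] at h2
  have h3 : p.r ≤ p.r + p.γ * p.b ^ 2 * p.P := by
    have := hP.1
    have : 0 ≤ p.γ * p.b ^ 2 * p.P := by positivity
    linarith
  by_contra hlt
  push Not at hlt
  nlinarith [abs_nonneg p.a]

/-- Completing the square shows that the excess over `P` solves the same Bellman system, with stage
cost proportional to `(k - Kstar)²`. -/
lemma val_sub_P (hk : Contr p k) (hl : Contr p l) :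
    val p k l - p.P = (p.r + p.γ * p.b ^ 2 * p.P) * (k - p.Kstar) ^ 2
      + p.γ * (sqPos (p.cl k) * (val p k l - p.P) + sqPos (-p.cl k) * (val p l k - p.P)) := by
  have e := val_eq hγ hk hl
  have h := bellman_square hr hγ hP 1 k
  have hs := sqPos_add_sqPos_neg (p.cl k)
  have hc : p.a * 1 + p.b * k = p.cl k := by rw [Problem.cl]; ring
  rw [hc, ← hs] at h
  linear_combination e + h

/-- The performance difference to the optimal gain. -/
lemma val_add_val_sub (hk : Contr p k) (hl : Contr p l) :
    val p k l + val p l k - 2 * p.P = (p.r + p.γ * p.b ^ 2 * p.P) *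
      (occ p k l * (k - p.Kstar) ^ 2 + occ p l k * (l - p.Kstar) ^ 2) := by
  have := sum_eq_of_bellman hγ hk hl (val_sub_P hr hγ hP hk hl) (val_sub_P hr hγ hP hl hk)
  linear_combination this

lemma P_eq : p.P = p.q + p.r * p.Kstar ^ 2 + p.γ * p.cl p.Kstar ^ 2 * p.P := by
  have h := bellman_square hr hγ hP 1 p.Kstar
  rw [Problem.cl]
  linear_combination -h

/-- Gradient dominance in terms of the value coefficients. -/
lemma gap_le_slope (hq : 0 < p.q) (hk : Contr p k) (hl : Contr p l) :
    (1 - p.γ * p.cl p.Kstar ^ 2) * (val p k l + val p l k - 2 * p.P)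
      ≤ (slope p k l ^ 2 + slope p l k ^ 2) / (4 * p.r) := by
  have h1 := advantage_ge hr hγ hq hk hl
  have h2 := advantage_ge hr hγ hq hl hk
  have hs := sqPos_add_sqPos_neg (p.cl p.Kstar)
  have hPe := P_eq hr hγ hP
  have e : (slope p k l ^ 2 + slope p l k ^ 2) / (4 * p.r)
      = -(-(slope p k l ^ 2) / (4 * p.r)) - -(slope p l k ^ 2) / (4 * p.r) := by ring
  rw [e]
  rw [← hs] at hPe ⊢
  -- In the sum of the two advantages the parts of `sqPos` recombine to `cl Kstar ^ 2`. By `P_eq`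
  -- the sum is minus the left side.
  nlinarith [h1, h2, hPe]

lemma contr_Kstar (hq : 0 < p.q) : Contr p p.Kstar := by
  have hPe := P_eq hr hγ hP
  have := hP.1
  unfold Contr
  have : 0 ≤ p.r * p.Kstar ^ 2 := by positivity
  nlinarith

end Riccati

end Values

/-! ### Cost of two-gain laws -/

section Cost

variable {p : Problem} {μ : ℝ → ℝ} {x : ℝ}

lemma stage_nonneg (hq : 0 < p.q) (hr : 0 < p.r) (hγ : 0 < p.γ) (t : ℕ) : 0 ≤ stage p μ x t := by
  unfold stage
  positivity

/-- A solution of the Bellman equation up to a defect `d` telescopes along trajectories. -/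
lemma sum_stage_eq {V d : ℝ → ℝ}
    (hV : ∀ y, p.q * y ^ 2 + p.r * μ y ^ 2 + p.γ * V (p.a * y + p.b * μ y) = V y + d y) (T : ℕ) :
    ∑ t ∈ Finset.range T, stage p μ x t
      = V x - p.γ ^ T * V (traj p μ x T) + ∑ t ∈ Finset.range T, p.γ ^ t * d (traj p μ x t) := by
  induction T with
  | zero => simp [traj]
  | succ T ih =>
    rw [Finset.sum_range_succ, Finset.sum_range_succ, ih, stage]
    have := hV (traj p μ x T)
    simp only [traj]
    linear_combination p.γ ^ T * this

lemma hasSum_stage (hq : 0 < p.q) (hr : 0 < p.r) (hγ : 0 < p.γ) {V : ℝ → ℝ}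
    (hV : ∀ y, p.q * y ^ 2 + p.r * μ y ^ 2 + p.γ * V (p.a * y + p.b * μ y) = V y)
    (hlim : Tendsto (fun t => p.γ ^ t * V (traj p μ x t)) atTop (𝓝 0)) :
    HasSum (stage p μ x) (V x) := by
  rw [hasSum_iff_tendsto_nat_of_nonneg (stage_nonneg hq hr hγ)]
  have : ∀ T, ∑ t ∈ Finset.range T, stage p μ x t = V x - p.γ ^ T * V (traj p μ x T) := by
    intro T
    rw [sum_stage_eq (V := V) (d := fun _ => 0) (by simpa using hV)]
    simp
  simp only [this]
  simpa using hlim.const_sub (V x)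

/-- The cost-to-go of a two-gain law. -/
def valFun (p : Problem) (K : EuclideanSpace ℝ (Fin 2)) (x : ℝ) : ℝ :=
  sqPos x * val p (K 0) (K 1) + sqPos (-x) * val p (K 1) (K 0)

lemma sqPos_mul_of_nonneg {c x : ℝ} (hx : 0 ≤ x) : sqPos (c * x) = sqPos c * x ^ 2 := by
  unfold sqPos
  rw [← mul_pow, max_mul_of_nonneg _ _ hx, zero_mul]

lemma sqPos_mul_of_nonpos {c x : ℝ} (hx : x ≤ 0) : sqPos (c * x) = sqPos (-c) * x ^ 2 := by
  have := sqPos_mul_of_nonneg (c := -c) (x := -x) (by linarith)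
  rw [neg_mul_neg] at this
  rw [this, neg_sq]

variable {K : EuclideanSpace ℝ (Fin 2)}

lemma valFun_bellman (hγ : 0 < p.γ) (h0 : Contr p (K 0)) (h1 : Contr p (K 1)) (y : ℝ) :
    p.q * y ^ 2 + p.r * gainLaw K y ^ 2 + p.γ * valFun p K (p.a * y + p.b * gainLaw K y)
      = valFun p K y := by
  have e0 := val_eq hγ h0 h1
  have e1 := val_eq hγ h1 h0
  by_cases hy : 0 ≤ y
  · have hg : gainLaw K y = K 0 * y := if_pos hy
    have hc : p.a * y + p.b * gainLaw K y = p.cl (K 0) * y := by rw [hg, Problem.cl]; ring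
    rw [hc, hg, valFun, valFun, ← neg_mul, sqPos_mul_of_nonneg hy, sqPos_mul_of_nonneg hy,
      sqPos_of_nonneg hy, sqPos_of_nonpos (x := -y) (by linarith)]
    linear_combination (-y ^ 2) * e0
  · push Not at hy
    have hg : gainLaw K y = K 1 * y := if_neg (not_le.2 hy)
    have hc : p.a * y + p.b * gainLaw K y = p.cl (K 1) * y := by rw [hg, Problem.cl]; ring
    rw [hc, hg, valFun, valFun, ← neg_mul, sqPos_mul_of_nonpos hy.le, sqPos_mul_of_nonpos hy.le,
      sqPos_of_nonpos hy.le, sqPos_of_nonneg (x := -y) (by linarith), neg_neg]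
    linear_combination (-y ^ 2) * e1

/-- Only the discounted squares need to decay for the remainder of the telescoped cost to vanish;
the closed loop itself need not be stable. -/
lemma traj_gainLaw_sq_le {c : ℝ} (hγ : 0 < p.γ) (h0 : p.γ * p.cl (K 0) ^ 2 ≤ c)
    (h1 : p.γ * p.cl (K 1) ^ 2 ≤ c) (x : ℝ) (t : ℕ) :
    p.γ ^ t * traj p (gainLaw K) x t ^ 2 ≤ c ^ t * x ^ 2 := by
  have hc : 0 ≤ c := le_trans (by positivity) h0
  induction t with
  | zero => simp [traj]
  | succ t ih =>
    have : p.γ * traj p (gainLaw K) x (t + 1) ^ 2 ≤ c * traj p (gainLaw K) x t ^ 2 := by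
      simp only [traj, gainLaw]
      set y := traj p (gainLaw K) x t
      split_ifs
      · have : p.a * y + p.b * (K 0 * y) = p.cl (K 0) * y := by rw [Problem.cl]; ring
        rw [this, mul_pow, ← mul_assoc]
        exact mul_le_mul_of_nonneg_right h0 (sq_nonneg _)
      · have : p.a * y + p.b * (K 1 * y) = p.cl (K 1) * y := by rw [Problem.cl]; ring
        rw [this, mul_pow, ← mul_assoc]
        exact mul_le_mul_of_nonneg_right h1 (sq_nonneg _)
    have hg : 0 ≤ p.γ ^ t := by positivity
    calc p.γ ^ (t + 1) * traj p (gainLaw K) x (t + 1) ^ 2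
        = p.γ ^ t * (p.γ * traj p (gainLaw K) x (t + 1) ^ 2) := by ring
      _ ≤ p.γ ^ t * (c * traj p (gainLaw K) x t ^ 2) := mul_le_mul_of_nonneg_left this hg
      _ = c * (p.γ ^ t * traj p (gainLaw K) x t ^ 2) := by ring
      _ ≤ c * (c ^ t * x ^ 2) := mul_le_mul_of_nonneg_left ih hc
      _ = c ^ (t + 1) * x ^ 2 := by ring

lemma hasSum_stage_gainLaw (hq : 0 < p.q) (hr : 0 < p.r) (hγ : 0 < p.γ) (h0 : Contr p (K 0))
    (h1 : Contr p (K 1)) (x : ℝ) : HasSum (stage p (gainLaw K) x) (valFun p K x) := by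
  refine hasSum_stage hq hr hγ (valFun_bellman hγ h0 h1) ?_
  set c := max (p.γ * p.cl (K 0) ^ 2) (p.γ * p.cl (K 1) ^ 2)
  have hc0 : 0 ≤ c := le_max_of_le_left (by positivity)
  have hc1 : c < 1 := max_lt h0 h1
  have v0 := val_nonneg hγ hq hr h0 h1
  have v1 := val_nonneg hγ hq hr h1 h0
  have hlim : Tendsto (fun t : ℕ => c ^ t * x ^ 2 * (val p (K 0) (K 1) + val p (K 1) (K 0))) atTop
      (𝓝 0) := by
    simpa [mul_assoc] using (tendsto_pow_atTop_nhds_zero_of_lt_one hc0 hc1).mul_const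
      (x ^ 2 * (val p (K 0) (K 1) + val p (K 1) (K 0)))
  refine squeeze_zero (fun t => ?_) (fun t => ?_) hlim
  · have := sqPos_nonneg (traj p (gainLaw K) x t)
    have := sqPos_nonneg (-traj p (gainLaw K) x t)
    unfold valFun
    positivity
  · have hle : valFun p K (traj p (gainLaw K) x t)
        ≤ traj p (gainLaw K) x t ^ 2 * (val p (K 0) (K 1) + val p (K 1) (K 0)) := by
      rw [← sqPos_add_sqPos_neg]
      unfold valFun
      nlinarith [mul_nonneg (sqPos_nonneg (traj p (gainLaw K) x t)) v1,
        mul_nonneg (sqPos_nonneg (-traj p (gainLaw K) x t)) v0]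
    calc p.γ ^ t * valFun p K (traj p (gainLaw K) x t)
        ≤ p.γ ^ t * (traj p (gainLaw K) x t ^ 2 * (val p (K 0) (K 1) + val p (K 1) (K 0))) :=
          mul_le_mul_of_nonneg_left hle (by positivity)
      _ = p.γ ^ t * traj p (gainLaw K) x t ^ 2 * (val p (K 0) (K 1) + val p (K 1) (K 0)) := by ring
      _ ≤ _ := mul_le_mul_of_nonneg_right
        (traj_gainLaw_sq_le hγ (le_max_left _ _) (le_max_right _ _) x t) (by linarith)

lemma costToGo_gainLaw (hq : 0 < p.q) (hr : 0 < p.r) (hγ : 0 < p.γ) (h0 : Contr p (K 0))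
    (h1 : Contr p (K 1)) : costToGo p (gainLaw K) = valFun p K :=
  funext fun x => (hasSum_stage_gainLaw hq hr hγ h0 h1 x).tsum_eq

lemma gainLaw_const (k : ℝ) : gainLaw !₂[k, k] = fun x => k * x := by
  ext x
  simp [gainLaw]

end Cost

/-! ### Expected cost, cost gap and quadratic growth. -/

section Integral

variable {p : Problem} {ρ : Measure ℝ} {δ₀ : ℝ} (A : Admissible p δ₀ ρ)
include A

lemma Admissible.integrable_sqPos : Integrable sqPos ρ ∧ ∫ x, sqPos x ∂ρ = p.σ ^ 2 / 2 := by
  have e : sqPos = (Set.Ici 0).indicator fun x => x ^ 2 := by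
    ext x
    by_cases hx : 0 ≤ x
    · rw [Set.indicator_of_mem (Set.mem_Ici.2 hx), sqPos_of_nonneg hx]
    · rw [Set.indicator_of_notMem (by simpa using hx), sqPos_of_nonpos (le_of_not_ge hx)]
  have hI : ∫ x, sqPos x ∂ρ = p.σ ^ 2 / 2 := by
    rw [e, integral_indicator measurableSet_Ici, A.hpos]
  refine ⟨?_, hI⟩
  -- The integral of a non-integrable function is `0` by convention, whereas the second moment is
  -- positive.
  by_contra hn
  rw [integral_undef hn] at hI
  have := pow_pos A.hσ 2
  linarith

lemma Admissible.integrable_sqPos_neg :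
    Integrable (fun x => sqPos (-x)) ρ ∧ ∫ x, sqPos (-x) ∂ρ = p.σ ^ 2 / 2 := by
  have e : (fun x => sqPos (-x)) = (Set.Iio 0).indicator fun x => x ^ 2 := by
    ext x
    by_cases hx : x < 0
    · rw [Set.indicator_of_mem (Set.mem_Iio.2 hx), sqPos_of_nonneg (by linarith), neg_sq]
    · rw [Set.indicator_of_notMem (by simpa using hx), sqPos_of_nonpos (by linarith)]
  have hI : ∫ x, sqPos (-x) ∂ρ = p.σ ^ 2 / 2 := by
    rw [e, integral_indicator measurableSet_Iio, A.hneg]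
  refine ⟨?_, hI⟩
  by_contra hn
  rw [integral_undef hn] at hI
  have := pow_pos A.hσ 2
  linarith

variable {K : EuclideanSpace ℝ (Fin 2)}

lemma Admissible.integrable_valFun : Integrable (valFun p K) ρ :=
  (A.integrable_sqPos.1.mul_const _).add (A.integrable_sqPos_neg.1.mul_const _)

lemma Admissible.gainCost_eq (h0 : Contr p (K 0)) (h1 : Contr p (K 1)) :
    gainCost p ρ K = p.σ ^ 2 / 2 * (val p (K 0) (K 1) + val p (K 1) (K 0)) := by
  rw [gainCost, cost, costToGo_gainLaw A.hq A.hr A.hγ0 h0 h1]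
  unfold valFun
  rw [integral_add (A.integrable_sqPos.1.mul_const _) (A.integrable_sqPos_neg.1.mul_const _),
    integral_mul_const, integral_mul_const, A.integrable_sqPos.2, A.integrable_sqPos_neg.2]
  ring

lemma Admissible.contr_Kstar : Contr p p.Kstar := ReLULQR.contr_Kstar A.hr A.hγ0 A.hP A.hq

lemma Admissible.val_Kstar : val p p.Kstar p.Kstar = p.P := by
  have h := val_add_val_sub A.hr A.hγ0 A.hP A.contr_Kstar A.contr_Kstar
  simp only [sub_self] at h
  linear_combination h / 2

lemma Admissible.optCost_eq : optCost p ρ = p.σ ^ 2 * p.P := by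
  have h : optCost p ρ = gainCost p ρ !₂[p.Kstar, p.Kstar] := by
    rw [gainCost, gainLaw_const]; rfl
  rw [h, A.gainCost_eq (by simpa using A.contr_Kstar) (by simpa using A.contr_Kstar)]
  simp only [Matrix.cons_val_zero, Matrix.cons_val_one, A.val_Kstar]
  ring

lemma Admissible.gap_eq (h0 : Contr p (K 0)) (h1 : Contr p (K 1)) :
    gainCost p ρ K - optCost p ρ
      = p.growth * (occ p (K 0) (K 1) * (K 0 - p.Kstar) ^ 2
        + occ p (K 1) (K 0) * (K 1 - p.Kstar) ^ 2) := by
  rw [A.gainCost_eq h0 h1, A.optCost_eq, Problem.growth]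
  linear_combination p.σ ^ 2 / 2 * val_add_val_sub A.hr A.hγ0 A.hP h0 h1

lemma Admissible.growth_pos : 0 < p.growth := by
  have := riccati_denom_pos A.hr A.hγ0 A.hP
  have := A.hσ
  unfold Problem.growth
  positivity

/-- Quadratic growth of the cost around the optimal gains. -/
lemma Admissible.growth_mul_le (h0 : Contr p (K 0)) (h1 : Contr p (K 1)) :
    p.growth * ‖K - optGains p‖ ^ 2 ≤ gainCost p ρ K - optCost p ρ := by
  rw [A.gap_eq h0 h1, EuclideanSpace.norm_sq_eq, Fin.sum_univ_two]
  simp only [optGains, PiLp.sub_apply, Real.norm_eq_abs, sq_abs, Matrix.cons_val_zero,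
    Matrix.cons_val_one]
  have o0 := one_le_occ A.hγ0 h0 h1
  have o1 := one_le_occ A.hγ0 h1 h0
  refine mul_le_mul_of_nonneg_left ?_ A.growth_pos.le
  nlinarith [sq_nonneg (K 0 - p.Kstar), sq_nonneg (K 1 - p.Kstar)]

/-- The gradient of the cost with respect to the two gains. -/
def gainGrad (p : Problem) (K : EuclideanSpace ℝ (Fin 2)) : EuclideanSpace ℝ (Fin 2) :=
  !₂[p.σ ^ 2 / 2 * (occ p (K 0) (K 1) * slope p (K 0) (K 1)),
    p.σ ^ 2 / 2 * (occ p (K 1) (K 0) * slope p (K 1) (K 0))]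

end Integral

/-! ### The gradient -/

@[fun_prop]
lemma differentiable_sqPos : Differentiable ℝ sqPos :=
  fun x => (hasDerivAt_sqPos x).differentiableAt

@[fun_prop]
lemma differentiable_cl (p : Problem) : Differentiable ℝ p.cl := by
  unfold Problem.cl
  fun_prop

/-- Implicit differentiation of the Bellman equation along a line in direction `d`. The derivatives
solve the same system, with stage cost `slope` times the coordinate of `d`. -/
lemma hasDerivAt_val {p : Problem} {K : EuclideanSpace ℝ (Fin 2)} {f g : EuclideanSpace ℝ (Fin 2) → ℝ} {i : Fin 2}
    {f' g' : EuclideanSpace ℝ (Fin 2) →L[ℝ] ℝ} (hf : HasFDerivAt f f' K) (hg : HasFDerivAt g g' K)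
    (h : ∀ᶠ K' in 𝓝 K, f K' = p.q + p.r * K' i ^ 2
      + p.γ * (sqPos (p.cl (K' i)) * f K' + sqPos (-p.cl (K' i)) * g K'))
    (d : EuclideanSpace ℝ (Fin 2)) :
    f' d = 2 * (p.r * K i + p.γ * p.b * (max (p.cl (K i)) 0 * f K - max (-p.cl (K i)) 0 * g K))
      * d i + p.γ * (sqPos (p.cl (K i)) * f' d + sqPos (-p.cl (K i)) * g' d) := by
  have hline : HasDerivAt (fun t : ℝ => K + t • d) d 0 := by
    simpa using ((hasDerivAt_id (0 : ℝ)).smul_const d).const_add K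
  have hK0 : K + (0 : ℝ) • d = K := by simp
  have hf1 : HasDerivAt (fun t : ℝ => f (K + t • d)) (f' d) 0 := by
    have hf' := hf
    rw [← hK0] at hf'
    exact hf'.comp_hasDerivAt (0 : ℝ) hline
  have hg1 : HasDerivAt (fun t : ℝ => g (K + t • d)) (g' d) 0 := by
    have hg' := hg
    rw [← hK0] at hg'
    exact hg'.comp_hasDerivAt (0 : ℝ) hline
  have hk : HasDerivAt (fun t : ℝ => (K + t • d) i) (d i) 0 := by
    simpa using ((hasDerivAt_id (0 : ℝ)).mul_const (d i)).const_add (K i)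
  have hc : HasDerivAt (fun t : ℝ => p.cl ((K + t • d) i)) (p.b * d i) 0 :=
    (hk.const_mul p.b).const_add p.a
  have hs : HasDerivAt (fun t : ℝ => sqPos (p.cl ((K + t • d) i)))
      (2 * max (p.cl ((K + (0 : ℝ) • d) i)) 0 * (p.b * d i)) 0 :=
    (hasDerivAt_sqPos _).comp (0 : ℝ) hc
  have hs' : HasDerivAt (fun t : ℝ => sqPos (-p.cl ((K + t • d) i)))
      (2 * max (-p.cl ((K + (0 : ℝ) • d) i)) 0 * -(p.b * d i)) 0 :=
    (hasDerivAt_sqPos _).comp (0 : ℝ) hc.neg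
  have hsq : HasDerivAt (fun t : ℝ => (K + t • d) i ^ 2)
      (2 * (K + (0 : ℝ) • d) i * d i) 0 := by
    simpa using hk.fun_pow 2
  have hR := ((hsq.const_mul p.r).const_add p.q).add (((hs.mul hf1).add (hs'.mul hg1)).const_mul p.γ)
  have hcont : Tendsto (fun t : ℝ => K + t • d) (𝓝 0) (𝓝 K) := by
    simpa using hline.continuousAt.tendsto
  have hL := hR.congr_of_eventuallyEq
    (show (fun t : ℝ => f (K + t • d)) =ᶠ[𝓝 0] _ from hcont.eventually h)
  have := hf1.unique hL
  simp only [hK0] at this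
  linear_combination this

lemma eventually_contr {p : Problem} {K : EuclideanSpace ℝ (Fin 2)} {i : Fin 2}
    (h : Contr p (K i)) : ∀ᶠ K' in 𝓝 K, Contr p (K' i) := by
  have : Continuous fun K' : EuclideanSpace ℝ (Fin 2) => p.γ * p.cl (K' i) ^ 2 := by
    unfold Problem.cl; fun_prop
  exact this.continuousAt.eventually (gt_mem_nhds h)

lemma differentiable_coord (i : Fin 2) :
    Differentiable ℝ fun K : EuclideanSpace ℝ (Fin 2) => K i :=
  (EuclideanSpace.proj (𝕜 := ℝ) i).differentiable

lemma differentiableAt_val {p : Problem} {K : EuclideanSpace ℝ (Fin 2)} {i j : Fin 2}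
    (hγ : 0 < p.γ) (h0 : Contr p (K i)) (h1 : Contr p (K j)) :
    DifferentiableAt ℝ (fun K' : EuclideanSpace ℝ (Fin 2) => val p (K' i) (K' j)) K := by
  have h := (det_pos hγ h0 h1).ne'
  have ci := differentiable_coord i
  have cj := differentiable_coord j
  have si := differentiable_sqPos.comp ((differentiable_cl p).comp ci)
  have sj := differentiable_sqPos.comp ((differentiable_cl p).comp cj)
  have ni := differentiable_sqPos.comp ((differentiable_cl p).comp ci).neg
  have nj := differentiable_sqPos.comp ((differentiable_cl p).comp cj).neg
  have hn : Differentiable ℝ fun K' : EuclideanSpace ℝ (Fin 2) =>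
      (p.q + p.r * K' i ^ 2) * (1 - p.γ * sqPos (p.cl (K' j)))
        + p.γ * sqPos (-p.cl (K' i)) * (p.q + p.r * K' j ^ 2) :=
    (((ci.pow 2).const_mul p.r).const_add p.q).mul ((sj.const_mul p.γ).const_sub 1) |>.add
      ((ni.const_mul p.γ).mul (((cj.pow 2).const_mul p.r).const_add p.q))
  have hd : Differentiable ℝ fun K' : EuclideanSpace ℝ (Fin 2) => det p (K' i) (K' j) :=
    (((si.const_mul p.γ).const_sub 1).mul ((sj.const_mul p.γ).const_sub 1)).sub
      ((ni.const_mul p.γ).mul (nj.const_mul p.γ))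
  have hi : DifferentiableAt ℝ
      (fun K' : EuclideanSpace ℝ (Fin 2) => (det p (K' i) (K' j))⁻¹) K :=
    (hd K).fun_inv (by exact h)
  simpa only [val, div_eq_mul_inv] using (hn K).fun_mul hi

/-- The policy gradient formula: each component is the occupation of a half line times the slope
there. -/
lemma Admissible.hasGradientAt {p : Problem} {ρ : Measure ℝ} {δ₀ : ℝ} (A : Admissible p δ₀ ρ)
    {K : EuclideanSpace ℝ (Fin 2)} (h0 : Contr p (K 0)) (h1 : Contr p (K 1)) :
    HasGradientAt (gainCost p ρ) (gainGrad p K) K := by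
  have hf := (differentiableAt_val A.hγ0 h0 h1).hasFDerivAt
  have hg := (differentiableAt_val A.hγ0 h1 h0).hasFDerivAt
  have ev := (eventually_contr h0).and (eventually_contr h1)
  have d0 := hasDerivAt_val (i := 0) hf hg
    (ev.mono fun K' h => val_eq A.hγ0 h.1 h.2)
  have d1 := hasDerivAt_val (i := 1) hg hf
    (ev.mono fun K' h => val_eq A.hγ0 h.2 h.1)
  rw [hasGradientAt_iff_hasFDerivAt]
  have hJ := ((hf.add hg).const_mul (p.σ ^ 2 / 2)).congr_of_eventuallyEq
    (show gainCost p ρ =ᶠ[𝓝 K] _ from ev.mono fun K' h => A.gainCost_eq h.1 h.2)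
  refine hJ.congr_fderiv ?_
  ext1 d
  -- The differentiated Bellman system is solved like the original one; this is where the
  -- occupations enter.
  have hs := sum_eq_of_bellman A.hγ0 h0 h1 (d0 d) (d1 d)
  simp only [smul_apply, add_apply, smul_eq_mul,
    InnerProductSpace.toDual_apply_apply, PiLp.inner_apply, Fin.sum_univ_two, gainGrad]
  rw [hs]
  simp [slope]
  ring

lemma Admissible.gradient_eq {p : Problem} {ρ : Measure ℝ} {δ₀ : ℝ} (A : Admissible p δ₀ ρ)
    {K : EuclideanSpace ℝ (Fin 2)} (h0 : Contr p (K 0)) (h1 : Contr p (K 1)) :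
    gradient (gainCost p ρ) K = gainGrad p K := (A.hasGradientAt h0 h1).gradient

/-! ### Bounded Lipschitz functions -/

/-- `f` is bounded and Lipschitz on `s`. -/
def BddLip {X : Type*} [PseudoMetricSpace X] (s : Set X) (f : X → ℝ) : Prop :=
  ∃ C, 0 ≤ C ∧ ∀ x ∈ s, ∀ y ∈ s, |f x| ≤ C ∧ |f x - f y| ≤ C * dist x y

namespace BddLip

variable {X : Type*} [PseudoMetricSpace X] {s : Set X} {f g : X → ℝ}

lemma const (c : ℝ) : BddLip s fun _ => c :=
  ⟨|c|, abs_nonneg c, fun x _ y _ => ⟨le_rfl, by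
    rw [sub_self, abs_zero]; exact mul_nonneg (abs_nonneg c) dist_nonneg⟩⟩

lemma add (hf : BddLip s f) (hg : BddLip s g) : BddLip s fun x => f x + g x := by
  obtain ⟨C, hC, h⟩ := hf
  obtain ⟨D, hD, h'⟩ := hg
  refine ⟨C + D, by positivity, fun x hx y hy => ⟨?_, ?_⟩⟩
  · exact (abs_add_le _ _).trans (add_le_add (h x hx y hy).1 (h' x hx y hy).1)
  · rw [add_sub_add_comm, add_mul]
    exact (abs_add_le _ _).trans (add_le_add (h x hx y hy).2 (h' x hx y hy).2)

/-- The reason for carrying boundedness along: the Lipschitz bound of a product uses the bounds of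
its factors. -/
lemma mul (hf : BddLip s f) (hg : BddLip s g) : BddLip s fun x => f x * g x := by
  obtain ⟨C, hC, h⟩ := hf
  obtain ⟨D, hD, h'⟩ := hg
  refine ⟨C * D + C * D, by positivity, fun x hx y hy => ⟨?_, ?_⟩⟩
  · rw [abs_mul]
    have := mul_le_mul (h x hx y hy).1 (h' x hx y hy).1 (abs_nonneg _) hC
    have := mul_nonneg hC hD
    linarith
  · have e : f x * g x - f y * g y = f x * (g x - g y) + (f x - f y) * g y := by ring
    rw [e]
    refine (abs_add_le _ _).trans ?_
    rw [abs_mul, abs_mul]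
    have h1 := mul_le_mul (h x hx y hy).1 (h' x hx y hy).2 (abs_nonneg _) hC
    have h2 := mul_le_mul (h x hx y hy).2 (h' y hy x hx).1 (abs_nonneg _)
      (mul_nonneg hC dist_nonneg)
    linarith

lemma neg (hf : BddLip s f) : BddLip s fun x => -f x := by
  simpa using (const (s := s) (-1)).mul hf

lemma sub (hf : BddLip s f) (hg : BddLip s g) : BddLip s fun x => f x - g x := by
  simpa [sub_eq_add_neg] using hf.add hg.neg

lemma inv (hf : BddLip s f) {c : ℝ} (hc : 0 < c) (h : ∀ x ∈ s, c ≤ f x) :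
    BddLip s fun x => (f x)⁻¹ := by
  obtain ⟨C, hC, hC'⟩ := hf
  refine ⟨c⁻¹ + C * (c⁻¹ * c⁻¹), by positivity, fun x hx y hy => ⟨?_, ?_⟩⟩
  · rw [abs_inv, abs_of_pos (hc.trans_le (h x hx))]
    have := inv_anti₀ hc (h x hx)
    have : 0 ≤ C * (c⁻¹ * c⁻¹) := by positivity
    linarith
  · have hx0 := hc.trans_le (h x hx)
    have hy0 := hc.trans_le (h y hy)
    have e : (f x)⁻¹ - (f y)⁻¹ = -(f x - f y) * ((f x)⁻¹ * (f y)⁻¹) := by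
      field_simp
      ring
    rw [e, abs_mul, abs_neg, abs_of_nonneg (by positivity : 0 ≤ (f x)⁻¹ * (f y)⁻¹)]
    have h1 : (f x)⁻¹ * (f y)⁻¹ ≤ c⁻¹ * c⁻¹ :=
      mul_le_mul (inv_anti₀ hc (h x hx)) (inv_anti₀ hc (h y hy)) (by positivity) (by positivity)
    have h2 := mul_le_mul (hC' x hx y hy).2 h1 (by positivity) (mul_nonneg hC dist_nonneg)
    have : 0 ≤ c⁻¹ * dist x y := mul_nonneg (by positivity) dist_nonneg
    nlinarith

lemma posPart (hf : BddLip s f) : BddLip s fun x => max (f x) 0 := by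
  obtain ⟨C, hC, h⟩ := hf
  refine ⟨C, hC, fun x hx y hy => ⟨?_, ?_⟩⟩
  · rw [abs_of_nonneg (le_max_right _ _)]
    exact max_le ((le_abs_self _).trans (h x hx y hy).1) hC
  · exact (abs_max_sub_max_le_abs _ _ _).trans (h x hx y hy).2

end BddLip

/-! ### The safe set -/

section Safe

variable {p : Problem} {ρ : Measure ℝ} {δ₀ : ℝ} (A : Admissible p δ₀ ρ)
include A

lemma Admissible.delta_lt_one : p.δ < 1 := by
  have := abs_nonneg p.a
  linarith [A.ha, A.hδ₀]

lemma Admissible.d0_pos : 0 < p.d0 := by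
  have h1 := A.delta_lt_one
  have h2 := A.hδ
  have : (1 - p.δ / 2) ^ 2 < 1 := by nlinarith
  unfold Problem.d0
  nlinarith [A.hγ1, A.hγ0]

lemma Admissible.cl_sq_le {k : ℝ} (hk : |p.a + p.b * k| ≤ 1 - p.δ / 2) :
    p.γ * p.cl k ^ 2 ≤ 1 - p.d0 := by
  have : p.cl k ^ 2 ≤ (1 - p.δ / 2) ^ 2 := by
    rw [← sq_abs (p.cl k)]
    exact pow_le_pow_left₀ (abs_nonneg _) hk 2
  unfold Problem.d0
  nlinarith [A.hγ0]

lemma Admissible.contr {k : ℝ} (hk : |p.a + p.b * k| ≤ 1 - p.δ / 2) : Contr p k := by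
  have := A.cl_sq_le hk
  have := A.d0_pos
  unfold Contr
  linarith

lemma Admissible.abs_gain_le {k : ℝ} (hk : |p.a + p.b * k| ≤ 1 - p.δ / 2) : |k| ≤ p.Kmax := by
  rw [Problem.Kmax, le_div_iff₀ (abs_pos.2 A.hb), ← abs_mul]
  have e : k * p.b = (p.a + p.b * k) - p.a := by ring
  rw [e]
  linarith [abs_sub (p.a + p.b * k) p.a]

lemma Admissible.val_mem {k l : ℝ} (hk : |p.a + p.b * k| ≤ 1 - p.δ / 2)
    (hl : |p.a + p.b * l| ≤ 1 - p.δ / 2) : 0 ≤ val p k l ∧ val p k l ≤ p.Pmax := by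
  refine ⟨val_nonneg A.hγ0 A.hq A.hr (A.contr hk) (A.contr hl), ?_⟩
  have hsq : ∀ {k : ℝ}, |p.a + p.b * k| ≤ 1 - p.δ / 2 →
      p.q + p.r * k ^ 2 ≤ p.q + p.r * p.Kmax ^ 2 := by
    intro k hk
    have : k ^ 2 ≤ p.Kmax ^ 2 := by
      rw [← sq_abs k]; exact pow_le_pow_left₀ (abs_nonneg _) (A.abs_gain_le hk) 2
    nlinarith [A.hr]
  exact val_le A.hγ0 (A.cl_sq_le hk) (A.cl_sq_le hl) A.d0_pos (hsq hk) (hsq hl)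
    (by have := A.hq; have := A.hr; positivity)

lemma Admissible.abs_slope_le {k l : ℝ} (hk : |p.a + p.b * k| ≤ 1 - p.δ / 2)
    (hl : |p.a + p.b * l| ≤ 1 - p.δ / 2) :
    |slope p k l| ≤ 2 * (p.r * p.Kmax + p.γ * |p.b| * (1 - p.δ / 2) * p.Pmax) := by
  obtain ⟨v0, v1⟩ := A.val_mem hk hl
  obtain ⟨w0, w1⟩ := A.val_mem hl hk
  have hy : 0 ≤ 1 - p.δ / 2 := by linarith [A.delta_lt_one]
  have hc : |max (p.cl k) 0 * val p k l - max (-p.cl k) 0 * val p l k|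
      ≤ (1 - p.δ / 2) * p.Pmax := by
    obtain ⟨c1, c2⟩ := abs_le.1 hk
    have e : p.a + p.b * k = p.cl k := rfl
    rw [e] at c1 c2
    have m1 : max (p.cl k) 0 * val p k l ≤ (1 - p.δ / 2) * p.Pmax :=
      mul_le_mul (max_le c2 hy) v1 v0 hy
    have m2 : max (-p.cl k) 0 * val p l k ≤ (1 - p.δ / 2) * p.Pmax :=
      mul_le_mul (max_le (by linarith) hy) w1 w0 hy
    have m3 := mul_nonneg (le_max_right (p.cl k) 0) v0
    have m4 := mul_nonneg (le_max_right (-p.cl k) 0) w0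
    rw [abs_le]
    constructor <;> linarith
  rw [slope, abs_mul, abs_of_pos (by norm_num : (0 : ℝ) < 2)]
  refine mul_le_mul_of_nonneg_left ?_ (by norm_num)
  refine (abs_add_le _ _).trans (add_le_add ?_ ?_)
  · rw [abs_mul, abs_of_pos A.hr]
    exact mul_le_mul_of_nonneg_left (A.abs_gain_le hk) A.hr.le
  · rw [abs_mul, abs_mul, abs_of_pos A.hγ0, mul_assoc (p.γ * |p.b|)]
    exact mul_le_mul_of_nonneg_left hc (mul_nonneg A.hγ0.le (abs_nonneg _))

variable {K : EuclideanSpace ℝ (Fin 2)} (hK : K ∈ margin p (p.δ / 2))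
include hK

lemma Admissible.contr_zero : Contr p (K 0) := A.contr hK.1

lemma Admissible.contr_one : Contr p (K 1) := A.contr hK.2

lemma Admissible.hasGradientAt_margin :
    HasGradientAt (gainCost p ρ) (gradient (gainCost p ρ) K) K := by
  rw [A.gradient_eq (A.contr_zero hK) (A.contr_one hK)]
  exact A.hasGradientAt (A.contr_zero hK) (A.contr_one hK)

lemma Admissible.norm_gradient_le : ‖gradient (gainCost p ρ) K‖ ≤ p.Gmax := by
  rw [A.gradient_eq (A.contr_zero hK) (A.contr_one hK)]
  have o0 := one_le_occ A.hγ0 (A.contr_zero hK) (A.contr_one hK)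
  have o1 := one_le_occ A.hγ0 (A.contr_one hK) (A.contr_zero hK)
  have os := occ_add_occ_le A.hγ0 (A.cl_sq_le hK.1) (A.cl_sq_le hK.2) A.d0_pos
  have s0 := A.abs_slope_le hK.1 hK.2
  have s1 := A.abs_slope_le hK.2 hK.1
  set M := 2 * (p.r * p.Kmax + p.γ * |p.b| * (1 - p.δ / 2) * p.Pmax) with hM
  have hM0 : 0 ≤ M := (abs_nonneg _).trans s0
  have hσ := pow_pos A.hσ 2
  have hd := A.d0_pos
  have h1 : ‖gainGrad p K‖ ≤ p.σ ^ 2 / 2 * (2 / p.d0) * M := by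
    have hnn : 0 ≤ p.σ ^ 2 / 2 * (2 / p.d0) * M := by positivity
    rw [EuclideanSpace.norm_eq, Real.sqrt_le_left hnn, Fin.sum_univ_two]
    simp only [gainGrad, Real.norm_eq_abs, sq_abs, Matrix.cons_val_zero, Matrix.cons_val_one]
    have q0 : slope p (K 0) (K 1) ^ 2 ≤ M ^ 2 := by
      rw [← sq_abs]; exact pow_le_pow_left₀ (abs_nonneg _) s0 2
    have q1 : slope p (K 1) (K 0) ^ 2 ≤ M ^ 2 := by
      rw [← sq_abs]; exact pow_le_pow_left₀ (abs_nonneg _) s1 2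
    calc _ = (p.σ ^ 2 / 2) ^ 2 * (occ p (K 0) (K 1) ^ 2 * slope p (K 0) (K 1) ^ 2
            + occ p (K 1) (K 0) ^ 2 * slope p (K 1) (K 0) ^ 2) := by ring
      _ ≤ (p.σ ^ 2 / 2) ^ 2 * (occ p (K 0) (K 1) ^ 2 * M ^ 2
            + occ p (K 1) (K 0) ^ 2 * M ^ 2) := by gcongr
      -- Only the sum of the occupations has a good bound, so the sum of squares is enlarged to the
      -- square of the sum.
      _ ≤ (p.σ ^ 2 / 2) ^ 2 * ((occ p (K 0) (K 1) + occ p (K 1) (K 0)) ^ 2 * M ^ 2) := by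
          refine mul_le_mul_of_nonneg_left ?_ (by positivity)
          rw [← add_mul]
          refine mul_le_mul_of_nonneg_right ?_ (by positivity)
          nlinarith
      _ ≤ (p.σ ^ 2 / 2) ^ 2 * ((2 / p.d0) ^ 2 * M ^ 2) := by gcongr
      _ = _ := by ring
  refine h1.trans ?_
  -- `Gmax` exceeds the bound just proved by the factor `√2`.
  have h2 : p.Gmax = √2 * (p.σ ^ 2 / 2 * (2 / p.d0) * M) := by
    rw [hM, Problem.Gmax]
    field_simp
  rw [h2]
  refine le_mul_of_one_le_left (by positivity) ?_
  rw [Real.one_le_sqrt]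
  norm_num

lemma Admissible.gap_nonneg : 0 ≤ gainCost p ρ K - optCost p ρ :=
  le_trans (mul_nonneg A.growth_pos.le (sq_nonneg _))
    (A.growth_mul_le (A.contr_zero hK) (A.contr_one hK))

-- Combines `gap_le_slope` with `occ ≥ 1`, which allows the slopes to be replaced by the components
-- of the gradient.
omit hK in
lemma Admissible.isPLConst :
    IsPLConst p ρ (p.σ ^ 2 * p.r * (1 - p.γ * p.cl p.Kstar ^ 2)) := by
  intro K hK
  have c0 := A.contr_zero hK
  have c1 := A.contr_one hK
  rw [A.gradient_eq c0 c1, A.gainCost_eq c0 c1, A.optCost_eq, EuclideanSpace.norm_sq_eq,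
    Fin.sum_univ_two]
  simp only [gainGrad, Real.norm_eq_abs, sq_abs, Matrix.cons_val_zero, Matrix.cons_val_one]
  have o0 := one_le_occ A.hγ0 c0 c1
  have o1 := one_le_occ A.hγ0 c1 c0
  have hg := gap_le_slope A.hr A.hγ0 A.hP A.hq c0 c1
  have hr := A.hr
  rw [le_div_iff₀ (by positivity)] at hg
  have h0 : slope p (K 0) (K 1) ^ 2 ≤ (occ p (K 0) (K 1) * slope p (K 0) (K 1)) ^ 2 := by
    rw [mul_pow]
    exact le_mul_of_one_le_left (sq_nonneg _) (one_le_pow₀ o0)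
  have h1 : slope p (K 1) (K 0) ^ 2 ≤ (occ p (K 1) (K 0) * slope p (K 1) (K 0)) ^ 2 := by
    rw [mul_pow]
    exact le_mul_of_one_le_left (sq_nonneg _) (one_le_pow₀ o1)
  have hσ := pow_pos A.hσ 4
  rw [mul_pow (p.σ ^ 2 / 2), mul_pow (p.σ ^ 2 / 2)]
  generalize (occ p (K 0) (K 1) * slope p (K 0) (K 1)) ^ 2 = X at *
  generalize (occ p (K 1) (K 0) * slope p (K 1) (K 0)) ^ 2 = Y at *
  have := mul_le_mul_of_nonneg_left (hg.trans (add_le_add h0 h1)) hσ.le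
  linarith

omit hK in
lemma Admissible.PLConst_pos : 0 < p.σ ^ 2 * p.r * (1 - p.γ * p.cl p.Kstar ^ 2) := by
  have h := A.contr_Kstar
  have := A.hσ
  have := A.hr
  unfold Contr at h
  have : 0 < 1 - p.γ * p.cl p.Kstar ^ 2 := by linarith
  positivity

-- The gradient is built from the gains by sums, products, positive parts and division by `det`,
-- each of which preserves `BddLip` on the safe set.
omit hK in
lemma Admissible.exists_isSmoothConst : ∃ L, 0 < L ∧ IsSmoothConst p ρ L := by
  set s := margin p (p.δ / 2)
  have hk : ∀ i : Fin 2, BddLip s fun K => K i := by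
    intro i
    refine ⟨max 1 p.Kmax, by positivity, fun K hK K' _ => ⟨?_, ?_⟩⟩
    · refine le_trans ?_ (le_max_right _ _)
      fin_cases i
      · exact A.abs_gain_le hK.1
      · exact A.abs_gain_le hK.2
    · rw [dist_eq_norm]
      refine le_trans ?_ (le_mul_of_one_le_left (norm_nonneg _) (le_max_left _ _))
      exact PiLp.norm_apply_le (K - K') i
  have hc : ∀ i : Fin 2, BddLip s fun K => p.cl (K i) := fun i =>
    (BddLip.const p.a).add ((BddLip.const p.b).mul (hk i))
  have hm : ∀ i : Fin 2, BddLip s fun K => max (p.cl (K i)) 0 := fun i => (hc i).posPart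
  have hn : ∀ i : Fin 2, BddLip s fun K => max (-p.cl (K i)) 0 := fun i => (hc i).neg.posPart
  have hS : ∀ i : Fin 2, BddLip s fun K => p.γ * sqPos (p.cl (K i)) := by
    intro i
    simpa only [sqPos, sq] using (BddLip.const p.γ).mul ((hm i).mul (hm i))
  have hT : ∀ i : Fin 2, BddLip s fun K => p.γ * sqPos (-p.cl (K i)) := by
    intro i
    simpa only [sqPos, sq] using (BddLip.const p.γ).mul ((hn i).mul (hn i))
  have h1S : ∀ i : Fin 2, BddLip s fun K => 1 - p.γ * sqPos (p.cl (K i)) := fun i =>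
    (BddLip.const 1).sub (hS i)
  have hst : ∀ i : Fin 2, BddLip s fun K => p.q + p.r * K i ^ 2 := by
    intro i
    simpa only [sq] using (BddLip.const p.q).add ((BddLip.const p.r).mul ((hk i).mul (hk i)))
  have hsafe : ∀ K ∈ s, ∀ i : Fin 2, |p.a + p.b * K i| ≤ 1 - p.δ / 2 := by
    intro K hK i
    fin_cases i
    · exact hK.1
    · exact hK.2
  have hd := A.d0_pos
  have hdet : ∀ i j : Fin 2, BddLip s fun K => (det p (K i) (K j))⁻¹ := by
    intro i j
    -- Each diagonal entry of `1 - γ M` exceeds its off-diagonal entry by at least `d0`, which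
    -- bounds the determinant below by `d0 ^ 2`.
    refine BddLip.inv (((h1S i).mul (h1S j)).sub ((hT i).mul (hT j))) (pow_pos hd 2) ?_
    intro K hK
    have ci := A.cl_sq_le (hsafe K hK i)
    have cj := A.cl_sq_le (hsafe K hK j)
    rw [← sqPos_add_sqPos_neg] at ci cj
    have ti := mul_nonneg A.hγ0.le (sqPos_nonneg (-p.cl (K i)))
    have tj := mul_nonneg A.hγ0.le (sqPos_nonneg (-p.cl (K j)))
    have hi : p.d0 + p.γ * sqPos (-p.cl (K i)) ≤ 1 - p.γ * sqPos (p.cl (K i)) := by linarith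
    have hj : p.d0 + p.γ * sqPos (-p.cl (K j)) ≤ 1 - p.γ * sqPos (p.cl (K j)) := by linarith
    unfold det
    nlinarith [mul_le_mul hi hj (by positivity) (by linarith), mul_nonneg hd.le ti,
      mul_nonneg hd.le tj]
  have hval : ∀ i j : Fin 2, BddLip s fun K => val p (K i) (K j) := by
    intro i j
    simpa only [val, div_eq_mul_inv] using
      (((hst i).mul (h1S j)).add ((hT i).mul (hst j))).mul (hdet i j)
  have hocc : ∀ i j : Fin 2, BddLip s fun K => occ p (K i) (K j) := by
    intro i j
    simpa only [occ, div_eq_mul_inv] using ((h1S j).add (hT j)).mul (hdet i j)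
  have hslope : ∀ i j : Fin 2, BddLip s fun K => slope p (K i) (K j) := by
    intro i j
    exact (BddLip.const 2).mul (((BddLip.const p.r).mul (hk i)).add
      ((BddLip.const (p.γ * p.b)).mul
        (((hm i).mul (hval i j)).sub ((hn i).mul (hval j i)))))
  have hcomp : ∀ i j : Fin 2, BddLip s fun K =>
      p.σ ^ 2 / 2 * (occ p (K i) (K j) * slope p (K i) (K j)) := fun i j =>
    (BddLip.const _).mul ((hocc i j).mul (hslope i j))
  obtain ⟨C, hC, h⟩ := hcomp 0 1
  obtain ⟨D, hD, h'⟩ := hcomp 1 0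
  refine ⟨C + D + 1, by positivity, fun K hK K' hK' => ?_⟩
  rw [A.gradient_eq (A.contr_zero hK) (A.contr_one hK),
    A.gradient_eq (A.contr_zero hK') (A.contr_one hK')]
  have e0 := (h K hK K' hK').2
  have e1 := (h' K hK K' hK').2
  rw [dist_eq_norm] at e0 e1
  have hnn := norm_nonneg (K - K')
  rw [EuclideanSpace.norm_eq, Real.sqrt_le_left (by positivity), Fin.sum_univ_two]
  simp only [gainGrad, PiLp.sub_apply, Real.norm_eq_abs, Matrix.cons_val_zero,
    Matrix.cons_val_one]
  calc _ ≤ (C * ‖K - K'‖) ^ 2 + (D * ‖K - K'‖) ^ 2 :=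
        add_le_add (pow_le_pow_left₀ (abs_nonneg _) e0 2) (pow_le_pow_left₀ (abs_nonneg _) e1 2)
    _ ≤ (C * ‖K - K'‖ + D * ‖K - K'‖) ^ 2 := by
        have := mul_nonneg (mul_nonneg hC hnn) (mul_nonneg hD hnn)
        nlinarith
    _ ≤ _ := pow_le_pow_left₀ (by positivity) (by nlinarith) 2

end Safe

/-! ### Optimality of the Riccati gain -/

section Optimal

variable {p : Problem} {ρ : Measure ℝ} {δ₀ : ℝ} (A : Admissible p δ₀ ρ)
include A

omit A in
lemma traj_linear (k x : ℝ) (t : ℕ) : traj p (fun y => k * y) x t = p.cl k ^ t * x := by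
  induction t with
  | zero => simp [traj]
  | succ t ih => simp only [traj, ih, Problem.cl]; ring

omit A in
lemma stabilizing_iff (k : ℝ) : Stabilizing p (fun y => k * y) ↔ |p.cl k| < 1 := by
  constructor
  · intro h
    have := h 1
    simp only [funext (traj_linear k 1), mul_one] at this
    exact (tendsto_pow_atTop_nhds_zero_iff).1 this
  · intro h x
    simp only [funext (traj_linear k x)]
    simpa using (tendsto_pow_atTop_nhds_zero_iff.2 h).mul_const x

lemma contr_of_abs_lt {k : ℝ} (h : |p.cl k| < 1) : Contr p k := by
  have : p.cl k ^ 2 < 1 := by rwa [sq_lt_one_iff_abs_lt_one]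
  unfold Contr
  nlinarith [A.hγ0, A.hγ1, sq_nonneg (p.cl k)]

lemma extCost_linear {k : ℝ} (h : Contr p k) :
    extCost p ρ (fun y => k * y) = ENNReal.ofReal (p.σ ^ 2 * val p k k) := by
  have h0 : Contr p ((!₂[k, k] : EuclideanSpace ℝ (Fin 2)) 0) := by simpa using h
  have h1 : Contr p ((!₂[k, k] : EuclideanSpace ℝ (Fin 2)) 1) := by simpa using h
  have e : ∀ x, ∑' t, ENNReal.ofReal (stage p (fun y => k * y) x t)
      = ENNReal.ofReal (valFun p !₂[k, k] x) := by
    intro x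
    have hs := hasSum_stage_gainLaw A.hq A.hr A.hγ0 h0 h1 x
    rw [gainLaw_const] at hs
    rw [← ENNReal.ofReal_tsum_of_nonneg (stage_nonneg A.hq A.hr A.hγ0) hs.summable, hs.tsum_eq]
  have hv := val_nonneg A.hγ0 A.hq A.hr h h
  have hnn : ∀ x, 0 ≤ valFun p !₂[k, k] x := by
    intro x
    have := sqPos_nonneg x
    have := sqPos_nonneg (-x)
    simp only [valFun, Matrix.cons_val_zero, Matrix.cons_val_one]
    positivity
  have hc := A.gainCost_eq h0 h1
  rw [gainCost, cost, costToGo_gainLaw A.hq A.hr A.hγ0 h0 h1] at hc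
  simp only [extCost, e]
  rw [← ofReal_integral_eq_lintegral_ofReal A.integrable_valFun (Eventually.of_forall hnn), hc]
  simp only [Matrix.cons_val_zero, Matrix.cons_val_one]
  congr 1
  ring

/-- Telescoping `bellman_square` leaves nonnegative defects, and the terminal term vanishes because
`μ` is stabilizing. -/
lemma le_tsum_stage {μ : ℝ → ℝ} (hμ : Stabilizing p μ) (x : ℝ) :
    ENNReal.ofReal (p.P * x ^ 2) ≤ ∑' t, ENNReal.ofReal (stage p μ x t) := by
  have hV : ∀ y, p.q * y ^ 2 + p.r * μ y ^ 2 + p.γ * (p.P * (p.a * y + p.b * μ y) ^ 2)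
      = p.P * y ^ 2 + (p.r + p.γ * p.b ^ 2 * p.P) * (μ y - p.Kstar * y) ^ 2 := by
    intro y
    rw [← bellman_square A.hr A.hγ0 A.hP y (μ y)]
    ring
  have hR := riccati_denom_pos A.hr A.hγ0 A.hP
  have hγ := A.hγ0
  have hle : ∀ T : ℕ, p.P * x ^ 2 - p.γ ^ T * (p.P * traj p μ x T ^ 2)
      ≤ ∑ t ∈ Finset.range T, stage p μ x t := by
    intro T
    rw [sum_stage_eq (V := fun y => p.P * y ^ 2) hV]
    have : 0 ≤ ∑ t ∈ Finset.range T, p.γ ^ t *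
        ((p.r + p.γ * p.b ^ 2 * p.P) * (μ (traj p μ x t) - p.Kstar * traj p μ x t) ^ 2) :=
      Finset.sum_nonneg fun t _ => by positivity
    linarith
  have hlim : Tendsto (fun T : ℕ => p.P * x ^ 2 - p.γ ^ T * (p.P * traj p μ x T ^ 2)) atTop
      (𝓝 (p.P * x ^ 2)) := by
    have h1 := tendsto_pow_atTop_nhds_zero_of_lt_one A.hγ0.le A.hγ1
    have h2 := h1.mul (((hμ x).pow 2).const_mul p.P)
    simpa using h2.const_sub (p.P * x ^ 2)
  refine le_of_tendsto' (ENNReal.tendsto_ofReal hlim) fun T => ?_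
  refine (ENNReal.ofReal_le_ofReal (hle T)).trans ?_
  rw [ENNReal.ofReal_sum_of_nonneg fun t _ => stage_nonneg A.hq A.hr A.hγ0 t]
  exact ENNReal.sum_le_tsum _

lemma Admissible.isOptimalGain_iff (k : ℝ) : IsOptimalGain p ρ k ↔ k = p.Kstar := by
  have hs : |p.cl p.Kstar| < 1 :=
    (abs_cl_Kstar_le A.hr A.hγ0 A.hP).trans_lt (by linarith [A.ha, A.hδ, A.hδ₀])
  constructor
  · rintro ⟨h1, h2⟩
    have hc := contr_of_abs_lt A ((stabilizing_iff k).1 h1)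
    have h := h2 _ ((stabilizing_iff p.Kstar).2 hs)
    have hP := A.hP.1
    rw [extCost_linear A hc, extCost_linear A A.contr_Kstar, A.val_Kstar,
      ENNReal.ofReal_le_ofReal_iff (by positivity)] at h
    have hv : val p k k ≤ p.P := le_of_mul_le_mul_left h (pow_pos A.hσ 2)
    have he := val_add_val_sub A.hr A.hγ0 A.hP hc hc
    have ho := one_le_occ A.hγ0 hc hc
    have hR := riccati_denom_pos A.hr A.hγ0 A.hP
    -- Uniqueness: by the performance difference, any other gain has a strictly larger value.
    by_contra hne
    have hpos : 0 < (k - p.Kstar) ^ 2 := by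
      have := sub_ne_zero.2 hne
      positivity
    have : 0 < (p.r + p.γ * p.b ^ 2 * p.P) *
      (occ p k k * (k - p.Kstar) ^ 2 + occ p k k * (k - p.Kstar) ^ 2) := by positivity
    linarith
  · rintro rfl
    refine ⟨(stabilizing_iff _).2 hs, fun μ hμ => ?_⟩
    have h0 : extCost p ρ (fun y => p.Kstar * y) = ∫⁻ x, ENNReal.ofReal (p.P * x ^ 2) ∂ρ := by
      have hsq : (fun x : ℝ => x ^ 2) = fun x => sqPos x + sqPos (-x) :=
        funext fun x => (sqPos_add_sqPos_neg x).symm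
      have hi : Integrable (fun x : ℝ => x ^ 2) ρ := by
        rw [hsq]
        exact A.integrable_sqPos.1.add A.integrable_sqPos_neg.1
      have hP := A.hP.1
      rw [extCost_linear A A.contr_Kstar, A.val_Kstar,
        ← ofReal_integral_eq_lintegral_ofReal (hi.const_mul p.P)
          (Eventually.of_forall fun x => by positivity), integral_const_mul, hsq,
        integral_add A.integrable_sqPos.1 A.integrable_sqPos_neg.1, A.integrable_sqPos.2,
        A.integrable_sqPos_neg.2]
      congr 1
      ring
    rw [h0]
    -- The comparison is pointwise in the initial state, so an arbitrary, possibly non-measurable,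
    -- law is covered.
    exact lintegral_mono fun x => le_tsum_stage A hμ x

end Optimal

/-! ### The network and its effective gains -/

/-- The index of the gain to which a neuron with input weight `w` contributes. -/
def cls (w : ℝ) : Fin 2 := if 0 ≤ w then 0 else 1

/-- The contribution of a neuron to the gain `i`. -/
def contrib (i : Fin 2) (w v : ℝ) : ℝ := if cls w = i then v * w else 0

section Network

variable {m : ℕ} (θ : Weights m)

lemma gains_apply (i : Fin 2) : gains θ i = ∑ j, contrib i (θ.1 j) (θ.2 j) := by
  revert i
  refine Fin.forall_fin_two.2 ⟨?_, ?_⟩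
  · change ∑ j with 0 ≤ θ.1 j, θ.2 j * θ.1 j = _
    rw [Finset.sum_filter]
    refine Finset.sum_congr rfl fun j _ => ?_
    by_cases h : 0 ≤ θ.1 j <;> simp [contrib, cls, h]
  · change ∑ j with θ.1 j < 0, θ.2 j * θ.1 j = _
    rw [Finset.sum_filter]
    refine Finset.sum_congr rfl fun j _ => ?_
    by_cases h : 0 ≤ θ.1 j
    · simp [contrib, cls, h, not_lt.2 h]
    · simp [contrib, cls, h, not_le.1 h]

/-- A neuron is active only on the half line of the sign of its input weight, and is linear there.
-/
lemma net_eq_gainLaw : net θ = gainLaw (gains θ) := by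
  ext x
  rw [net, gainLaw, gains_apply, gains_apply, Finset.sum_mul, Finset.sum_mul]
  split_ifs with hx
  · refine Finset.sum_congr rfl fun j _ => ?_
    unfold contrib cls
    by_cases h : 0 ≤ θ.1 j
    · simp [h, max_eq_right (mul_nonneg h hx), mul_assoc]
    · simp [h, max_eq_left (mul_nonpos_of_nonpos_of_nonneg (le_of_not_ge h) hx)]
  · push Not at hx
    refine Finset.sum_congr rfl fun j _ => ?_
    unfold contrib cls
    by_cases h : 0 ≤ θ.1 j
    · simp [h, max_eq_left (mul_nonpos_of_nonneg_of_nonpos h hx.le)]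
    · simp [h, max_eq_right (mul_nonneg_of_nonpos_of_nonpos (le_of_not_ge h) hx.le), mul_assoc]

lemma cost_net (p : Problem) (ρ : Measure ℝ) : cost p ρ (net θ) = gainCost p ρ (gains θ) := by
  rw [net_eq_gainLaw, gainCost]

/-- As long as the sign class is kept, moving one weight moves the gains along a coordinate line, so
partial derivatives reduce to the gain gradient. -/
lemma gains_update_w (j : Fin m) {t : ℝ} (ht : cls t = cls (θ.1 j)) :
    gains (Function.update θ.1 j t, θ.2)
      = gains θ + (t - θ.1 j) • EuclideanSpace.single (cls (θ.1 j)) (θ.2 j) := by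
  ext i
  rw [PiLp.add_apply, gains_apply, gains_apply, ← sub_eq_iff_eq_add', ← Finset.sum_sub_distrib,
    Finset.sum_eq_single j]
  · simp only [Function.update_self, contrib, ht, PiLp.smul_apply, smul_eq_mul,
      PiLp.single_apply]
    by_cases h : i = cls (θ.1 j)
    · subst h; simp; ring
    · simp [h, Ne.symm h]
  · intro j' _ hj'
    simp [Function.update_of_ne hj']
  · simp

lemma gains_update_v (j : Fin m) (t : ℝ) :
    gains (θ.1, Function.update θ.2 j t)
      = gains θ + (t - θ.2 j) • EuclideanSpace.single (cls (θ.1 j)) (θ.1 j) := by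
  ext i
  rw [PiLp.add_apply, gains_apply, gains_apply, ← sub_eq_iff_eq_add', ← Finset.sum_sub_distrib,
    Finset.sum_eq_single j]
  · simp only [Function.update_self, contrib, PiLp.smul_apply, smul_eq_mul,
      PiLp.single_apply]
    by_cases h : i = cls (θ.1 j)
    · subst h; simp; ring
    · simp [h, Ne.symm h]
  · intro j' _ hj'
    simp [Function.update_of_ne hj']
  · simp

lemma eventually_cls_eq {w : ℝ} (hw : w ≠ 0) : ∀ᶠ t in 𝓝 w, cls t = cls w := by
  rcases lt_or_gt_of_ne hw with h | h
  · filter_upwards [Iio_mem_nhds h] with t ht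
    simp [cls, not_le.2 h, not_le.2 (Set.mem_Iio.1 ht)]
  · filter_upwards [Ioi_mem_nhds h] with t ht
    simp [cls, h.le, (Set.mem_Ioi.1 ht).le]

lemma hasDerivAt_line {f : EuclideanSpace ℝ (Fin 2) → ℝ} {G K : EuclideanSpace ℝ (Fin 2)}
    (hf : HasGradientAt f G K) (x c : ℝ) (i : Fin 2) :
    HasDerivAt (fun t => f (K + (t - x) • EuclideanSpace.single i c)) (c * G i) x := by
  have hline : HasDerivAt (fun t : ℝ => K + (t - x) • EuclideanSpace.single i c)
      (EuclideanSpace.single i c) x := by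
    simpa using (((hasDerivAt_id x).sub_const x).smul_const (EuclideanSpace.single i c)).const_add K
  have hK : K + (x - x) • EuclideanSpace.single i c = K := by simp
  have hf' := hf.hasFDerivAt
  rw [← hK] at hf'
  have := hf'.comp_hasDerivAt x hline
  exact this.congr_deriv
    (by simp [InnerProductSpace.toDual_apply_apply, EuclideanSpace.inner_single_right])

variable {p : Problem} {ρ : Measure ℝ} {G : EuclideanSpace ℝ (Fin 2)}

lemma hasDerivAt_costW (hG : HasGradientAt (gainCost p ρ) G (gains θ)) (j : Fin m)
    (hw : θ.1 j ≠ 0) :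
    HasDerivAt (costW p ρ θ j) (θ.2 j * G (cls (θ.1 j))) (θ.1 j) := by
  refine (hasDerivAt_line hG (θ.1 j) (θ.2 j) (cls (θ.1 j))).congr_of_eventuallyEq ?_
  filter_upwards [eventually_cls_eq hw] with t ht
  rw [costW, cost_net, gains_update_w θ j ht]

lemma hasDerivAt_costV (hG : HasGradientAt (gainCost p ρ) G (gains θ)) (j : Fin m) :
    HasDerivAt (costV p ρ θ j) (θ.1 j * G (cls (θ.1 j))) (θ.2 j) := by
  refine (hasDerivAt_line hG (θ.2 j) (θ.1 j) (cls (θ.1 j))).congr_of_eventuallyEq ?_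
  refine Eventually.of_forall fun t => ?_
  rw [costV, cost_net, gains_update_v θ j t]

/-- The gradient step on the input weight of a neuron, for the gain gradient `G`. -/
def stepW (η : ℝ) (G : EuclideanSpace ℝ (Fin 2)) (w v : ℝ) : ℝ :=
  if w = 0 then w else w - η * (v * G (cls w))

/-- The gradient step on the output weight of a neuron, for the gain gradient `G`. -/
def stepV (η : ℝ) (G : EuclideanSpace ℝ (Fin 2)) (w v : ℝ) : ℝ := v - η * (w * G (cls w))

lemma pgStep_eq (hG : HasGradientAt (gainCost p ρ) G (gains θ)) (η : ℝ) :
    pgStep p ρ η θ = (fun j => stepW η G (θ.1 j) (θ.2 j), fun j => stepV η G (θ.1 j) (θ.2 j)) := by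
  refine Prod.ext (funext fun j => ?_) (funext fun j => ?_)
  · simp only [pgStep, gradW, stepW]
    split_ifs with h
    · simp
    · rw [(hasDerivAt_costW θ hG j h).deriv]
  · simp only [pgStep, gradV, stepV]
    rw [(hasDerivAt_costV θ hG j).deriv]

lemma wellPosed {δ₀ : ℝ} (A : Admissible p δ₀ ρ) (hθ : gains θ ∈ margin p (p.δ / 2)) :
    WellPosed p ρ θ := by
  have c0 := A.contr_zero hθ
  have c1 := A.contr_one hθ
  have hG := A.hasGradientAt_margin hθ
  refine ⟨fun x => ?_, ?_, fun j hj => (hasDerivAt_costW θ hG j hj).differentiableAt,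
    fun j => (hasDerivAt_costV θ hG j).differentiableAt⟩
  · rw [net_eq_gainLaw]
    exact (hasSum_stage_gainLaw A.hq A.hr A.hγ0 c0 c1 x).summable
  · rw [net_eq_gainLaw, costToGo_gainLaw A.hq A.hr A.hγ0 c0 c1]
    exact A.integrable_valFun

end Network

/-! ### One step of policy gradient -/

section Step

variable {η : ℝ} {G : EuclideanSpace ℝ (Fin 2)}

lemma abs_coord_le (G : EuclideanSpace ℝ (Fin 2)) (i : Fin 2) : |G i| ≤ ‖G‖ :=
  PiLp.norm_apply_le G i

/-- The change of the contribution of a neuron that does not change its class. -/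
def drift (η : ℝ) (G : EuclideanSpace ℝ (Fin 2)) (i : Fin 2) (w v : ℝ) : ℝ :=
  if cls w = i then -η * G i * (w ^ 2 + v ^ 2) + η ^ 2 * G i ^ 2 * (v * w) else 0

/-- The deviation of the change of a contribution from the drift. -/
def flipErr (η : ℝ) (G : EuclideanSpace ℝ (Fin 2)) (i : Fin 2) (w v : ℝ) : ℝ :=
  contrib i (stepW η G w v) (stepV η G w v) - contrib i w v - drift η G i w v

/-- `drift` is the exact expansion of `(v - η g w) (w - η g v) - v w`, second-order term included.
-/
lemma flipErr_eq_zero {w v : ℝ} (hw : w ≠ 0) (hc : cls (stepW η G w v) = cls w) (i : Fin 2) :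
    flipErr η G i w v = 0 := by
  unfold flipErr contrib drift
  rw [hc]
  split_ifs with h
  · subst h
    rw [stepW, if_neg hw, stepV]
    ring
  · simp

/-- A weight that crosses zero ends no farther from zero than the length of the step. -/
lemma abs_stepW_le_of_flip {w v : ℝ} (hc : cls (stepW η G w v) ≠ cls w) :
    |stepW η G w v| ≤ |η * (v * G (cls w))| := by
  have hw : w ≠ 0 := by
    rintro rfl
    exact hc (by simp [stepW])
  have e : stepW η G w v = w - η * (v * G (cls w)) := if_neg hw
  rw [e] at hc ⊢
  generalize η * (v * G (cls w)) = d at *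
  unfold cls at hc
  by_cases h : 0 ≤ w
  · rw [if_pos h] at hc
    have : w - d < 0 := by
      by_contra h'
      rw [if_pos (not_lt.1 h')] at hc
      exact hc rfl
    rw [abs_of_neg this]
    linarith [le_abs_self d]
  · rw [if_neg h] at hc
    have : 0 ≤ w - d := by
      by_contra h'
      rw [if_neg h'] at hc
      exact hc rfl
    rw [abs_of_nonneg this]
    linarith [neg_abs_le d]

/-- A flipped neuron errs by at most `7 / 5` of the scaled mass in each gain, so `14 / 5 ≤ 2 √2`
covers both. -/
lemma seven_fifths_le : (7 : ℝ) / 5 ≤ √2 := Real.le_sqrt_of_sq_le (by norm_num)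

lemma abs_flipErr_le (hη : 0 ≤ η) (hG : η * ‖G‖ ≤ 1) (w v : ℝ) :
    |flipErr η G 0 w v| + |flipErr η G 1 w v| ≤ 2 * √2 * (η * ‖G‖) * (w ^ 2 + v ^ 2) := by
  have hs := seven_fifths_le
  have hnn : 0 ≤ η * ‖G‖ := by positivity
  have hgi : η * |G (cls w)| ≤ η * ‖G‖ := mul_le_mul_of_nonneg_left (abs_coord_le G _) hη
  have hrhs : 14 / 5 * (η * ‖G‖) * (w ^ 2 + v ^ 2) ≤ 2 * √2 * (η * ‖G‖) * (w ^ 2 + v ^ 2) := by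
    gcongr
    linarith
  refine le_trans ?_ hrhs
  -- A frozen neuron with `w = 0` contributes nothing before or after, while the drift formula
  -- predicts `-η g v²`; this difference is charged to the error.
  by_cases hw : w = 0
  · subst hw
    have hc : cls 0 = 0 := by simp [cls]
    rw [hc] at hgi
    simp only [flipErr, contrib, drift, stepW, stepV, hc]
    simp only [if_true, zero_ne_one, if_false, zero_mul, mul_zero, sub_zero]
    norm_num
    rw [abs_of_nonneg hη]
    nlinarith [mul_le_mul_of_nonneg_right hgi (sq_nonneg v), mul_nonneg hnn (sq_nonneg v)]
  by_cases hc : cls (stepW η G w v) = cls w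
  · rw [flipErr_eq_zero hw hc, flipErr_eq_zero hw hc]
    simp only [abs_zero, add_zero]
    positivity
  · have h1 := abs_stepW_le_of_flip hc
    have h2 : |stepV η G w v| ≤ |v| + |w| := by
      rw [stepV]
      refine (abs_sub _ _).trans (add_le_add le_rfl ?_)
      rw [abs_mul, abs_mul, abs_of_nonneg hη]
      nlinarith [abs_nonneg w]
    rw [abs_mul, abs_mul, abs_of_nonneg hη] at h1
    have h3 : |stepW η G w v| ≤ η * ‖G‖ * |v| := by
      nlinarith [abs_nonneg v]
    have h4 : |stepV η G w v * stepW η G w v| ≤ 7 / 5 * (η * ‖G‖) * (w ^ 2 + v ^ 2) := by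
      rw [abs_mul, ← sq_abs w, ← sq_abs v]
      refine (mul_le_mul h2 h3 (abs_nonneg _) (by positivity)).trans ?_
      have : (|v| + |w|) * |v| ≤ 7 / 5 * (|w| ^ 2 + |v| ^ 2) := by
        nlinarith [sq_nonneg (|v| - 5 / 4 * |w|), sq_nonneg (|w|), sq_nonneg (|v|)]
      nlinarith [mul_le_mul_of_nonneg_left this hnn]
    have hlin : ∀ i, cls w = i → drift η G i w v = v * stepW η G w v - contrib i w v
        + (stepV η G w v - v) * stepW η G w v := by
      rintro i rfl
      simp only [drift, contrib, if_true, stepW, if_neg hw, stepV]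
      ring
    have hlin' : ∀ i, cls w ≠ i → drift η G i w v = 0 ∧ contrib i w v = 0 := by
      intro i hi
      simp [drift, contrib, hi]
    -- In the class left, contribution plus drift is the new product, which no longer counts. In the
    -- class entered, the new product appears without having been predicted.
    have hsw : ∀ i, |flipErr η G i w v| ≤ |stepV η G w v * stepW η G w v| := by
      intro i
      by_cases hi : cls w = i
      · have : contrib i (stepW η G w v) (stepV η G w v) = 0 := by
          rw [contrib, if_neg]
          rw [← hi]
          exact hc
        rw [flipErr, this, hlin i hi, ← abs_neg]
        apply le_of_eq
        congr 1
        ring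
      · obtain ⟨e1, e2⟩ := hlin' i hi
        rw [flipErr, e1, e2, contrib]
        split_ifs <;> simp [abs_nonneg, mul_nonneg]
    linarith [hsw 0, hsw 1]

variable {m : ℕ}

/-- The mass of the neurons of class `i`. -/
def massOf (θ : Weights m) (i : Fin 2) : ℝ := ∑ j with cls (θ.1 j) = i, (θ.1 j ^ 2 + θ.2 j ^ 2)

/-- The total mass of all neurons. -/
def totalMass (θ : Weights m) : ℝ := ∑ j, (θ.1 j ^ 2 + θ.2 j ^ 2)

lemma massOf_le_totalMass (θ : Weights m) (i : Fin 2) : massOf θ i ≤ totalMass θ :=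
  Finset.sum_le_sum_of_subset_of_nonneg (Finset.filter_subset _ _) fun j _ _ => by positivity

lemma abs_gains_le (θ : Weights m) (i : Fin 2) : |gains θ i| ≤ massOf θ i / 2 := by
  rw [gains_apply, massOf, Finset.sum_filter, Finset.sum_div]
  refine (Finset.abs_sum_le_sum_abs _ _).trans (Finset.sum_le_sum fun j _ => ?_)
  unfold contrib
  split_ifs
  · rw [abs_le]
    constructor <;> nlinarith [sq_nonneg (θ.1 j + θ.2 j), sq_nonneg (θ.1 j - θ.2 j)]
  · simp

/-- The weights after one gradient step for the gain gradient `G`. -/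
def stepWeights (η : ℝ) (G : EuclideanSpace ℝ (Fin 2)) (θ : Weights m) : Weights m :=
  (fun j => stepW η G (θ.1 j) (θ.2 j), fun j => stepV η G (θ.1 j) (θ.2 j))

variable {θ : Weights m} {X : Finset (Fin m)}

/-- The part of the change of the gains that comes from neurons keeping their class. -/
def driftVec (η : ℝ) (G : EuclideanSpace ℝ (Fin 2)) (θ : Weights m) : EuclideanSpace ℝ (Fin 2) :=
  WithLp.toLp 2 fun i => -η * G i * massOf θ i + η ^ 2 * G i ^ 2 * gains θ i

/-- `X` may be any set containing the neurons that change class or have `w = 0`; all others follow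
the drift exactly. -/
lemma norm_gains_sub_drift_le (hη : 0 ≤ η) (hG : η * ‖G‖ ≤ 1)
    (hX : ∀ j, j ∉ X → θ.1 j ≠ 0 ∧ cls (stepW η G (θ.1 j) (θ.2 j)) = cls (θ.1 j)) :
    ‖gains (stepWeights η G θ) - gains θ - driftVec η G θ‖
      ≤ 2 * √2 * (η * ‖G‖) * ∑ j ∈ X, (θ.1 j ^ 2 + θ.2 j ^ 2) := by
  have he : ∀ i, (gains (stepWeights η G θ) - gains θ - driftVec η G θ) i
      = ∑ j ∈ X, flipErr η G i (θ.1 j) (θ.2 j) := by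
    intro i
    have h1 : ∑ j ∈ X, flipErr η G i (θ.1 j) (θ.2 j) = ∑ j, flipErr η G i (θ.1 j) (θ.2 j) := by
      refine Finset.sum_subset (Finset.subset_univ _) fun j _ hj => ?_
      exact flipErr_eq_zero (hX j hj).1 (hX j hj).2 i
    have h2 : driftVec η G θ i = ∑ j, drift η G i (θ.1 j) (θ.2 j) := by
      simp only [driftVec, massOf, gains_apply, drift, contrib, Finset.sum_filter]
      rw [Finset.mul_sum, Finset.mul_sum, ← Finset.sum_add_distrib]
      refine Finset.sum_congr rfl fun j _ => ?_
      split_ifs <;> simp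
    rw [h1, PiLp.sub_apply, PiLp.sub_apply, h2, gains_apply, gains_apply]
    simp only [flipErr, stepWeights, Finset.sum_sub_distrib]
  set E := gains (stepWeights η G θ) - gains θ - driftVec η G θ
  have hn : ‖E‖ ≤ |E 0| + |E 1| := by
    rw [EuclideanSpace.norm_eq, Real.sqrt_le_left (by positivity), Fin.sum_univ_two]
    simp only [Real.norm_eq_abs]
    nlinarith [mul_nonneg (abs_nonneg (E 0)) (abs_nonneg (E 1))]
  refine hn.trans ?_
  rw [he, he, Finset.mul_sum]
  refine (add_le_add (Finset.abs_sum_le_sum_abs _ _) (Finset.abs_sum_le_sum_abs _ _)).trans ?_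
  rw [← Finset.sum_add_distrib]
  exact Finset.sum_le_sum fun j _ => abs_flipErr_le hη hG _ _

/-- The first-order term gives `Q`. The second-order one gives `Q / 2`, since the gains are at most
half the mass and `η ‖G‖ ≤ 1`. -/
lemma norm_driftVec_le {Q : ℝ} (hη : 0 ≤ η) (hG : η * ‖G‖ ≤ 1) (hQ : totalMass θ ≤ Q) :
    ‖driftVec η G θ‖ ≤ 3 / 2 * Q * (η * ‖G‖) := by
  have hQ0 : 0 ≤ Q := le_trans (Finset.sum_nonneg fun j _ => by positivity) hQ
  have hi : ∀ i, |driftVec η G θ i| ≤ 3 / 2 * Q * (η * |G i|) := by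
    intro i
    have hm := (massOf_le_totalMass θ i).trans hQ
    have hm0 : 0 ≤ massOf θ i := Finset.sum_nonneg fun j _ => by positivity
    have hk := abs_gains_le θ i
    have hg0 : 0 ≤ η * |G i| := by positivity
    have hg1 : η * |G i| ≤ 1 := (mul_le_mul_of_nonneg_left (abs_coord_le G i) hη).trans hG
    simp only [driftVec]
    refine (abs_add_le _ _).trans ?_
    rw [abs_mul, abs_mul, abs_mul, abs_mul, abs_neg, abs_of_nonneg hη, abs_of_nonneg hm0,
      abs_of_nonneg (by positivity : (0 : ℝ) ≤ η ^ 2), abs_of_nonneg (sq_nonneg (G i)),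
      ← sq_abs (G i), ← mul_pow]
    have h1 : (η * |G i|) ^ 2 ≤ η * |G i| := by nlinarith
    have h2 := mul_le_mul h1 hk (abs_nonneg _) hg0
    nlinarith [mul_le_mul_of_nonneg_left hm hg0]
  rw [EuclideanSpace.norm_eq, Real.sqrt_le_left (by positivity), Fin.sum_univ_two]
  have h0 := pow_le_pow_left₀ (abs_nonneg _) (hi 0) 2
  have h1 := pow_le_pow_left₀ (abs_nonneg _) (hi 1) 2
  simp only [Real.norm_eq_abs]
  calc _ ≤ _ := add_le_add h0 h1
    _ = (3 / 2 * Q * η) ^ 2 * (G 0 ^ 2 + G 1 ^ 2) := by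
      rw [← sq_abs (G 0), ← sq_abs (G 1)]; ring
    _ = (3 / 2 * Q * η) ^ 2 * ‖G‖ ^ 2 := by
      rw [EuclideanSpace.norm_sq_eq, Fin.sum_univ_two]
      simp only [Real.norm_eq_abs, sq_abs]
    _ = _ := by ring

/-- The masses of the classes act as a diagonal preconditioner of gradient descent on the gains, and
`lam` bounds its smaller entry from below. -/
lemma inner_driftVec_le {Q lam : ℝ} (hη : 0 ≤ η) (hQ : totalMass θ ≤ Q)
    (hlam : ∀ i, lam ≤ massOf θ i) :
    inner ℝ G (driftVec η G θ) ≤ η * ‖G‖ ^ 2 * (-lam + η * ‖G‖ * Q / 2) := by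
  have hi : ∀ i, driftVec η G θ i * G i ≤ η * G i ^ 2 * (-lam + η * ‖G‖ * Q / 2) := by
    intro i
    have hm := (massOf_le_totalMass θ i).trans hQ
    have hk : |gains θ i| ≤ Q / 2 := (abs_gains_le θ i).trans (by linarith)
    have h1 : G i * gains θ i ≤ ‖G‖ * (Q / 2) :=
      (le_abs_self _).trans (by
        rw [abs_mul]
        exact mul_le_mul (abs_coord_le G i) hk (abs_nonneg _) (norm_nonneg _))
    have h2 : 0 ≤ η * G i ^ 2 := by positivity
    have h3 : -massOf θ i + η * (G i * gains θ i) ≤ -lam + η * ‖G‖ * Q / 2 := by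
      have := hlam i
      have := mul_le_mul_of_nonneg_left h1 hη
      linarith
    calc driftVec η G θ i * G i = η * G i ^ 2 * (-massOf θ i + η * (G i * gains θ i)) := by
          simp only [driftVec]; ring
      _ ≤ _ := mul_le_mul_of_nonneg_left h3 h2
  rw [PiLp.inner_apply, Fin.sum_univ_two]
  simp only [RCLike.inner_apply, conj_trivial]
  have hn : ‖G‖ ^ 2 = G 0 ^ 2 + G 1 ^ 2 := by
    rw [EuclideanSpace.norm_sq_eq, Fin.sum_univ_two]
    simp only [Real.norm_eq_abs, sq_abs]
  calc _ ≤ _ := add_le_add (hi 0) (hi 1)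
    _ = η * (G 0 ^ 2 + G 1 ^ 2) * (-lam + η * ‖G‖ * Q / 2) := by ring
    _ = _ := by rw [hn]

end Step

/-! ### The descent lemma -/

lemma descent {E : Type*} [NormedAddCommGroup E] [InnerProductSpace ℝ E] [CompleteSpace E]
    {f : E → ℝ} {s : Set E} (hs : Convex ℝ s) {L : ℝ}
    (hf : ∀ x ∈ s, HasGradientAt f (gradient f x) x)
    (hL : ∀ x ∈ s, ∀ y ∈ s, ‖gradient f x - gradient f y‖ ≤ L * ‖x - y‖) {x y : E} (hx : x ∈ s)
    (hy : y ∈ s) :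
    f y ≤ f x + inner ℝ (gradient f x) (y - x) + L / 2 * ‖y - x‖ ^ 2 := by
  set d := y - x with hd
  have hmem : ∀ t ∈ Set.Icc (0 : ℝ) 1, x + t • d ∈ s := fun t ht =>
    hs.add_smul_sub_mem hx hy ht
  have hder : ∀ t ∈ Set.Icc (0 : ℝ) 1, HasDerivAt
      (fun t : ℝ => f (x + t • d) - t * inner ℝ (gradient f x) d - L / 2 * ‖d‖ ^ 2 * t ^ 2)
      (inner ℝ (gradient f (x + t • d)) d - inner ℝ (gradient f x) d - L * ‖d‖ ^ 2 * t) t := by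
    intro t ht
    have hline : HasDerivAt (fun t : ℝ => x + t • d) d t := by
      simpa using ((hasDerivAt_id t).smul_const d).const_add x
    have h1 := (hf _ (hmem t ht)).hasFDerivAt.comp_hasDerivAt t hline
    have h2 := (hasDerivAt_id t).mul_const (inner ℝ (gradient f x) d)
    have h3 := (hasDerivAt_pow 2 t).const_mul (L / 2 * ‖d‖ ^ 2)
    refine ((h1.sub h2).sub h3).congr_deriv ?_
    simp
    ring
  -- The Lipschitz bound makes the derivative of this auxiliary function nonpositive; comparing its
  -- values at `0` and `1` is the claim.
  have hanti := antitoneOn_of_deriv_nonpos (convex_Icc (0 : ℝ) 1)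
    (f := fun t : ℝ => f (x + t • d) - t * inner ℝ (gradient f x) d - L / 2 * ‖d‖ ^ 2 * t ^ 2)
    (fun t ht => (hder t ht).continuousAt.continuousWithinAt)
    (fun t ht => (hder t (interior_subset ht)).differentiableAt.differentiableWithinAt)
    (fun t ht => by
      have ht' := interior_subset ht
      rw [(hder t ht').deriv, ← inner_sub_left]
      have h1 := real_inner_le_norm (gradient f (x + t • d) - gradient f x) d
      have h2 := hL _ (hmem t ht') x hx
      rw [add_sub_cancel_left, norm_smul, Real.norm_of_nonneg ht'.1] at h2
      nlinarith [mul_le_mul_of_nonneg_right h2 (norm_nonneg d)])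
  have := hanti (Set.left_mem_Icc.2 zero_le_one) (Set.right_mem_Icc.2 zero_le_one) zero_le_one
  simp only [one_smul, zero_smul, add_zero, one_mul, zero_mul, one_pow, mul_one, sub_zero,
    ne_eq, OfNat.ofNat_ne_zero, not_false_eq_true, zero_pow, mul_zero] at this
  have e : x + d = y := by rw [hd]; abel
  rw [e] at this
  linarith

lemma convex_margin (p : Problem) (d : ℝ) : Convex ℝ (margin p d) := by
  have key : ∀ i : Fin 2, Convex ℝ {K : EuclideanSpace ℝ (Fin 2) | |p.a + p.b * K i| ≤ 1 - d} := by
    intro i K hK K' hK' u v hu hv huv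
    simp only [Set.mem_ofPred_eq, PiLp.add_apply, PiLp.smul_apply, smul_eq_mul] at *
    have e : p.a + p.b * (u * K i + v * K' i)
        = u * (p.a + p.b * K i) + v * (p.a + p.b * K' i) := by
      linear_combination (-p.a) * huv
    rw [e]
    refine (abs_add_le _ _).trans ?_
    rw [abs_mul, abs_mul, abs_of_nonneg hu, abs_of_nonneg hv]
    have e' : u * (1 - d) + v * (1 - d) = 1 - d := by linear_combination (1 - d) * huv
    linarith [mul_le_mul_of_nonneg_left hK hu, mul_le_mul_of_nonneg_left hK' hv]
  exact (key 0).inter (key 1)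

/-- Multiplicative perturbations with small total size move a point by a small relative amount. -/
lemma norm_le_of_relative_steps {E : Type*} [NormedAddCommGroup E] {z : ℕ → E} {e : ℕ → ℝ} {n : ℕ}
    {B : ℝ} (he : ∀ k, 0 ≤ e k) (hz : ∀ k < n, ‖z (k + 1) - z k‖ ≤ e k * ‖z k‖)
    (hB : ∑ k ∈ Finset.range n, e k ≤ B) {k : ℕ} (hk : k ≤ n) :
    ‖z k‖ ≤ Real.exp B * ‖z 0‖ ∧ ‖z k - z 0‖ ≤ Real.exp B * B * ‖z 0‖ := by
  have hmono : ∀ k ≤ n, ∑ i ∈ Finset.range k, e i ≤ B := fun k hk =>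
    (Finset.sum_le_sum_of_subset_of_nonneg (Finset.range_mono hk) fun i _ _ => he i).trans hB
  have h1 : ∀ k ≤ n, ‖z k‖ ≤ Real.exp (∑ i ∈ Finset.range k, e i) * ‖z 0‖ := by
    intro k
    induction k with
    | zero => simp
    | succ k ih =>
      intro hk
      have hi := ih (by omega)
      have hs := hz k (by omega)
      have ht : ‖z (k + 1)‖ ≤ (e k + 1) * ‖z k‖ := by
        have := norm_add_le (z (k + 1) - z k) (z k)
        rw [sub_add_cancel] at this
        linarith
      rw [Finset.sum_range_succ, Real.exp_add, mul_comm (Real.exp _), mul_assoc]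
      exact ht.trans (mul_le_mul (Real.add_one_le_exp _) hi (norm_nonneg _) (Real.exp_nonneg _))
  have h1' : ∀ k ≤ n, ‖z k‖ ≤ Real.exp B * ‖z 0‖ := fun k hk =>
    (h1 k hk).trans (mul_le_mul_of_nonneg_right (Real.exp_le_exp.2 (hmono k hk)) (norm_nonneg _))
  have h2 : ∀ k ≤ n, ‖z k - z 0‖ ≤ (∑ i ∈ Finset.range k, e i) * (Real.exp B * ‖z 0‖) := by
    intro k
    induction k with
    | zero => simp
    | succ k ih =>
      intro hk
      have hi := ih (by omega)
      have hs := (hz k (by omega)).trans (mul_le_mul_of_nonneg_left (h1' k (by omega)) (he k))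
      have := norm_add_le (z (k + 1) - z k) (z k - z 0)
      rw [sub_add_sub_cancel] at this
      rw [Finset.sum_range_succ, add_mul]
      linarith
  refine ⟨h1' k hk, (h2 k hk).trans ?_⟩
  calc _ ≤ B * (Real.exp B * ‖z 0‖) :=
        mul_le_mul_of_nonneg_right (hmono k hk) (by positivity)
    _ = _ := by ring

/-! ### Trajectories of the weights -/

/-- The weights of a neuron as a point of the plane. -/
def neuron {m : ℕ} (θ : Weights m) (j : Fin m) : ℂ := ⟨θ.1 j, θ.2 j⟩

section Trajectory

variable {m : ℕ}

lemma norm_neuron_sq (θ : Weights m) (j : Fin m) : ‖neuron θ j‖ ^ 2 = θ.1 j ^ 2 + θ.2 j ^ 2 := by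
  rw [Complex.sq_norm, Complex.normSq_apply, neuron]
  ring

/-- The gradient of a neuron is a gain gradient entry times the swapped vector `(v, w)`, which has
the same norm; freezing `w = 0` only shortens the step. -/
lemma norm_neuron_step_le {η : ℝ} (hη : 0 ≤ η) (G : EuclideanSpace ℝ (Fin 2)) (θ : Weights m)
    (j : Fin m) :
    ‖neuron (stepWeights η G θ) j - neuron θ j‖ ≤ η * ‖G‖ * ‖neuron θ j‖ := by
  refine le_of_sq_le_sq ?_ (by positivity)
  rw [mul_pow, norm_neuron_sq, Complex.sq_norm, Complex.normSq_apply]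
  have hg : (η * G (cls (θ.1 j))) ^ 2 ≤ (η * ‖G‖) ^ 2 := by
    rw [← sq_abs (η * G _), abs_mul, abs_of_nonneg hη]
    exact pow_le_pow_left₀ (by positivity)
      (mul_le_mul_of_nonneg_left (abs_coord_le G _) hη) 2
  refine le_trans ?_ (mul_le_mul_of_nonneg_right hg (by positivity))
  simp only [neuron, stepWeights, Complex.sub_re, Complex.sub_im, stepW, stepV]
  split_ifs with h
  · rw [h]
    nlinarith [mul_nonneg (sq_nonneg (η * G (cls 0))) (sq_nonneg (θ.2 j))]
  · apply le_of_eq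
    ring

lemma cls_eq_of_abs_sub_lt {x y : ℝ} (h : |x - y| < |y|) : x ≠ 0 ∧ cls x = cls y := by
  rw [abs_lt] at h
  unfold cls
  rcases le_or_gt 0 y with hy | hy
  · rw [abs_of_nonneg hy] at h
    have : 0 < x := by linarith
    simp [this.ne', this.le, hy]
  · rw [abs_of_neg hy] at h
    have : x < 0 := by linarith
    simp [this.ne, not_le.2 this, not_le.2 hy]

variable {θ : ℕ → Weights m} {G : ℕ → EuclideanSpace ℝ (Fin 2)} {η B : ℝ} {n : ℕ}

/-- The neurons whose input weight is not large compared with the total movement. -/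
def exceptional (B : ℝ) (θ₀ : Weights m) : Finset (Fin m) :=
  {j | |θ₀.1 j| ≤ Real.exp B * B * ‖neuron θ₀ j‖}

variable (hη : 0 ≤ η) (hθ : ∀ k < n, θ (k + 1) = stepWeights η (G k) (θ k))
  (hB : ∑ k ∈ Finset.range n, η * ‖G k‖ ≤ B)
include hη hθ hB

lemma neuron_bounds {k : ℕ} (hk : k ≤ n) (j : Fin m) :
    ‖neuron (θ k) j‖ ≤ Real.exp B * ‖neuron (θ 0) j‖ ∧
      ‖neuron (θ k) j - neuron (θ 0) j‖ ≤ Real.exp B * B * ‖neuron (θ 0) j‖ := by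
  refine norm_le_of_relative_steps (z := fun k => neuron (θ k) j) (e := fun k => η * ‖G k‖)
    (fun k => by positivity) (fun k hk => ?_) hB hk
  rw [hθ k hk]
  exact norm_neuron_step_le hη _ _ _

lemma sum_sq_le {k : ℕ} (hk : k ≤ n) (X : Finset (Fin m)) :
    ∑ j ∈ X, ((θ k).1 j ^ 2 + (θ k).2 j ^ 2)
      ≤ Real.exp (2 * B) * ∑ j ∈ X, ((θ 0).1 j ^ 2 + (θ 0).2 j ^ 2) := by
  rw [Finset.mul_sum]
  refine Finset.sum_le_sum fun j _ => ?_
  rw [← norm_neuron_sq, ← norm_neuron_sq]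
  have := pow_le_pow_left₀ (norm_nonneg _) (neuron_bounds hη hθ hB hk j).1 2
  rwa [mul_pow, ← Real.exp_nat_mul, Nat.cast_ofNat] at this

/-- The total movement of such a neuron is smaller than its initial input weight, so the sign never
changes. -/
lemma cls_eq_of_notMem {k : ℕ} (hk : k ≤ n) {j : Fin m} (hj : j ∉ exceptional B (θ 0)) :
    (θ k).1 j ≠ 0 ∧ cls ((θ k).1 j) = cls ((θ 0).1 j) := by
  have h := (neuron_bounds hη hθ hB hk j).2
  have hj' : Real.exp B * B * ‖neuron (θ 0) j‖ < |(θ 0).1 j| := by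
    simpa [exceptional] using hj
  refine cls_eq_of_abs_sub_lt (lt_of_le_of_lt ?_ (h.trans_lt hj'))
  exact Complex.abs_re_le_norm (neuron (θ k) j - neuron (θ 0) j)

/-- The neurons of `Γ` move by at most half the lower bound `t` of their input weights. They keep
their class and an input weight of size at least `t / 2`. -/
lemma le_massOf {i : Fin 2} {Γ : Finset (Fin m)} {t R c : ℝ} (ht : 0 < t)
    (hΓ : ∀ j ∈ Γ, cls ((θ 0).1 j) = i ∧ t ≤ |(θ 0).1 j| ∧ ‖neuron (θ 0) j‖ ≤ R)
    (hB0 : 0 ≤ B) (hR : Real.exp B * B * R ≤ t / 2) (hc : c ≤ Γ.card) {k : ℕ} (hk : k ≤ n) :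
    c * (t / 2) ^ 2 ≤ massOf (θ k) i := by
  have key : ∀ j ∈ Γ, cls ((θ k).1 j) = i ∧ t / 2 ≤ |(θ k).1 j| := by
    intro j hj
    obtain ⟨h1, h2, h3⟩ := hΓ j hj
    have h4 : |(θ k).1 j - (θ 0).1 j| ≤ t / 2 :=
      calc |(θ k).1 j - (θ 0).1 j| ≤ ‖neuron (θ k) j - neuron (θ 0) j‖ :=
            Complex.abs_re_le_norm (neuron (θ k) j - neuron (θ 0) j)
        _ ≤ Real.exp B * B * ‖neuron (θ 0) j‖ := (neuron_bounds hη hθ hB hk j).2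
        _ ≤ Real.exp B * B * R := by gcongr
        _ ≤ t / 2 := hR
    refine ⟨?_, ?_⟩
    · rw [(cls_eq_of_abs_sub_lt (lt_of_le_of_lt h4 (by linarith))).2, h1]
    · have := abs_sub_abs_le_abs_sub ((θ 0).1 j) ((θ k).1 j)
      rw [abs_sub_comm] at this
      linarith
  calc c * (t / 2) ^ 2 ≤ Γ.card * (t / 2) ^ 2 := by gcongr
    _ = ∑ _j ∈ Γ, (t / 2) ^ 2 := by simp
    _ ≤ ∑ j ∈ Γ, ((θ k).1 j ^ 2 + (θ k).2 j ^ 2) := by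
        refine Finset.sum_le_sum fun j hj => ?_
        have := pow_le_pow_left₀ (by positivity) (key j hj).2 2
        rw [sq_abs] at this
        nlinarith [sq_nonneg ((θ k).2 j)]
    _ ≤ massOf (θ k) i := by
        refine Finset.sum_le_sum_of_subset_of_nonneg (fun j hj => ?_) fun j _ _ => by positivity
        simp [(key j hj).1]

end Trajectory

/-! ### Deterministic convergence from good initial weights. -/

/-- The properties of the initial weights on which the convergence rests. -/
structure GoodInit (p : Problem) (ρ : Measure ℝ) (h : Hyper) {m : ℕ} (θ : Weights m) : Prop where
  safe : gains θ ∈ margin p p.δ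
  gap : gainCost p ρ (gains θ) - optCost p ρ ≤ h.Δ
  mass : totalMass θ ≤ h.RstarSq
  massW : h.massW p θ ≤ h.Mw
  massV : h.massV θ ≤ h.Mv
  good : ∀ i, h.c * m ≤ (Finset.card {j | cls (θ.1 j) = i ∧ h.tau / √m ≤ |θ.1 j| ∧
    |θ.1 j| ≤ h.W / √m ∧ |θ.2 j| ≤ h.V / √m} : ℕ)

/-- The origin of `tauW`: solving `|w| ≤ x ‖(w, v)‖` for `|w|`, with `x = e^B B < 1` and `|v| ≤ V /
√m`, gives `|w| ≤ tauW / √m`. -/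
lemma sum_exceptional_le {p : Problem} {h : Hyper} {m : ℕ} {θ₀ : Weights m}
    (hB0 : 0 ≤ h.B p) (hB1 : Real.exp (h.B p) * h.B p < 1) :
    ∑ j ∈ exceptional (h.B p) θ₀, (θ₀.1 j ^ 2 + θ₀.2 j ^ 2) ≤ h.massW p θ₀ + h.massV θ₀ := by
  have hsub : exceptional (h.B p) θ₀ ⊆ ({j | |θ₀.1 j| ≤ h.tauW p / √m} : Finset (Fin m))
      ∪ ({j | h.V / √m < |θ₀.2 j|} : Finset (Fin m)) := by
    intro j hj
    simp only [exceptional, Finset.mem_filter, Finset.mem_univ, true_and, Finset.mem_union] at hj ⊢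
    by_contra hcon
    push Not at hcon
    obtain ⟨hw, hv⟩ := hcon
    set x := Real.exp (h.B p) * h.B p with hx
    have hx0 : 0 ≤ x := by positivity
    have hsq : Real.exp (2 * h.B p) * h.B p ^ 2 = x ^ 2 := by
      rw [hx, mul_pow, ← Real.exp_nat_mul, Nat.cast_ofNat]
    have hpos : 0 < 1 - x ^ 2 := by nlinarith
    have hs : 0 < √(1 - x ^ 2) := Real.sqrt_pos.2 hpos
    have h1 : θ₀.1 j ^ 2 * (1 - x ^ 2) ≤ x ^ 2 * θ₀.2 j ^ 2 := by
      have := pow_le_pow_left₀ (abs_nonneg _) hj 2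
      rw [mul_pow, norm_neuron_sq, sq_abs] at this
      linarith
    have h2 : |θ₀.1 j| * √(1 - x ^ 2) ≤ x * |θ₀.2 j| := by
      refine le_of_sq_le_sq ?_ (by positivity)
      rw [mul_pow |θ₀.1 j|, mul_pow x, sq_abs, sq_abs, Real.sq_sqrt hpos.le]
      exact h1
    have h3 : |θ₀.1 j| ≤ h.tauW p / √m := by
      have e : h.tauW p / √m = x * (h.V / √m) / √(1 - x ^ 2) := by
        rw [Hyper.tauW, hsq]
        ring
      rw [e, le_div_iff₀ hs]
      exact h2.trans (mul_le_mul_of_nonneg_left hv hx0)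
    exact absurd h3 (not_le.2 hw)
  refine (Finset.sum_le_sum_of_subset_of_nonneg hsub fun j _ _ => by positivity).trans ?_
  have := Finset.sum_union_inter (s₁ := ({j | |θ₀.1 j| ≤ h.tauW p / √m} : Finset (Fin m)))
    (s₂ := ({j | h.V / √m < |θ₀.2 j|} : Finset (Fin m)))
    (f := fun j => θ₀.1 j ^ 2 + θ₀.2 j ^ 2)
  rw [Hyper.massW, Hyper.massV, ← this]
  exact le_add_of_nonneg_right (Finset.sum_nonneg fun j _ => by positivity)

section Convergence

variable {p : Problem} {ρ : Measure ℝ} {δ₀ : ℝ} (A : Admissible p δ₀ ρ)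
include A

lemma Admissible.optGains_mem : optGains p ∈ margin p (p.δ / 2) := by
  have h := (abs_cl_Kstar_le A.hr A.hγ0 A.hP).trans A.ha
  have := A.hδ
  have := A.hδ₀
  have h' : |p.a + p.b * p.Kstar| ≤ 1 - p.δ / 2 := le_trans h (by linarith)
  exact ⟨by simpa [optGains] using h', by simpa [optGains] using h'⟩

lemma Admissible.gradient_optGains : gradient (gainCost p ρ) (optGains p) = 0 := by
  have hs : slope p p.Kstar p.Kstar = 0 := by
    have hm : max (p.cl p.Kstar) 0 - max (-p.cl p.Kstar) 0 = p.cl p.Kstar := by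
      rcases le_total 0 (p.cl p.Kstar) with h | h
      · rw [max_eq_left h, max_eq_right (by linarith)]; ring
      · rw [max_eq_right h, max_eq_left (by linarith)]; ring
    have e : p.cl p.Kstar = p.a + p.b * p.Kstar := rfl
    rw [slope, A.val_Kstar, ← sub_mul, hm, e]
    linear_combination 2 * Kstar_mul A.hr A.hγ0 A.hP
  rw [A.gradient_eq (A.contr_zero A.optGains_mem) (A.contr_one A.optGains_mem)]
  ext i
  fin_cases i <;> simp [gainGrad, optGains, hs]

/-- The gradient is controlled by the cost gap. -/
lemma Admissible.norm_gradient_sq_le {L : ℝ} (hL : IsSmoothConst p ρ L)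
    {K : EuclideanSpace ℝ (Fin 2)} (hK : K ∈ margin p (p.δ / 2)) :
    ‖gradient (gainCost p ρ) K‖ ^ 2 ≤ L ^ 2 / p.growth * (gainCost p ρ K - optCost p ρ) := by
  -- The gradient vanishes at the optimum, so smoothness bounds it by the distance, and quadratic
  -- growth bounds the distance by the gap.
  have h1 := hL K hK _ A.optGains_mem
  rw [A.gradient_optGains, sub_zero] at h1
  have h2 := pow_le_pow_left₀ (norm_nonneg _) h1 2
  have h3 := A.growth_mul_le (A.contr_zero hK) (A.contr_one hK)
  have hg := A.growth_pos
  refine h2.trans ?_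
  rw [div_mul_eq_mul_div, le_div_iff₀ hg]
  nlinarith [mul_le_mul_of_nonneg_left h3 (sq_nonneg L)]

/-- One step of policy gradient: safety increment and descent. -/
lemma Admissible.step {h : Hyper} {ι : ℝ} {m : ℕ} (hm : 0 < m) (hι : 0 < ι) (hs : 0 < h.s)
    (hV : 0 < h.V) (hβ : 0 < h.β) (hB0 : 0 ≤ h.B p) (hBen : h.Benign p ι m)
    {θ : ℕ → Weights m} {n : ℕ}
    (hθ : ∀ k < n, θ (k + 1) = stepWeights (ι / m) (gradient (gainCost p ρ) (gains (θ k))) (θ k))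
    (hB : ∑ k ∈ Finset.range n, ι / m * ‖gradient (gainCost p ρ) (gains (θ k))‖ ≤ h.B p)
    (hsafe : ∀ k < n, gains (θ k) ∈ margin p (p.δ / 2))
    (hinit : GoodInit p ρ h (θ 0)) {k : ℕ} (hk : k < n) :
    ‖gains (θ (k + 1)) - gains (θ k)‖
        ≤ ι / m * ‖gradient (gainCost p ρ) (gains (θ k))‖ * h.Lstar p ∧
      inner ℝ (gradient (gainCost p ρ) (gains (θ k))) (gains (θ (k + 1)) - gains (θ k))
        ≤ ι / m * ‖gradient (gainCost p ρ) (gains (θ k))‖ ^ 2 *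
          (-h.lamStar + ι / m * p.Gmax * h.Gstar p / 2 + 2 * √2 * h.XiStar p) := by
  obtain ⟨b1, b2, b3, b4, b5, b6, b7⟩ := hBen
  have hmR : (0 : ℝ) < m := Nat.cast_pos.2 hm
  have hη : 0 ≤ ι / m := by positivity
  set G := gradient (gainCost p ρ) (gains (θ k)) with hG
  have hGmax : ‖G‖ ≤ p.Gmax := A.norm_gradient_le (hsafe k hk)
  have hηG : ι / m * ‖G‖ ≤ 1 := (mul_le_mul_of_nonneg_left hGmax hη).trans b1
  have hQ : totalMass (θ k) ≤ h.Gstar p :=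
    (sum_sq_le hη hθ hB hk.le Finset.univ).trans
      (mul_le_mul_of_nonneg_left hinit.mass (Real.exp_nonneg _))
  have hX : ∑ j ∈ exceptional (h.B p) (θ 0), ((θ k).1 j ^ 2 + (θ k).2 j ^ 2) ≤ h.XiStar p :=
    (sum_sq_le hη hθ hB hk.le _).trans (mul_le_mul_of_nonneg_left
      ((sum_exceptional_le hB0 b3).trans (add_le_add hinit.massW hinit.massV))
      (Real.exp_nonneg _))
  have hcls : ∀ j, j ∉ exceptional (h.B p) (θ 0) → (θ k).1 j ≠ 0 ∧
      cls (stepW (ι / m) G ((θ k).1 j) ((θ k).2 j)) = cls ((θ k).1 j) := by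
    intro j hj
    have h1 := cls_eq_of_notMem hη hθ hB hk.le hj
    -- The movement bound also covers time `k + 1`, so the class agrees with the initial one both
    -- before and after this step.
    have h2 := cls_eq_of_notMem hη hθ hB (Nat.succ_le_of_lt hk) hj
    rw [Nat.succ_eq_add_one, hθ k hk] at h2
    exact ⟨h1.1, h2.2.trans h1.2.symm⟩
  have hsm : 0 < √(m : ℝ) := Real.sqrt_pos.2 hmR
  have htau : 0 < h.tau := mul_pos hs (Real.sqrt_pos.2 hβ)
  have hlam : ∀ i, h.lamStar ≤ massOf (θ k) i := by
    intro i
    -- At least `c m` neurons, each with squared input weight at least `τ² / (4 m)`: the width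
    -- cancels and leaves `lamStar`.
    have := le_massOf (t := h.tau / √m) (R := h.Rc / √m) (i := i) hη hθ hB (by positivity) ?_ hB0
      ?_ (hinit.good i) hk.le
    · refine le_trans (le_of_eq ?_) this
      rw [Hyper.lamStar, div_div, div_pow, mul_pow, Real.sq_sqrt hmR.le]
      field_simp
      norm_num
    · intro j hj
      simp only [Finset.mem_filter, Finset.mem_univ, true_and] at hj
      obtain ⟨h1, h2, h3, h4⟩ := hj
      refine ⟨h1, h2, ?_⟩
      have hRc : 0 ≤ h.Rc := Real.sqrt_nonneg _
      refine le_of_sq_le_sq ?_ (by positivity)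
      rw [norm_neuron_sq, ← sq_abs ((θ 0).1 j), ← sq_abs ((θ 0).2 j), div_pow, Hyper.Rc,
        Real.sq_sqrt (by positivity), add_div, ← div_pow, ← div_pow]
      exact add_le_add (pow_le_pow_left₀ (abs_nonneg _) h3 2) (pow_le_pow_left₀ (abs_nonneg _) h4 2)
    · rw [← mul_div_assoc, div_div, mul_comm (√(m : ℝ)) 2, ← div_div]
      exact div_le_div_of_nonneg_right b4 hsm.le
  have herr := norm_gains_sub_drift_le hη hηG hcls
  have hdr := norm_driftVec_le hη hηG hQ
  have hin := inner_driftVec_le (G := G) hη hQ hlam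
  have hηG0 : 0 ≤ ι / m * ‖G‖ := by positivity
  have herr' : ‖gains (stepWeights (ι / m) G (θ k)) - gains (θ k) - driftVec (ι / m) G (θ k)‖
      ≤ 2 * √2 * (ι / m * ‖G‖) * h.XiStar p :=
    herr.trans (mul_le_mul_of_nonneg_left hX (by positivity))
  rw [hθ k hk, ← hG]
  generalize gains (stepWeights (ι / m) G (θ k)) - gains (θ k) = D at *
  generalize driftVec (ι / m) G (θ k) = R at *
  have hDR : D = R + (D - R) := by abel
  constructor
  · rw [hDR, Hyper.Lstar]
    refine (norm_add_le _ _).trans ?_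
    linarith
  · rw [hDR, inner_add_right]
    have h1 := (real_inner_le_norm G (D - R)).trans
      (mul_le_mul_of_nonneg_left herr' (norm_nonneg _))
    have h2 : ι / m * ‖G‖ ^ 2 * (-h.lamStar + ι / m * ‖G‖ * h.Gstar p / 2)
        ≤ ι / m * ‖G‖ ^ 2 * (-h.lamStar + ι / m * p.Gmax * h.Gstar p / 2) := by
      have hGs : 0 ≤ h.Gstar p := by
        refine le_trans (Finset.sum_nonneg fun j _ => ?_) hQ
        positivity
      gcongr
    have h3 : ‖G‖ * (2 * √2 * (ι / m * ‖G‖) * h.XiStar p)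
        = ι / m * ‖G‖ ^ 2 * (2 * √2 * h.XiStar p) := by ring
    rw [h3] at h1
    linarith

omit A in
lemma rate_eq (h : Hyper) (hβ : 0 < h.β) (ι : ℝ) (m : ℕ) :
    h.rate ι m = 1 - ι / m * h.lamStar * h.α := by
  rw [Hyper.rate, Hyper.lamStar, Hyper.c, Hyper.tau, mul_pow, Real.sq_sqrt hβ.le]
  ring

/-- Linear convergence from good initial weights. -/
lemma Admissible.converges {h : Hyper} {ι : ℝ} {m : ℕ} (hm : 0 < m) (hι : 0 < ι) (hL0 : 0 < h.L)
    (hL : IsSmoothConst p ρ h.L) (hα0 : 0 < h.α) (hα : IsPLConst p ρ h.α) (hs : 0 < h.s)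
    (hV : 0 < h.V) (hβ : 0 < h.β) (hc : 0 < h.c) (hΔ : 0 ≤ h.Δ)
    (hBen : h.Benign p ι m)
    {θ₀ : Weights m} (hinit : GoodInit p ρ h θ₀) (n : ℕ) : ∀ k ≤ n,
      gains (iter p ρ (ι / m) θ₀ k) ∈ margin p (p.δ / 2) ∧
      gainCost p ρ (gains (iter p ρ (ι / m) θ₀ k)) - optCost p ρ
        ≤ h.rate ι m ^ k * (gainCost p ρ (gains θ₀) - optCost p ρ) := by
  have hmR : (0 : ℝ) < m := Nat.cast_pos.2 hm
  have hη : 0 < ι / m := by positivity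
  have htau : 0 < h.tau := mul_pos hs (Real.sqrt_pos.2 hβ)
  have hlam : 0 < h.lamStar := by unfold Hyper.lamStar; positivity
  have hg := A.growth_pos
  have hBen' := hBen
  obtain ⟨b1, b2, b3, b4, b5, b6, b7⟩ := hBen'
  have hrate := rate_eq h hβ ι m
  set r := h.rate ι m
  have hr0 : 0 ≤ r := by rw [hrate]; linarith
  have hr1 : r < 1 := by rw [hrate]; have : 0 < ι / m * h.lamStar * h.α := by positivity
                         linarith
  have hB0 : 0 ≤ h.B p := by unfold Hyper.B; positivity
  have hsub : margin p p.δ ⊆ margin p (p.δ / 2) := fun K hK =>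
    ⟨hK.1.trans (by linarith [A.hδ]), hK.2.trans (by linarith [A.hδ])⟩
  have hsq0 := Real.sqrt_nonneg r
  have hsq1 : √r < 1 := by rw [Real.sqrt_lt' one_pos]; simpa using hr1
  set θ : ℕ → Weights m := iter p ρ (ι / m) θ₀ with hθdef
  have hθ0 : θ 0 = θ₀ := rfl
  have hgap0 := A.gap_nonneg (hsub hinit.safe)
  -- The whole history up to `n` is kept, because the movement bound sums over all earlier steps.
  induction n with
  | zero =>
    intro k hk
    obtain rfl : k = 0 := by omega
    exact ⟨hsub hinit.safe, by rw [pow_zero, one_mul, hθ0]⟩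
  | succ n ih =>
    have hsafe : ∀ k < n + 1, gains (θ k) ∈ margin p (p.δ / 2) := fun k hk => (ih k (by omega)).1
    have hstep : ∀ k < n + 1,
        θ (k + 1) = stepWeights (ι / m) (gradient (gainCost p ρ) (gains (θ k))) (θ k) := by
      intro k hk
      rw [hθdef, iter, Function.iterate_succ_apply']
      exact pgStep_eq _ (A.hasGradientAt_margin (hsafe k hk)) _
    have hgrad : ∀ k < n + 1, ‖gradient (gainCost p ρ) (gains (θ k))‖
        ≤ √(h.Cgrad p * h.Δ) * √r ^ k := by
      intro k hk
      have h1 := A.norm_gradient_sq_le hL (hsafe k hk)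
      have h2 := (ih k (by omega)).2
      have hC : 0 ≤ h.Cgrad p := by unfold Hyper.Cgrad; positivity
      refine le_of_sq_le_sq ?_ (by positivity)
      rw [mul_pow, Real.sq_sqrt (by positivity), ← pow_mul, mul_comm k 2, pow_mul,
        Real.sq_sqrt hr0]
      have h3 : r ^ k * (gainCost p ρ (gains θ₀) - optCost p ρ) ≤ r ^ k * h.Δ :=
        mul_le_mul_of_nonneg_left hinit.gap (by positivity)
      calc _ ≤ h.Cgrad p * (gainCost p ρ (gains (θ k)) - optCost p ρ) := h1
        _ ≤ h.Cgrad p * (r ^ k * h.Δ) := mul_le_mul_of_nonneg_left (h2.trans h3) hC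
        _ = _ := by ring
    have hB : ∑ k ∈ Finset.range (n + 1), ι / m * ‖gradient (gainCost p ρ) (gains (θ k))‖
        ≤ h.B p := by
      have h1 : ∑ k ∈ Finset.range (n + 1), ι / m * ‖gradient (gainCost p ρ) (gains (θ k))‖
          ≤ ι / m * √(h.Cgrad p * h.Δ) * ∑ k ∈ Finset.range (n + 1), √r ^ k := by
        rw [Finset.mul_sum]
        refine Finset.sum_le_sum fun k hk => ?_
        rw [mul_assoc]
        exact mul_le_mul_of_nonneg_left (hgrad k (Finset.mem_range.1 hk)) hη.le
      -- Gradients decay like `√r ^ k`. Since `1 - r = (1 - √r) (1 + √r)` and `1 + √r ≤ 2`, the sum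
      -- is at most `2 / (1 - r)`, the source of the `2` in `B`.
      have h2 : ∑ k ∈ Finset.range (n + 1), √r ^ k ≤ 2 / (ι / m * h.lamStar * h.α) := by
        have hg1 : (∑ k ∈ Finset.range (n + 1), √r ^ k) * (1 - √r) ≤ 1 := by
          rw [geom_sum_mul_neg]
          linarith [pow_nonneg hsq0 (n + 1)]
        have hg0 : 0 ≤ ∑ k ∈ Finset.range (n + 1), √r ^ k :=
          Finset.sum_nonneg fun k _ => by positivity
        have e : ι / m * h.lamStar * h.α = (1 - √r) * (1 + √r) := by
          have := Real.sq_sqrt hr0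
          have e' : (1 - √r) * (1 + √r) = 1 - √r ^ 2 := by ring
          rw [e', this, hrate]
          ring
        rw [le_div_iff₀ (by positivity), e, ← mul_assoc]
        nlinarith
      refine h1.trans ((mul_le_mul_of_nonneg_left h2 (by positivity)).trans (le_of_eq ?_))
      rw [Hyper.B]
      field_simp
    have hall : ∀ k < n + 1, _ := fun k hk =>
      A.step hm hι hs hV hβ hB0 hBen hstep hB hsafe hinit hk
    have hLs : 0 ≤ h.Lstar p := by
      have h1 : 0 ≤ h.Gstar p := mul_nonneg (Real.exp_nonneg _)
        ((Finset.sum_nonneg fun j _ => by positivity).trans hinit.mass)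
      have h2 : 0 ≤ h.XiStar p := mul_nonneg (Real.exp_nonneg _) (add_nonneg
        ((Finset.sum_nonneg fun j _ => by positivity).trans hinit.massW)
        ((Finset.sum_nonneg fun j _ => by positivity).trans hinit.massV))
      unfold Hyper.Lstar
      positivity
    have hdist : ‖gains (θ (n + 1)) - gains θ₀‖ ≤ h.B p * h.Lstar p := by
      have h1 := Finset.sum_range_sub (fun k => gains (θ k)) (n + 1)
      rw [← hθ0, ← h1]
      refine (norm_sum_le _ _).trans ((Finset.sum_le_sum fun k hk =>
        (hall k (Finset.mem_range.1 hk)).1).trans ?_)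
      rw [← Finset.sum_mul]
      exact mul_le_mul_of_nonneg_right hB hLs
    -- Displacement is measured from the initial gains, whose margin is `δ`; the last benign
    -- condition allows half of it to be used up.
    have hcoord : ∀ i, |p.a + p.b * gains θ₀ i| ≤ 1 - p.δ →
        |p.a + p.b * gains (θ (n + 1)) i| ≤ 1 - p.δ / 2 := by
      intro i hi
      have h1 := (abs_coord_le (gains (θ (n + 1)) - gains θ₀) i).trans hdist
      have e : p.a + p.b * gains (θ (n + 1)) i
          = (p.a + p.b * gains θ₀ i) + p.b * (gains (θ (n + 1)) - gains θ₀) i := by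
        rw [PiLp.sub_apply]; ring
      rw [e]
      refine (abs_add_le _ _).trans ?_
      rw [abs_mul]
      have := mul_le_mul_of_nonneg_left h1 (abs_nonneg p.b)
      nlinarith
    have hnew : gains (θ (n + 1)) ∈ margin p (p.δ / 2) :=
      ⟨hcoord 0 hinit.safe.1, hcoord 1 hinit.safe.2⟩
    intro k hk
    rcases Nat.lt_or_ge k (n + 1) with hk' | hk'
    · exact ih k (by omega)
    obtain rfl : k = n + 1 := by omega
    refine ⟨hnew, ?_⟩
    obtain ⟨s1, s2⟩ := hall n (by omega)
    have hn := hsafe n (by omega)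
    have hd := descent (convex_margin p (p.δ / 2)) (fun K hK => A.hasGradientAt_margin hK)
      hL hn hnew
    have hPL := hα _ hn
    have hprev := (ih n le_rfl).2
    set g := ‖gradient (gainCost p ρ) (gains (θ n))‖
    have s3 : ‖gains (θ (n + 1)) - gains (θ n)‖ ^ 2 ≤ (ι / m * g * h.Lstar p) ^ 2 :=
      pow_le_pow_left₀ (norm_nonneg _) s1 2
    have s4 : h.L / 2 * ‖gains (θ (n + 1)) - gains (θ n)‖ ^ 2
        ≤ h.L / 2 * (ι / m * g * h.Lstar p) ^ 2 := mul_le_mul_of_nonneg_left s3 (by positivity)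
    have hηg : 0 ≤ ι / m * g ^ 2 := by positivity
    -- Sign changes and second-order terms each cost at most a quarter of `lamStar`, so half of it
    -- remains.
    have s5 : gainCost p ρ (gains (θ (n + 1))) - gainCost p ρ (gains (θ n))
        ≤ ι / m * g ^ 2 * (-(h.lamStar / 2)) := by
      have e : ι / m * g ^ 2 * (-h.lamStar + ι / m * p.Gmax * h.Gstar p / 2 + 2 * √2 * h.XiStar p)
          + h.L / 2 * (ι / m * g * h.Lstar p) ^ 2
          = ι / m * g ^ 2 * (-h.lamStar + ι / m * h.Cstar p + 2 * √2 * h.XiStar p) := by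
        rw [Hyper.Cstar]; ring
      have : ι / m * g ^ 2 * (-h.lamStar + ι / m * h.Cstar p + 2 * √2 * h.XiStar p)
          ≤ ι / m * g ^ 2 * (-(h.lamStar / 2)) :=
        mul_le_mul_of_nonneg_left (by linarith) hηg
      linarith
    have s6 : gainCost p ρ (gains (θ (n + 1))) - optCost p ρ
        ≤ r * (gainCost p ρ (gains (θ n)) - optCost p ρ) := by
      have := mul_le_mul_of_nonneg_left hPL (mul_nonneg hη.le hlam.le)
      rw [hrate]
      linarith
    refine s6.trans ((mul_le_mul_of_nonneg_left hprev hr0).trans (le_of_eq ?_))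
    ring

end Convergence

/-! ### Exponentially small events -/

section Chernoff

variable {Ω : Type*} [MeasurableSpace Ω] {ν : Measure Ω}

/-- A family of events for `m` independent samples whose probability decays exponentially. -/
def ExpSmall (ν : Measure Ω) (S : ∀ m : ℕ, Set (Fin m → Ω)) : Prop :=
  (∀ m, MeasurableSet (S m)) ∧ ∃ C, 0 < C ∧ ∃ m₀ : ℕ, ∀ m ≥ m₀,
    (Measure.pi fun _ : Fin m => ν).real (S m) ≤ Real.exp (-C * m)

lemma ExpSmall.union [IsProbabilityMeasure ν] {S T : ∀ m : ℕ, Set (Fin m → Ω)}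
    (hS : ExpSmall ν S) (hT : ExpSmall ν T) : ExpSmall ν fun m => S m ∪ T m := by
  obtain ⟨s1, C, hC, m₀, h⟩ := hS
  obtain ⟨t1, D, hD, m₁, h'⟩ := hT
  -- Halving the smaller rate absorbs the factor `2` of the union bound once `m` is large.
  refine ⟨fun m => (s1 m).union (t1 m), min C D / 2, by positivity, ?_⟩
  have hmin : 0 < min C D := lt_min hC hD
  obtain ⟨m₂, hm₂⟩ := exists_nat_ge (Real.log 2 / (min C D / 2))
  refine ⟨max m₀ (max m₁ m₂), fun m hm => ?_⟩
  have h0 : m₀ ≤ m := le_trans (le_max_left _ _) hm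
  have h1 : m₁ ≤ m := le_trans (le_trans (le_max_left _ _) (le_max_right _ _)) hm
  have h2 : m₂ ≤ m := le_trans (le_trans (le_max_right _ _) (le_max_right _ _)) hm
  have e1 : Real.exp (-C * m) ≤ Real.exp (-min C D * m) := by
    refine Real.exp_le_exp.2 (mul_le_mul_of_nonneg_right ?_ (Nat.cast_nonneg m))
    exact neg_le_neg (min_le_left _ _)
  have e2 : Real.exp (-D * m) ≤ Real.exp (-min C D * m) := by
    refine Real.exp_le_exp.2 (mul_le_mul_of_nonneg_right ?_ (Nat.cast_nonneg m))
    exact neg_le_neg (min_le_right _ _)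
  have e3 : 2 ≤ Real.exp (min C D / 2 * m) := by
    rw [← Real.log_le_iff_le_exp (by norm_num)]
    have : (m₂ : ℝ) ≤ m := Nat.cast_le.2 h2
    have := hm₂.trans this
    rw [div_le_iff₀ (by positivity)] at this
    linarith
  refine (measureReal_union_le _ _).trans ((add_le_add (h m h0) (h' m h1)).trans ?_)
  have e4 : Real.exp (-(min C D / 2) * m)
      = Real.exp (min C D / 2 * m) * Real.exp (-min C D * m) := by
    rw [← Real.exp_add]; congr 1; ring
  rw [e4]
  nlinarith [Real.exp_pos (-min C D * m)]

lemma measurable_sample_sum {f : Ω → ℝ} (hf : Measurable f) (m : ℕ) :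
    Measurable fun ζ : Fin m → Ω => ∑ j, f (ζ j) :=
  Finset.measurable_sum _ fun j _ => hf.comp (measurable_pi_apply j)

lemma integral_sample [IsProbabilityMeasure ν] {g : Ω → ℝ} (hg : AEStronglyMeasurable g ν) {m : ℕ}
    (j : Fin m) : ∫ ζ, g (ζ j) ∂(Measure.pi fun _ : Fin m => ν) = ∫ x, g x ∂ν := by
  have hp := measurePreserving_eval (fun _ : Fin m => ν) j
  have := integral_map (f := g) hp.measurable.aemeasurable (by rwa [hp.map_eq])
  rw [hp.map_eq] at this
  exact this.symm

/-- Cramér–Chernoff bound for sums of i.i.d. variables with an exponential moment. -/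
lemma expSmall_sum [IsProbabilityMeasure ν] {f : Ω → ℝ} (hf : Measurable f)
    (h0 : 0 ∈ interior (integrableExpSet f ν)) {M : ℝ} (hM : ∫ x, f x ∂ν < M) :
    ExpSmall ν fun m => {ζ | M * m ≤ ∑ j, f (ζ j)} := by
  refine ⟨fun m => measurableSet_le measurable_const (measurable_sample_sum hf m), ?_⟩
  set φ : ℝ → ℝ := fun t => Real.exp (-t * M) * mgf f ν t with hφ
  have hφ0 : φ 0 = 1 := by simp [hφ]
  have hder : HasDerivAt φ (∫ x, f x ∂ν - M) 0 := by
    have h1 := hasDerivAt_mgf h0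
    have h2 : HasDerivAt (fun t : ℝ => Real.exp (-t * M)) (-M) 0 := by
      have := ((hasDerivAt_id (0 : ℝ)).fun_neg.mul_const M).exp
      simpa using this
    refine (h2.mul h1).congr_deriv ?_
    simp
    ring
  -- `φ` equals `1` at `0` and decreases there because `M` exceeds the mean. A small `t > 0` with `φ
  -- t < 1` supplies the rate `-log (φ t)`.
  have hslope := (hasDerivAt_iff_tendsto_slope.1 hder).eventually
    (gt_mem_nhds (show ∫ x, f x ∂ν - M < 0 by linarith))
  have hslope' : ∀ᶠ t in 𝓝[>] (0 : ℝ), _root_.slope φ 0 t < 0 :=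
    hslope.filter_mono (nhdsWithin_mono _ fun t ht => ne_of_gt ht)
  have hint : ∀ᶠ t in 𝓝[>] (0 : ℝ), t ∈ integrableExpSet f ν :=
    nhdsWithin_le_nhds (mem_interior_iff_mem_nhds.1 h0)
  obtain ⟨t, ⟨ht1, ht2⟩, ht0⟩ := ((hslope'.and hint).and self_mem_nhdsWithin).exists
  have ht0' : 0 < t := ht0
  have hlt : φ t < 1 := by
    rw [slope_def_field, hφ0, sub_zero, div_lt_iff₀ ht0'] at ht1
    linarith
  have hpos : 0 < φ t := mul_pos (Real.exp_pos _) (mgf_pos ht2)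
  refine ⟨-Real.log (φ t), neg_pos.2 (Real.log_neg hpos hlt), 0, fun m _ => ?_⟩
  set X : Fin m → (Fin m → Ω) → ℝ := fun j ζ => f (ζ j) with hX
  have hind : iIndepFun X (Measure.pi fun _ : Fin m => ν) :=
    iIndepFun_pi (X := fun _ => f) fun _ => hf.aemeasurable
  have hXm : ∀ j, Measurable (X j) := fun j => hf.comp (measurable_pi_apply j)
  have hXmgf : ∀ j, mgf (X j) (Measure.pi fun _ : Fin m => ν) t = mgf f ν t := by
    intro j
    exact integral_sample (g := fun x => Real.exp (t * f x))
      (hf.const_mul t).exp.aestronglyMeasurable j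
  have hXint : ∀ j, Integrable (fun ζ => Real.exp (t * X j ζ)) (Measure.pi fun _ : Fin m => ν) := by
    intro j
    have hp := measurePreserving_eval (fun _ : Fin m => ν) j
    exact hp.integrable_comp_of_integrable ht2
  have hsum := hind.integrable_exp_mul_sum hXm (s := Finset.univ) fun j _ => hXint j
  have hch := measure_ge_le_exp_mul_mgf (M * m) ht0'.le hsum
  rw [hind.mgf_sum hXm] at hch
  simp only [hXmgf, Finset.prod_const, Finset.card_univ, Fintype.card_fin] at hch
  have he : Real.exp (-t * (M * m)) * mgf f ν t ^ m = Real.exp (-(-Real.log (φ t)) * m) := by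
    rw [neg_neg, mul_comm (Real.log _), Real.exp_nat_mul, Real.exp_log hpos, hφ, mul_pow,
      ← Real.exp_nat_mul]
    congr 2
    ring
  rw [he] at hch
  have hset : {ζ : Fin m → Ω | M * m ≤ ∑ j, f (ζ j)} = {ζ | M * m ≤ (∑ j, X j) ζ} := by
    ext ζ
    simp [hX, Finset.sum_apply]
  exact (congrArg _ hset).trans_le hch

end Chernoff

/-! ### The law of the rescaled initial weights -/

/-- The law of a neuron of the initialization, rescaled by `√m`. -/
def baseLaw (β : ℝ) : Measure (ℝ × ℝ) :=
  (gaussianReal 0 β.toNNReal).prod (gaussianReal 0 ((β ^ 2)⁻¹).toNNReal)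

instance (β : ℝ) : IsProbabilityMeasure (baseLaw β) := by
  unfold baseLaw
  infer_instance

/-- The weights rescaled by `√m`, neuron by neuron. -/
def rescale {m : ℕ} (θ : Weights m) (j : Fin m) : ℝ × ℝ := (√m * θ.1 j, √m * θ.2 j)

lemma measurePreserving_mul_gaussian {c v v' : ℝ} (hv : 0 ≤ v) (h : c ^ 2 * v = v') :
    MeasurePreserving (fun x => c * x) (gaussianReal 0 v.toNNReal) (gaussianReal 0 v'.toNNReal) := by
  refine ⟨measurable_const_mul c, ?_⟩
  rw [gaussianReal_map_const_mul, mul_zero]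
  congr 1
  apply NNReal.coe_injective
  rw [← h, Real.coe_toNNReal _ (by positivity), NNReal.coe_mul, Real.coe_toNNReal _ hv]
  rfl

/-- Rescaling turns the initialization into `m` i.i.d. samples of one fixed law, which makes all
rates independent of `m`. -/
lemma measurePreserving_rescale {β : ℝ} (hβ : 0 < β) {m : ℕ} (hm : 0 < m) :
    MeasurePreserving (rescale (m := m)) (initLaw β m) (Measure.pi fun _ : Fin m => baseLaw β) := by
  have hmR : (0 : ℝ) < m := Nat.cast_pos.2 hm
  have h1 : MeasurePreserving (fun x => √(m : ℝ) * x) (gaussianReal 0 (β / m).toNNReal)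
      (gaussianReal 0 β.toNNReal) := by
    refine measurePreserving_mul_gaussian (by positivity) ?_
    rw [Real.sq_sqrt hmR.le]
    field_simp
  have h2 : MeasurePreserving (fun x => √(m : ℝ) * x) (gaussianReal 0 ((β ^ 2)⁻¹ / m).toNNReal)
      (gaussianReal 0 ((β ^ 2)⁻¹).toNNReal) := by
    refine measurePreserving_mul_gaussian (by positivity) ?_
    rw [Real.sq_sqrt hmR.le]
    field_simp
  have h3 := (measurePreserving_arrowProdEquivProdArrow ℝ ℝ (Fin m)
    (fun _ => gaussianReal 0 (β / m).toNNReal)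
    (fun _ => gaussianReal 0 ((β ^ 2)⁻¹ / m).toNNReal)).symm
  have h4 := measurePreserving_pi
    (fun _ : Fin m => (gaussianReal 0 (β / m).toNNReal).prod
      (gaussianReal 0 ((β ^ 2)⁻¹ / m).toNNReal))
    (fun _ : Fin m => baseLaw β) fun _ => h1.prod h2
  exact h4.comp h3

lemma exists_integrable_exp_sq_baseLaw (β : ℝ) :
    ∃ c, 0 < c ∧ Integrable (fun u => Real.exp (c * (u.1 ^ 2 + u.2 ^ 2))) (baseLaw β) := by
  -- Fernique's theorem for each coordinate; independence multiplies the two integrals.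
  obtain ⟨c, hc, h⟩ := IsGaussian.exists_integrable_exp_sq (gaussianReal 0 β.toNNReal)
  obtain ⟨d, hd, h'⟩ := IsGaussian.exists_integrable_exp_sq (gaussianReal 0 ((β ^ 2)⁻¹).toNNReal)
  refine ⟨min c d, lt_min hc hd, (h.mul_prod h').mono' ?_ (Eventually.of_forall fun u => ?_)⟩
  · exact (by fun_prop : Continuous fun u : ℝ × ℝ =>
      Real.exp (min c d * (u.1 ^ 2 + u.2 ^ 2))).aestronglyMeasurable
  · rw [Real.norm_of_nonneg (Real.exp_nonneg _), ← Real.exp_add, Real.exp_le_exp]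
    simp only [Real.norm_eq_abs, sq_abs]
    have h1 := mul_le_mul_of_nonneg_right (min_le_left c d) (sq_nonneg u.1)
    have h2 := mul_le_mul_of_nonneg_right (min_le_right c d) (sq_nonneg u.2)
    linarith

/-- Functions of quadratic growth have exponential moments under the law of a neuron. -/
lemma zero_mem_interior_integrableExpSet {β : ℝ} {f : ℝ × ℝ → ℝ} (hf : Measurable f) {D : ℝ}
    (h : ∀ u, |f u| ≤ u.1 ^ 2 + u.2 ^ 2 + D) :
    0 ∈ interior (integrableExpSet f (baseLaw β)) := by
  obtain ⟨c, hc, hi⟩ := exists_integrable_exp_sq_baseLaw β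
  rw [mem_interior_iff_mem_nhds]
  filter_upwards [Metric.ball_mem_nhds (0 : ℝ) hc] with t ht
  rw [mem_ball_zero_iff, Real.norm_eq_abs] at ht
  have hi' := hi.mul_const (Real.exp (|t| * D))
  refine Integrable.mono' hi' (hf.const_mul t).exp.aestronglyMeasurable
    (Eventually.of_forall fun u => ?_)
  rw [Real.norm_of_nonneg (Real.exp_nonneg _), ← Real.exp_add, Real.exp_le_exp]
  have h1 : t * f u ≤ |t| * (u.1 ^ 2 + u.2 ^ 2 + D) := by
    refine (le_abs_self _).trans ?_
    rw [abs_mul]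
    exact mul_le_mul_of_nonneg_left (h u) (abs_nonneg t)
  nlinarith [mul_le_mul_of_nonneg_right ht.le (by positivity : 0 ≤ u.1 ^ 2 + u.2 ^ 2)]

lemma integral_sample_sum {Ω : Type*} [MeasurableSpace Ω] {ν : Measure Ω} [IsProbabilityMeasure ν]
    {f : Ω → ℝ} (hf : Integrable f ν) (m : ℕ) :
    ∫ ζ, ∑ j, f (ζ j) ∂(Measure.pi fun _ : Fin m => ν) = m * ∫ x, f x ∂ν := by
  have hint : ∀ j : Fin m, Integrable (fun ζ : Fin m → Ω => f (ζ j))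
      (Measure.pi fun _ : Fin m => ν) := fun j =>
    (measurePreserving_eval (fun _ : Fin m => ν) j).integrable_comp_of_integrable hf
  rw [integral_finsetSum _ fun j _ => hint j]
  simp [integral_sample hf.aestronglyMeasurable]

/-! ### Gaussian moments and probabilities -/

lemma integral_sq_gaussian (v : NNReal) : ∫ x, x ^ 2 ∂(gaussianReal 0 v) = v := by
  rw [← variance_id_gaussianReal (μ := 0) (v := v), variance_of_integral_eq_zero
    measurable_id.aemeasurable (by simp)]
  rfl

lemma integrable_of_quadratic {β : ℝ} {f : ℝ × ℝ → ℝ} (hf : Measurable f) {D : ℝ}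
    (h : ∀ u, |f u| ≤ u.1 ^ 2 + u.2 ^ 2 + D) : Integrable f (baseLaw β) :=
  integrable_of_mem_interior_integrableExpSet (zero_mem_interior_integrableExpSet hf h)

lemma integral_sq_add_sq_baseLaw {β : ℝ} (hβ : 0 < β) :
    ∫ u, (u.1 ^ 2 + u.2 ^ 2) ∂(baseLaw β) = (β ^ 2)⁻¹ + β := by
  rw [integral_add]
  · rw [baseLaw, integral_fun_fst (fun x : ℝ => x ^ 2), integral_fun_snd (fun x : ℝ => x ^ 2),
      integral_sq_gaussian, integral_sq_gaussian, Real.coe_toNNReal _ hβ.le,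
      Real.coe_toNNReal _ (by positivity)]
    simp
    ring
  · refine integrable_of_quadratic (D := 0) (by fun_prop) fun u => ?_
    rw [abs_of_nonneg (sq_nonneg _)]
    linarith [sq_nonneg u.2]
  · refine integrable_of_quadratic (D := 0) (by fun_prop) fun u => ?_
    rw [abs_of_nonneg (sq_nonneg _)]
    linarith [sq_nonneg u.1]

lemma measurable_cls : Measurable cls :=
  Measurable.ite measurableSet_Ici measurable_const measurable_const

lemma measurable_contrib (i : Fin 2) : Measurable fun u : ℝ × ℝ => contrib i u.1 u.2 :=
  Measurable.ite ((measurable_cls.comp measurable_fst) (measurableSet_singleton i))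
    (by fun_prop) measurable_const

/-- The output weight is centred and independent of the input weight, so the initial gains
concentrate at `0`. -/
lemma integral_contrib_baseLaw (β : ℝ) (i : Fin 2) :
    ∫ u, contrib i u.1 u.2 ∂(baseLaw β) = 0 := by
  have : ∀ u : ℝ × ℝ, contrib i u.1 u.2 = (if cls u.1 = i then u.1 else 0) * u.2 := by
    intro u
    unfold contrib
    split_ifs <;> ring
  simp only [this]
  rw [baseLaw, integral_prod_mul (fun w => if cls w = i then w else 0) (fun v => v),
    integral_id_gaussianReal, mul_zero]

lemma stdGaussian_Icc (s S : ℝ) (h : s ≤ S) :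
    (gaussianReal 0 1).real (Set.Icc s S) = Phi S - Phi s := by
  have : NullSingletonClass (gaussianReal 0 1) := nullSingletonClass_gaussianReal one_ne_zero
  have e : (gaussianReal 0 1).real (Set.Icc s S) = (gaussianReal 0 1).real (Set.Ioc s S) :=
    measureReal_congr Ioc_ae_eq_Icc.symm
  rw [e, Phi, Phi, cdf_eq_real, cdf_eq_real,
    ← measureReal_sdiff (Set.Iic_subset_Iic.2 h) measurableSet_Iic, Set.Iic_sdiff_Iic]

lemma stdGaussian_Icc_neg (s S : ℝ) :
    (gaussianReal 0 1).real (Set.Icc (-S) (-s)) = (gaussianReal 0 1).real (Set.Icc s S) := by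
  have h : (gaussianReal 0 1).map (fun x => -x) = gaussianReal 0 1 := by
    rw [gaussianReal_map_neg, neg_zero]
  conv_rhs => rw [← h]
  rw [map_measureReal_apply measurable_neg measurableSet_Icc]
  congr 1
  ext x
  simp only [Set.mem_Icc, Set.mem_preimage]
  constructor <;> rintro ⟨h1, h2⟩ <;> constructor <;> linarith

lemma Phi_neg (x : ℝ) : Phi (-x) = 1 - Phi x := by
  have : NullSingletonClass (gaussianReal 0 1) := nullSingletonClass_gaussianReal one_ne_zero
  have h : (gaussianReal 0 1).map (fun x => -x) = gaussianReal 0 1 := by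
    rw [gaussianReal_map_neg, neg_zero]
  rw [Phi, Phi, cdf_eq_real, cdf_eq_real]
  conv_lhs => rw [← h]
  rw [map_measureReal_apply measurable_neg measurableSet_Iic]
  have e : (fun x : ℝ => -x) ⁻¹' Set.Iic (-x) = Set.Ici x := by
    ext y; simp
  rw [e, ← probReal_compl_eq_one_sub measurableSet_Iic, Set.compl_Iic]
  exact measureReal_congr Ioi_ae_eq_Ici.symm

lemma Phi_lt {s S : ℝ} (h : s < S) : Phi s < Phi S := by
  have h1 := stdGaussian_Icc s S h.le
  have h2 : 0 < (gaussianReal 0 1).real (Set.Icc s S) := by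
    rw [measureReal_def, ENNReal.toReal_pos_iff]
    refine ⟨pos_iff_ne_zero.2 fun h0 => ?_, measure_lt_top _ _⟩
    have := gaussianReal_absolutelyContinuous' 0 one_ne_zero h0
    rw [Real.volume_Icc, ENNReal.ofReal_eq_zero] at this
    linarith
  linarith

lemma Hyper.c_pos {h : Hyper} (hsS : h.s < h.S) (hV : 0 < h.V) (hβ : 0 < h.β) (hε : h.ε < 1) :
    0 < h.c := by
  have h1 := Phi_lt hsS
  have h2 : Phi (-(h.V * h.β)) < Phi (h.V * h.β) := Phi_lt (by nlinarith [mul_pos hV hβ])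
  rw [Phi_neg] at h2
  exact mul_pos (mul_pos (by linarith) (by linarith)) (by linarith)

/-- The range of rescaled weights of the well-behaved neurons of class `i`. -/
def goodRange (h : Hyper) (i : Fin 2) : Set (ℝ × ℝ) :=
  {w | cls w = i ∧ h.tau ≤ |w| ∧ |w| ≤ h.W} ×ˢ {v | |v| ≤ h.V}

lemma measurableSet_goodRange (h : Hyper) (i : Fin 2) : MeasurableSet (goodRange h i) :=
  ((measurable_cls (measurableSet_singleton i)).inter
    ((measurableSet_le measurable_const measurable_abs).inter
      (measurableSet_le measurable_abs measurable_const))).prod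
    (measurableSet_le measurable_abs measurable_const)

/-- Standardizing turns `tau`, `W`, `V` into `s`, `S`, `V β`; by symmetry both classes have the same
probability, which is `c / (1 - ε)`. -/
lemma baseLaw_goodRange {h : Hyper} (hs : 0 < h.s) (hsS : h.s < h.S) (hV : 0 < h.V)
    (hβ : 0 < h.β) (i : Fin 2) :
    (baseLaw h.β).real (goodRange h i)
      = (Phi h.S - Phi h.s) * (2 * Phi (h.V * h.β) - 1) := by
  have hsβ : 0 < √h.β := Real.sqrt_pos.2 hβ
  rw [baseLaw, goodRange, measureReal_prod_prod]
  congr 1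
  · have hmp := measurePreserving_mul_gaussian (c := √h.β) (v := 1) (v' := h.β) zero_le_one
      (by rw [mul_one, Real.sq_sqrt hβ.le])
    rw [Real.toNNReal_one] at hmp
    have hmeas : MeasurableSet {w : ℝ | cls w = i ∧ h.tau ≤ |w| ∧ |w| ≤ h.W} :=
      (measurable_cls (measurableSet_singleton i)).inter
        ((measurableSet_le measurable_const measurable_abs).inter
          (measurableSet_le measurable_abs measurable_const))
    rw [← hmp.measureReal_preimage hmeas.nullMeasurableSet, ← stdGaussian_Icc _ _ hsS.le]
    have habs : ∀ z : ℝ, h.tau ≤ |√h.β * z| ∧ |√h.β * z| ≤ h.W ↔ h.s ≤ |z| ∧ |z| ≤ h.S := by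
      intro z
      rw [abs_mul, abs_of_pos hsβ, Hyper.tau, Hyper.W, mul_comm, mul_comm h.S,
        mul_le_mul_iff_right₀ hsβ, mul_le_mul_iff_right₀ hsβ]
    have hcls : ∀ z : ℝ, cls (√h.β * z) = cls z := by
      intro z
      unfold cls
      simp only [mul_nonneg_iff_of_pos_left hsβ]
    have hpre : (fun z => √h.β * z) ⁻¹' {w | cls w = i ∧ h.tau ≤ |w| ∧ |w| ≤ h.W}
        = {z | cls z = i ∧ h.s ≤ |z| ∧ |z| ≤ h.S} := by
      ext z
      simp only [Set.mem_preimage, Set.mem_ofPred_eq, habs, hcls]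
    refine (congrArg _ hpre).trans ?_
    revert i
    refine Fin.forall_fin_two.2 ⟨fun _ _ => ?_, fun _ _ => ?_⟩
    · congr 1
      ext z
      simp only [Set.mem_ofPred_eq, Set.mem_Icc, cls]
      by_cases hz : 0 ≤ z
      · simp [hz, abs_of_nonneg hz]
      · simp only [hz, if_false, one_ne_zero, false_and, false_iff]
        rintro ⟨h1, _⟩
        linarith
    · rw [← stdGaussian_Icc_neg]
      congr 1
      ext z
      simp only [Set.mem_ofPred_eq, Set.mem_Icc, cls]
      by_cases hz : 0 ≤ z
      · simp only [hz, if_true, zero_ne_one, false_and, false_iff]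
        rintro ⟨_, h1⟩
        linarith
      · simp only [hz, if_false, true_and, abs_of_neg (not_le.1 hz)]
        constructor <;> rintro ⟨h1, h2⟩ <;> constructor <;> linarith
  · have hmp := measurePreserving_mul_gaussian (c := h.β⁻¹) (v := 1) (v' := (h.β ^ 2)⁻¹)
      zero_le_one (by rw [mul_one, inv_pow])
    rw [Real.toNNReal_one] at hmp
    rw [← hmp.measureReal_preimage (measurableSet_le measurable_abs
      measurable_const).nullMeasurableSet]
    have hpre : (fun z => h.β⁻¹ * z) ⁻¹' {v | |v| ≤ h.V}
        = Set.Icc (-(h.V * h.β)) (h.V * h.β) := by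
      ext z
      simp only [Set.mem_preimage, Set.mem_ofPred_eq, Set.mem_Icc]
      rw [abs_mul, abs_of_pos (inv_pos.2 hβ), inv_mul_le_iff₀ hβ, abs_le, mul_comm h.β]
    refine (congrArg _ hpre).trans ?_
    rw [stdGaussian_Icc _ _ (by nlinarith [mul_pos hV hβ]), Phi_neg]
    ring

/-! ### Good initial weights have high probability -/

/-- The squared norm of the weights `u` of a neuron. -/
def sqNorm (u : ℝ × ℝ) : ℝ := u.1 ^ 2 + u.2 ^ 2

/-- The squared norm, restricted to neurons with a small input weight. -/
def sqNormW (p : Problem) (h : Hyper) (u : ℝ × ℝ) : ℝ := if |u.1| ≤ h.tauW p then sqNorm u else 0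

/-- The squared norm, restricted to neurons with a large output weight. -/
def sqNormV (h : Hyper) (u : ℝ × ℝ) : ℝ := if h.V < |u.2| then sqNorm u else 0

lemma sqNorm_nonneg (u : ℝ × ℝ) : 0 ≤ sqNorm u := by
  unfold sqNorm
  positivity

lemma measurable_sqNorm : Measurable sqNorm := by
  unfold sqNorm
  fun_prop

lemma measurable_sqNormW (p : Problem) (h : Hyper) : Measurable (sqNormW p h) :=
  Measurable.ite (measurableSet_le (measurable_abs.comp measurable_fst) measurable_const)
    measurable_sqNorm measurable_const

lemma measurable_sqNormV (h : Hyper) : Measurable (sqNormV h) :=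
  Measurable.ite (measurableSet_lt measurable_const (measurable_abs.comp measurable_snd))
    measurable_sqNorm measurable_const

lemma abs_ite_sqNorm_le (P : Prop) [Decidable P] (u : ℝ × ℝ) :
    |if P then sqNorm u else 0| ≤ u.1 ^ 2 + u.2 ^ 2 + 0 := by
  rw [add_zero]
  split_ifs
  · exact (abs_of_nonneg (sqNorm_nonneg u)).le
  · rw [abs_zero]
    positivity

lemma abs_contrib_le (i : Fin 2) (u : ℝ × ℝ) : |contrib i u.1 u.2| ≤ u.1 ^ 2 + u.2 ^ 2 + 0 := by
  unfold contrib
  split_ifs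
  · rw [abs_le]
    constructor <;> nlinarith [sq_nonneg (u.1 + u.2), sq_nonneg (u.1 - u.2)]
  · rw [abs_zero]
    positivity

section Rescale

variable {m : ℕ} (θ : Weights m)

lemma sqNorm_rescale (j : Fin m) : sqNorm (rescale θ j) = m * (θ.1 j ^ 2 + θ.2 j ^ 2) := by
  rw [sqNorm, rescale, mul_pow, mul_pow, Real.sq_sqrt (Nat.cast_nonneg m)]
  ring

lemma sum_sqNorm_rescale : ∑ j, sqNorm (rescale θ j) = m * totalMass θ := by
  simp only [sqNorm_rescale, totalMass, Finset.mul_sum]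

variable (hm : 0 < m)
include hm

lemma abs_sqrt_mul_le_iff {x y : ℝ} : |√(m : ℝ) * x| ≤ y ↔ |x| ≤ y / √m := by
  have hs : 0 < √(m : ℝ) := Real.sqrt_pos.2 (Nat.cast_pos.2 hm)
  rw [abs_mul, abs_of_pos hs, le_div_iff₀ hs, mul_comm]

lemma sum_sqNormW_rescale (p : Problem) (h : Hyper) :
    ∑ j, sqNormW p h (rescale θ j) = m * h.massW p θ := by
  rw [Hyper.massW, Finset.mul_sum, Finset.sum_filter]
  refine Finset.sum_congr rfl fun j _ => ?_
  rw [sqNormW, sqNorm_rescale]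
  simp only [rescale, abs_sqrt_mul_le_iff hm]

lemma sum_sqNormV_rescale (h : Hyper) : ∑ j, sqNormV h (rescale θ j) = m * h.massV θ := by
  rw [Hyper.massV, Finset.mul_sum, Finset.sum_filter]
  refine Finset.sum_congr rfl fun j _ => ?_
  rw [sqNormV, sqNorm_rescale]
  simp only [rescale, ← not_le, abs_sqrt_mul_le_iff hm]

lemma cls_sqrt_mul (x : ℝ) : cls (√(m : ℝ) * x) = cls x := by
  have hs : 0 < √(m : ℝ) := Real.sqrt_pos.2 (Nat.cast_pos.2 hm)
  unfold cls
  simp only [mul_nonneg_iff_of_pos_left hs]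

lemma sum_contrib_rescale (i : Fin 2) :
    ∑ j, contrib i (rescale θ j).1 (rescale θ j).2 = m * gains θ i := by
  rw [gains_apply, Finset.mul_sum]
  refine Finset.sum_congr rfl fun j _ => ?_
  simp only [rescale, contrib, cls_sqrt_mul hm]
  split_ifs
  · rw [mul_mul_mul_comm, Real.mul_self_sqrt (Nat.cast_nonneg m)]
  · simp

lemma sum_indicator_rescale (h : Hyper) (i : Fin 2) :
    ∑ j, (goodRange h i).indicator (fun _ => (1 : ℝ)) (rescale θ j)
      = (Finset.card {j | cls (θ.1 j) = i ∧ h.tau / √m ≤ |θ.1 j| ∧ |θ.1 j| ≤ h.W / √m ∧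
        |θ.2 j| ≤ h.V / √m} : ℕ) := by
  classical
  have hs : 0 < √(m : ℝ) := Real.sqrt_pos.2 (Nat.cast_pos.2 hm)
  rw [Finset.card_filter, Nat.cast_sum]
  refine Finset.sum_congr rfl fun j _ => ?_
  have hiff : rescale θ j ∈ goodRange h i ↔ cls (θ.1 j) = i ∧ h.tau / √m ≤ |θ.1 j| ∧
      |θ.1 j| ≤ h.W / √m ∧ |θ.2 j| ≤ h.V / √m := by
    simp only [goodRange, rescale, Set.mem_prod, Set.mem_ofPred_eq, cls_sqrt_mul hm,
      abs_sqrt_mul_le_iff hm, and_assoc]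
    rw [abs_mul, abs_of_pos hs, div_le_iff₀ hs, mul_comm |θ.1 j|]
  rw [Set.indicator_apply]
  simp only [hiff]
  split_ifs <;> simp

end Rescale

/-- Expectations of empirical means over the initialization. -/
lemma integral_initLaw {β : ℝ} (hβ : 0 < β) {m : ℕ} (hm : 0 < m) {f : ℝ × ℝ → ℝ}
    (hf : Measurable f) (hi : Integrable f (baseLaw β)) {g : Weights m → ℝ}
    (hg : ∀ θ, ∑ j, f (rescale θ j) = m * g θ) :
    ∫ θ, g θ ∂(initLaw β m) = ∫ u, f u ∂(baseLaw β) := by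
  have hmp := measurePreserving_rescale hβ hm
  have h1 : (m : ℝ) * ∫ θ, g θ ∂(initLaw β m) = m * ∫ u, f u ∂(baseLaw β) := by
    rw [← integral_const_mul, ← integral_sample_sum hi, ← hmp.map_eq,
      integral_map hmp.measurable.aemeasurable
        (measurable_sample_sum hf m).aestronglyMeasurable]
    simp only [hg]
  exact mul_left_cancel₀ (Nat.cast_pos.2 hm).ne' h1

/-- The right side does not involve `m`, so the threshold conditions hold for all positive widths or
for none. -/
lemma thresholdsOK_iff (p : Problem) {h : Hyper} (hβ : 0 < h.β) {m : ℕ} (hm : 0 < m) :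
    h.ThresholdsOK p m ↔ ∫ u, sqNormW p h u ∂(baseLaw h.β) < h.Mw ∧
      ∫ u, sqNormV h u ∂(baseLaw h.β) < h.Mv := by
  rw [Hyper.ThresholdsOK, integral_initLaw hβ hm (measurable_sqNormW p h)
      (integrable_of_quadratic (measurable_sqNormW p h) fun u => abs_ite_sqNorm_le _ u)
      fun θ => sum_sqNormW_rescale θ hm p h,
    integral_initLaw hβ hm (measurable_sqNormV h)
      (integrable_of_quadratic (measurable_sqNormV h) fun u => abs_ite_sqNorm_le _ u)
      fun θ => sum_sqNormV_rescale θ hm h]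

lemma expSmall_of_quadratic {β M D : ℝ} {f : ℝ × ℝ → ℝ} (hf : Measurable f)
    (h : ∀ u, |f u| ≤ u.1 ^ 2 + u.2 ^ 2 + D) (hM : ∫ u, f u ∂(baseLaw β) < M) :
    ExpSmall (baseLaw β) fun m => {ζ | M * m ≤ ∑ j, f (ζ j)} :=
  expSmall_sum hf (zero_mem_interior_integrableExpSet hf h) hM

section Main

variable {p : Problem} {ρ : Measure ℝ} {δ₀ : ℝ} (A : Admissible p δ₀ ρ)
include A

/-- Small gains are safe and have a small cost gap. -/
lemma Admissible.exists_small_gains {Δ : ℝ}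
    (hΔ : cost p ρ (fun _ => 0) - optCost p ρ < Δ) :
    ∃ t, 0 < t ∧ ∀ K : EuclideanSpace ℝ (Fin 2), (∀ i, |K i| ≤ t) →
      K ∈ margin p p.δ ∧ gainCost p ρ K - optCost p ρ ≤ Δ := by
  have ha : |p.a| < 1 - p.δ := by linarith [A.ha, A.hδ₀]
  have h0 : (0 : EuclideanSpace ℝ (Fin 2)) ∈ margin p (p.δ / 2) := by
    have := A.hδ
    constructor <;> simp <;> linarith
  have hlaw : gainLaw 0 = fun _ => 0 := by
    ext x
    simp [gainLaw]
  have hcost : gainCost p ρ 0 - optCost p ρ < Δ := by rwa [gainCost, hlaw]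
  have hcont := (A.hasGradientAt_margin h0).continuousAt.sub_const (optCost p ρ)
  have e1 := hcont.eventually (gt_mem_nhds hcost)
  have e2 : ∀ i : Fin 2, ∀ᶠ K in 𝓝 (0 : EuclideanSpace ℝ (Fin 2)),
      |p.a + p.b * K i| < 1 - p.δ := by
    intro i
    have hc : Continuous fun K : EuclideanSpace ℝ (Fin 2) => |p.a + p.b * K i| := by fun_prop
    exact hc.continuousAt.eventually (gt_mem_nhds (by simpa using ha))
  obtain ⟨t, ht, hball⟩ := Metric.eventually_nhds_iff_ball.1 (e1.and ((e2 0).and (e2 1)))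
  -- Two coordinates of size at most `t / 3` keep the norm below `t`.
  refine ⟨t / 3, by positivity, fun K hK => ?_⟩
  have hn : ‖K‖ ≤ |K 0| + |K 1| := by
    rw [EuclideanSpace.norm_eq, Real.sqrt_le_left (by positivity), Fin.sum_univ_two]
    simp only [Real.norm_eq_abs]
    nlinarith [mul_nonneg (abs_nonneg (K 0)) (abs_nonneg (K 1))]
  obtain ⟨g1, g2, g3⟩ := hball K (by
    rw [mem_ball_zero_iff]
    linarith [hK 0, hK 1])
  exact ⟨⟨g2.le, g3.le⟩, g1.le⟩

/-- Each requirement fails only if an empirical mean exceeds a level strictly above its expectation.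
The slack comes from `ε`, from the strict thresholds, and from the radius `t` around zero gains. -/
lemma Admissible.exists_goodInit {h : Hyper} (hs : 0 < h.s) (hsS : h.s < h.S) (hV : 0 < h.V)
    (hβ : 0 < h.β) (hε0 : 0 < h.ε) (hε1 : h.ε < 1)
    (hΔ : cost p ρ (fun _ => 0) - optCost p ρ < h.Δ)
    (hMw : ∫ u, sqNormW p h u ∂(baseLaw h.β) < h.Mw)
    (hMv : ∫ u, sqNormV h u ∂(baseLaw h.β) < h.Mv) :
    ∃ C, 0 < C ∧ ∃ m₀ : ℕ, ∀ m ≥ m₀, 0 < m → ∃ E : Set (Weights m), MeasurableSet E ∧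
      1 - Real.exp (-C * m) ≤ (initLaw h.β m).real E ∧ ∀ θ ∈ E, GoodInit p ρ h θ := by
  obtain ⟨t, ht, hsmall⟩ := A.exists_small_gains hΔ
  have hc := Hyper.c_pos hsS hV hβ hε1
  have s1 : ExpSmall (baseLaw h.β) fun m => {ζ | h.RstarSq * m ≤ ∑ j, sqNorm (ζ j)} := by
    refine expSmall_of_quadratic (D := 0) measurable_sqNorm
      (fun u => by simpa using abs_ite_sqNorm_le True u) ?_
    simp only [sqNorm]
    rw [integral_sq_add_sq_baseLaw hβ, Hyper.RstarSq]
    have : 0 < (h.β ^ 2)⁻¹ + h.β := by positivity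
    nlinarith
  have s2 := expSmall_of_quadratic (measurable_sqNormW p h) (fun u => abs_ite_sqNorm_le _ u) hMw
  have s3 := expSmall_of_quadratic (measurable_sqNormV h) (fun u => abs_ite_sqNorm_le _ u) hMv
  have s4 : ∀ i : Fin 2, ExpSmall (baseLaw h.β) fun m =>
      {ζ | t * m ≤ ∑ j, contrib i (ζ j).1 (ζ j).2} := fun i =>
    expSmall_of_quadratic (measurable_contrib i) (abs_contrib_le i)
      (by rw [integral_contrib_baseLaw]; exact ht)
  have s5 : ∀ i : Fin 2, ExpSmall (baseLaw h.β) fun m =>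
      {ζ | t * m ≤ ∑ j, -contrib i (ζ j).1 (ζ j).2} := fun i =>
    expSmall_of_quadratic (f := fun u => -contrib i u.1 u.2) (measurable_contrib i).neg
      (fun u => by rw [abs_neg]; exact abs_contrib_le i u)
      (by rw [integral_neg, integral_contrib_baseLaw, neg_zero]; exact ht)
  have s6 : ∀ i : Fin 2, ExpSmall (baseLaw h.β) fun m =>
      {ζ | -h.c * m ≤ ∑ j, -(goodRange h i).indicator (fun _ => (1 : ℝ)) (ζ j)} := by
    intro i
    refine expSmall_of_quadratic (f := fun u => -(goodRange h i).indicator (fun _ => (1 : ℝ)) u)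
      (D := 1) (measurable_const.indicator (measurableSet_goodRange h i)).neg (fun u => ?_) ?_
    · classical
      rw [abs_neg, Set.indicator_apply]
      split_ifs
      · rw [abs_one]; nlinarith [sq_nonneg u.1, sq_nonneg u.2]
      · rw [abs_zero]; positivity
    · rw [integral_neg, integral_indicator_const _ (measurableSet_goodRange h i),
        baseLaw_goodRange hs hsS hV hβ, smul_eq_mul, mul_one, neg_lt_neg_iff]
      rw [Hyper.c, mul_assoc] at hc ⊢
      have : 0 < (Phi h.S - Phi h.s) * (2 * Phi (h.V * h.β) - 1) :=
        pos_of_mul_pos_right hc (by linarith)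
      nlinarith
  obtain ⟨hmeas, C, hC, m₀, hm₀⟩ := ((s1.union s2).union s3).union
    (((s4 0).union (s4 1)).union (((s5 0).union (s5 1)).union ((s6 0).union (s6 1))))
  refine ⟨C, hC, m₀, fun m hm hmpos => ?_⟩
  have hmp := measurePreserving_rescale hβ hmpos
  have hmR : (0 : ℝ) < m := Nat.cast_pos.2 hmpos
  refine ⟨rescale ⁻¹' _ᶜ, hmp.measurable (hmeas m).compl, ?_, ?_⟩
  · rw [hmp.measureReal_preimage (hmeas m).compl.nullMeasurableSet,
      probReal_compl_eq_one_sub (hmeas m)]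
    linarith [hm₀ m hm]
  intro θ hθ
  simp only [Set.mem_preimage, Set.mem_compl_iff, Set.mem_union, Set.mem_ofPred_eq, not_or,
    not_le] at hθ
  obtain ⟨⟨⟨t1, t2⟩, t3⟩, ⟨t4, t4'⟩, ⟨t5, t5'⟩, t6, t6'⟩ := hθ
  rw [sum_sqNorm_rescale, mul_comm, mul_lt_mul_iff_left₀ hmR] at t1
  rw [sum_sqNormW_rescale θ hmpos, mul_comm, mul_lt_mul_iff_left₀ hmR] at t2
  rw [sum_sqNormV_rescale θ hmpos, mul_comm, mul_lt_mul_iff_left₀ hmR] at t3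
  rw [sum_contrib_rescale θ hmpos, mul_comm, mul_lt_mul_iff_left₀ hmR] at t4 t4'
  rw [Finset.sum_neg_distrib, sum_contrib_rescale θ hmpos, ← mul_neg, mul_comm,
    mul_lt_mul_iff_left₀ hmR] at t5 t5'
  rw [Finset.sum_neg_distrib, sum_indicator_rescale θ hmpos, neg_mul, neg_lt_neg_iff] at t6 t6'
  have hgains : ∀ i, |gains θ i| ≤ t :=
    Fin.forall_fin_two.2 ⟨abs_le.2 ⟨by linarith, t4.le⟩, abs_le.2 ⟨by linarith, t4'.le⟩⟩
  exact
    { safe := (hsmall _ hgains).1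
      gap := (hsmall _ hgains).2
      mass := t1.le
      massW := t2.le
      massV := t3.le
      good := Fin.forall_fin_two.2 ⟨t6.le, t6'.le⟩ }

lemma Admissible.zero_gap_nonneg : 0 ≤ cost p ρ (fun _ => 0) - optCost p ρ := by
  have h0 : (0 : EuclideanSpace ℝ (Fin 2)) ∈ margin p (p.δ / 2) := by
    have := A.hδ
    have := A.ha
    have := A.hδ₀
    constructor <;> simp <;> linarith
  have hlaw : gainLaw 0 = fun _ => 0 := by
    ext x
    simp [gainLaw]
  have := A.gap_nonneg h0
  rwa [gainCost, hlaw] at this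

end Main

end ReLULQR

end

/-! ### The main theorem. -/

theorem theorem1 (p : ReLULQR.Problem) (δ₀ : ℝ)
    (ρ : MeasureTheory.Measure ℝ) [MeasureTheory.IsProbabilityMeasure ρ]
    (hq : 0 < p.q) (hr : 0 < p.r) (hγ0 : 0 < p.γ) (hγ1 : p.γ < 1)
    (hb : p.b ≠ 0) (ha : |p.a| ≤ 1 - δ₀)
    (hδ : 0 < p.δ) (hδ₀ : p.δ < δ₀)
    (hσ : 0 < p.σ)
    (hpos : ∫ x in Set.Ici 0, x ^ 2 ∂ρ = p.σ ^ 2 / 2)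
    (hneg : ∫ x in Set.Iio 0, x ^ 2 ∂ρ = p.σ ^ 2 / 2)
    (hP : ReLULQR.IsRiccati p) :
    (∀ K : ℝ, ReLULQR.IsOptimalGain p ρ K ↔ K = p.Kstar) ∧
    (∃ L α : ℝ, 0 < L ∧ 0 < α ∧ ReLULQR.IsSmoothConst p ρ L ∧ ReLULQR.IsPLConst p ρ α) ∧
    ∀ (h : ReLULQR.Hyper) (ι : ℝ),
      0 < h.L → ReLULQR.IsSmoothConst p ρ h.L →
      0 < h.α → ReLULQR.IsPLConst p ρ h.α →
      0 < h.s → h.s < h.S → 0 < h.V → 0 < h.β → 0 < h.ε → h.ε < 1 →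
      ReLULQR.cost p ρ (fun _ => 0) - ReLULQR.optCost p ρ < h.Δ →
      0 < ι → ι < 1 / h.L →
      ∃ C₀ : ℝ, 0 < C₀ ∧ ∃ m₀ : ℕ, ∀ m : ℕ, m₀ ≤ m →
        h.ThresholdsOK p m → h.Benign p ι m →
        0 ≤ h.rate ι m ∧ h.rate ι m < 1 ∧
        ∃ E : Set (ReLULQR.Weights m), MeasurableSet E ∧
          1 - Real.exp (-C₀ * m) ≤ (ReLULQR.initLaw h.β m).real E ∧
          ∀ θ₀ ∈ E, ∀ k : ℕ,
            ReLULQR.WellPosed p ρ (ReLULQR.iter p ρ (ι / m) θ₀ k) ∧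
            ReLULQR.gains (ReLULQR.iter p ρ (ι / m) θ₀ k) ∈ ReLULQR.margin p (p.δ / 2) ∧
            ReLULQR.cost p ρ (ReLULQR.net (ReLULQR.iter p ρ (ι / m) θ₀ k))
                - ReLULQR.optCost p ρ
              ≤ h.rate ι m ^ k
                * (ReLULQR.cost p ρ (ReLULQR.net θ₀) - ReLULQR.optCost p ρ) ∧
            ‖ReLULQR.gains (ReLULQR.iter p ρ (ι / m) θ₀ k) - ReLULQR.optGains p‖ ^ 2
              ≤ (ReLULQR.cost p ρ (ReLULQR.net θ₀) - ReLULQR.optCost p ρ) / p.growth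
                * h.rate ι m ^ k := by
  have A : ReLULQR.Admissible p δ₀ ρ :=
    ⟨hq, hr, hγ0, hγ1, hb, ha, hδ, hδ₀, hσ, hpos, hneg, hP⟩
  refine ⟨A.isOptimalGain_iff, ?_, ?_⟩
  · obtain ⟨L, hL, hL'⟩ := A.exists_isSmoothConst
    exact ⟨L, _, hL, A.PLConst_pos, hL', A.isPLConst⟩
  intro h ι hL0 hL hα0 hα hs hsS hV hβ hε0 hε1 hΔ hι _
  -- The constants must be chosen before `m`. If the width-free threshold conditions fail, no `m ≥
  -- 1` satisfies `ThresholdsOK` and the claim is vacuous.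
  by_cases hT : ∫ u, ReLULQR.sqNormW p h u ∂(ReLULQR.baseLaw h.β) < h.Mw ∧
      ∫ u, ReLULQR.sqNormV h u ∂(ReLULQR.baseLaw h.β) < h.Mv
  swap
  · exact ⟨1, one_pos, 1, fun m hm hth _ =>
      absurd ((ReLULQR.thresholdsOK_iff p hβ (by omega)).1 hth) hT⟩
  obtain ⟨C, hC, m₀, hE⟩ := A.exists_goodInit hs hsS hV hβ hε0 hε1 hΔ hT.1 hT.2
  refine ⟨C, hC, max m₀ 1, fun m hm _ hBen => ?_⟩
  have hm0 : 0 < m := lt_of_lt_of_le one_pos (le_trans (le_max_right _ _) hm)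
  have hmR : (0 : ℝ) < m := Nat.cast_pos.2 hm0
  have hc := ReLULQR.Hyper.c_pos hsS hV hβ hε1
  have htau : 0 < h.tau := mul_pos hs (Real.sqrt_pos.2 hβ)
  have hlam : 0 < h.lamStar := by unfold ReLULQR.Hyper.lamStar; positivity
  have hrate := ReLULQR.rate_eq h hβ ι m
  have hdec : 0 < ι / m * h.lamStar * h.α := by positivity
  refine ⟨by rw [hrate]; linarith [hBen.2.1], by rw [hrate]; linarith, ?_⟩
  obtain ⟨E, hEm, hEp, hEg⟩ := hE m (le_trans (le_max_left _ _) hm) hm0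
  refine ⟨E, hEm, hEp, fun θ₀ hθ k => ?_⟩
  obtain ⟨c1, c2⟩ := A.converges hm0 hι hL0 hL hα0 hα hs hV hβ hc
    (A.zero_gap_nonneg.trans hΔ.le) hBen (hEg θ₀ hθ) k k le_rfl
  refine ⟨ReLULQR.wellPosed _ A c1, c1, ?_, ?_⟩
  · rw [ReLULQR.cost_net, ReLULQR.cost_net]
    exact c2
  · have hg := A.growth_pos
    -- Quadratic growth turns decay of the cost gap into decay of the gain error.
    have h1 := A.growth_mul_le (A.contr_zero c1) (A.contr_one c1)
    rw [ReLULQR.cost_net, div_mul_eq_mul_div, le_div_iff₀ hg]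
    linarith
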